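/- **Theorem.** Let $n\ge 2$, let $S^n$ be the unit sphere in $\mathbb R^{n+1}$, write $x=(x',x_{n+1})$ with $x'\in\mathbb R^n$, and let $f$ be a (real- or complex-valued) function on $S^n$ that is even in the last variable, $f(x',-x_{n+1})=f(x',x_{n+1})$. Suppose that for some $0<\lambda\le 1$ the function $$x'\mapsto \frac{f(x',\sqrt{1-|x'|^2})}{\sqrt{1-|x'|^2}},\qquad |x'|<1,$$ satisfies a Lipschitz condition with exponent $\lambda$ on $\{|x'|<1\}$, i.e. there is $A>0$ such that its values at $x',y'$ differ by at most $A|x'-y'|^\lambda$. For $\theta\in S^{n-1}$ and $-1<t<1$ let $$(V_+f)(\theta,t)=\int_{\{x\in S^n:\ x_{n+1}\ge 0,\ x'\cdot\theta=t\}} f\,d\sigma,\qquad \Phi(\theta,t)=(1-t^2)^{-1/2}(V_+f)(\theta,t),$$ where $d\sigma$ is the surface measure of the $(n-1)$-dimensional sphere $\{x\in S^n: x'\cdot\theta=t\}$, and for functions $\Psi$ of $(\theta,t)$ let $$(R^*\Psi)(x')=\frac{1}{\sigma_{n-1}}\int_{S^{n-1}}\Psi(\theta,x'\cdot\theta)\,d\sigma(\theta),\quad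 \sigma_{n-1}=\frac{2\pi^{n/2}}{\Gamma(n/2)},\qquad (L\Psi)(\theta,s)=\int_{-1}^1\log|s-t|\,\Psi(\theta,t)\,dt .$$ Then for every $x\in S^n$ with $x_{n+1}\ne 0$ $$f(x)=|x_{n+1}|\,\varphi(x'),$$ where, for $|x'|<1$, $$\varphi=c_n(-\Delta)^{(n-1)/2}R^*\Phi,\quad c_n=\frac{\pi^{1-n/2}}{2^{n-1}\Gamma(n/2)}\quad\text{if $n$ is odd},$$ $$\varphi=\tilde c_n(-\Delta)^{n/2}R^*L\Phi,\quad \tilde c_n=-\frac{\pi^{-n/2}}{2^{n-1}\Gamma(n/2)}\quad\text{if $n$ is even}.$$ Here $\Delta$ is the Laplacian on $\mathbb R^n$ and its iterates exist in the classical sense: with $m=(n-1)/2$, $u=R^*\Phi$ for odd $n$ and $m=n/2$, $u=R^*L\Phi$ for even $n$, the functions $(-\Delta)^k u$, $0\le k<m$, are twice continuously differentiable on $\{|x'|<1\}$. -/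

import Mathlib

open MeasureTheory Metric

noncomputable section

namespace VerticalSlice

/-- The horizontal part `x' ∈ ℝⁿ` of a point `x = (x', x_{n+1}) ∈ ℝⁿ⁺¹`. -/
def horiz {n : ℕ} (x : EuclideanSpace ℝ (Fin (n + 1))) : EuclideanSpace ℝ (Fin n) :=
  WithLp.toLp 2 (fun i : Fin n => x i.castSucc)

/-- The point `(x', s) ∈ ℝⁿ⁺¹` with horizontal part `x' ∈ ℝⁿ` and last coordinate `s`. -/
def mkPoint {n : ℕ} (x' : EuclideanSpace ℝ (Fin n)) (s : ℝ) : EuclideanSpace ℝ (Fin (n + 1)) :=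
  WithLp.toLp 2 (Fin.snoc (α := fun _ : Fin (n + 1) => ℝ) (fun i : Fin n => x' i) s)

/-- `φ ∈ Lip_lam(G)`: there is `A > 0` with `|φ(x') - φ(y')| ≤ A |x' - y'| ^ lam` on `G`. -/
def IsLip {n : ℕ} {𝕜 : Type*} [RCLike 𝕜] (lam : ℝ) (φ : EuclideanSpace ℝ (Fin n) → 𝕜)
    (G : Set (EuclideanSpace ℝ (Fin n))) : Prop :=
  ∃ A : ℝ, 0 < A ∧ ∀ x ∈ G, ∀ y ∈ G, ‖φ x - φ y‖ ≤ A * ‖x - y‖ ^ lam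

/-- The function `x' ↦ f(x', √(1 - |x'|²)) / √(1 - |x'|²)`, meaningful for `|x'| < 1`. -/
def hemisphereQuotient {n : ℕ} {𝕜 : Type*} [RCLike 𝕜] (f : EuclideanSpace ℝ (Fin (n + 1)) → 𝕜)
    (x' : EuclideanSpace ℝ (Fin n)) : 𝕜 :=
  (√(1 - ‖x'‖ ^ 2))⁻¹ • f (mkPoint x' √(1 - ‖x'‖ ^ 2))

/-- The upper half-space `{x ∈ ℝⁿ⁺¹ : x_{n+1} ≥ 0}`; it meets the unit sphere in the closed upper
hemisphere. -/
def upperHalf (n : ℕ) : Set (EuclideanSpace ℝ (Fin (n + 1))) :=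
  {x | 0 ≤ x (Fin.last n)}

/-- The (`n`-dimensional) space of directions of the vertical hyperplanes `x' ⬝ θ = t`: the
orthogonal complement of `(θ, 0)` in `ℝⁿ⁺¹`. -/
abbrev verticalDirection {n : ℕ} (θ : EuclideanSpace ℝ (Fin n)) :
    Submodule ℝ (EuclideanSpace ℝ (Fin (n + 1))) :=
  (Submodule.span ℝ {mkPoint θ 0})ᗮ

/-- The surface measure of the vertical slice `τ = {x ∈ Sⁿ : x' ⬝ θ = t}`, `|θ| = 1`, `|t| < 1`.
The slice is the `(n-1)`-dimensional sphere with centre `(tθ, 0)` and radius `r = √(1 - t²)` in the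
hyperplane `x' ⬝ θ = t`, so its surface measure is `r ^ (n - 1)` times the image of the surface
measure `volume.toSphere` of the unit sphere of `(θ, 0)ᗮ` under `ω ↦ (tθ, 0) + r ω`.
For `|t| ≥ 1` and `n ≥ 2` this is the zero measure. -/
def sliceMeasure {n : ℕ} (θ : EuclideanSpace ℝ (Fin n)) (t : ℝ) :
    Measure (EuclideanSpace ℝ (Fin (n + 1))) :=
  ENNReal.ofReal (√(1 - t ^ 2) ^ (n - 1)) •
    ((volume : Measure (verticalDirection θ)).toSphere).map
      (fun ω : sphere (0 : verticalDirection θ) 1 =>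
        mkPoint (t • θ) 0 + √(1 - t ^ 2) • ((ω : verticalDirection θ) : EuclideanSpace ℝ (Fin (n + 1))))

/-- The hemispherical vertical slice transform `(V₊f)(θ, t)`: the integral of `f` over the part
of the slice that lies in the closed upper hemisphere, against the surface measure of the slice. -/
def verticalSlice {n : ℕ} {𝕜 : Type*} [RCLike 𝕜] (f : EuclideanSpace ℝ (Fin (n + 1)) → 𝕜)
    (θ : EuclideanSpace ℝ (Fin n)) (t : ℝ) : 𝕜 :=
  ∫ x in upperHalf n, f x ∂(sliceMeasure θ t)

/-- `Φ(θ, t) = (1 - t²)^{-1/2} (V₊f)(θ, t)`. -/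
def normalizedSlice {n : ℕ} {𝕜 : Type*} [RCLike 𝕜] (f : EuclideanSpace ℝ (Fin (n + 1)) → 𝕜)
    (θ : EuclideanSpace ℝ (Fin n)) (t : ℝ) : 𝕜 :=
  (√(1 - t ^ 2))⁻¹ • verticalSlice f θ t

/-- The dual Radon transform
`(R*Φ)(x') = σ_{n-1}⁻¹ ∫_{S^{n-1}} Φ(θ, x' ⬝ θ) dσ(θ)`, `σ_{n-1} = 2 π^{n/2} / Γ(n/2)`. -/
def dualRadon {n : ℕ} {𝕜 : Type*} [RCLike 𝕜] (Φ : EuclideanSpace ℝ (Fin n) → ℝ → 𝕜)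
    (x' : EuclideanSpace ℝ (Fin n)) : 𝕜 :=
  (2 * Real.pi ^ ((n : ℝ) / 2) / Real.Gamma ((n : ℝ) / 2))⁻¹ •
    ∫ θ : sphere (0 : EuclideanSpace ℝ (Fin n)) 1,
      Φ (θ : EuclideanSpace ℝ (Fin n)) (inner ℝ x' (θ : EuclideanSpace ℝ (Fin n)))
        ∂((volume : Measure (EuclideanSpace ℝ (Fin n))).toSphere)

/-- `(LΦ)(θ, s) = ∫_{-1}^{1} log |s - t| Φ(θ, t) dt`. -/
def logTransform {n : ℕ} {𝕜 : Type*} [RCLike 𝕜] (Φ : EuclideanSpace ℝ (Fin n) → ℝ → 𝕜)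
    (θ : EuclideanSpace ℝ (Fin n)) (s : ℝ) : 𝕜 :=
  ∫ t in (-1 : ℝ)..1, Real.log |s - t| • Φ θ t

/-- The operator `-Δ` on functions on `ℝⁿ`. -/
def negLaplacian {n : ℕ} {𝕜 : Type*} [RCLike 𝕜] (u : EuclideanSpace ℝ (Fin n) → 𝕜) :
    EuclideanSpace ℝ (Fin n) → 𝕜 :=
  fun x => -(Laplacian.laplacian u x)

/-- The constant of the inversion formula in odd dimension, `π^{1 - n/2} / (2^{n-1} Γ(n/2))`. -/
def oddConst (n : ℕ) : ℝ :=
  Real.pi ^ (1 - (n : ℝ) / 2) / (2 ^ (n - 1) * Real.Gamma ((n : ℝ) / 2))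

/-- The constant of the inversion formula in even dimension, `-π^{-n/2} / (2^{n-1} Γ(n/2))`. -/
def evenConst (n : ℕ) : ℝ :=
  -(Real.pi ^ (-(n : ℝ) / 2) / (2 ^ (n - 1) * Real.Gamma ((n : ℝ) / 2)))

/-- The iterated Laplacian `(-Δ)^m u` exists in the classical sense on `U`: each application of
`-Δ` is to a function that is twice continuously differentiable on `U`. -/
def HasClassicalLaplacianPow {n : ℕ} {𝕜 : Type*} [RCLike 𝕜] (m : ℕ)
    (u : EuclideanSpace ℝ (Fin n) → 𝕜) (U : Set (EuclideanSpace ℝ (Fin n))) : Prop :=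
  ∀ k < m, ContDiffOn ℝ 2 (negLaplacian^[k] u) U

end VerticalSlice

end

/-! Let `φ` be the hemisphere quotient of `f`, extended by zero outside the unit ball (`zeroExt`).
On the upper hemisphere `f = x_{n+1} φ(x')`. A vertical slice at distance `t` is a sphere of radius
`r = √(1 - t²)`, and projecting its upper half to the hyperplane `x' ⬝ θ = t` turns surface measure
into `r / x_{n+1}` times Lebesgue measure. The height cancels, `r` is removed by the normalization,
and `Φ` is exactly the Radon transform of `φ` (`normalizedSlice_eq_radon`). What remains is Radon
inversion for a density that is Hölder inside the ball but may jump at the unit sphere, hence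
identities on the open ball only.

Backprojecting a Radon transform is convolution with a multiple of `|z|⁻¹`
(`integral_sphere_radon`). To see this, integrate `|z|⁻¹ ψ(x + z)` over the cone of half-opening `s`
around `θᗮ`. Averaged over `θ`, Fubini and rotation invariance give a number times the full
integral; divided by `s`, as `s → 0`, the cone integral tends to twice the integral over the
hyperplane. The number is calibrated on the indicator of the ball. With the logarithmic transform in
between, Fubini leaves `∫ log |z ⬝ θ| dσ(θ)`, which is `σ_{n-1} log |z|` plus a constant
(`integral_sphere_log_radon`).

So the function to be differentiated is a potential of `φ` with kernel `|z|⁻¹` (odd `n`) or `log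
|z|` up to an additive constant (even `n`). A Laplacian sends `|z|^(-2p)` to a multiple of
`|z|^(-2p-2)` as long as the latter is integrable (`laplacian_potential_of_lt`); at the Newtonian
exponent it becomes local and returns a multiple of the density (`laplacian_potential_of_eq`).
Classical `C²` regularity, including that borderline case, comes from `contDiffOn_potential`:
kernels are smoothed by replacing `|z|²` with `|z|² + ε²`, and first and second derivatives converge
locally uniformly. The Hessian kernel may be as singular as `|z|⁻ⁿ`; Hölder continuity compensates
after subtracting `ψ x` near the singularity, and the subtracted term is a scalar matrix by
symmetry. Iterating (`isLaplacianPow_potential`) and checking constants gives the formulas. -/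

noncomputable section

set_option linter.unusedSectionVars false

namespace VerticalSlice

open Set Module Filter
open scoped ENNReal Pointwise Topology

/-! ### Rotation invariance of the surface measure and polar coordinates. -/

section SphereMeasure

variable {E : Type*} [NormedAddCommGroup E] [InnerProductSpace ℝ E] [FiniteDimensional ℝ E]
  [MeasurableSpace E] [BorelSpace E]

/-- A linear isometry equivalence restricted to the unit sphere. -/
def sphereEquiv (A : E ≃ₗᵢ[ℝ] E) : sphere (0 : E) 1 ≃ᵐ sphere (0 : E) 1 where
  toFun ω := ⟨A ω, by simp⟩
  invFun ω := ⟨A.symm ω, by simp⟩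
  left_inv ω := by simp
  right_inv ω := by simp
  measurable_toFun := by
    refine Measurable.subtype_mk ?_
    exact A.continuous.measurable.comp measurable_subtype_coe
  measurable_invFun := by
    refine Measurable.subtype_mk ?_
    exact A.symm.continuous.measurable.comp measurable_subtype_coe

/-- `toSphere` measures a set by the volume of the cone over it, and a linear isometry carries cones
to cones of equal volume. -/
lemma measurePreserving_sphereEquiv (A : E ≃ₗᵢ[ℝ] E) :
    MeasurePreserving (sphereEquiv A) (volume : Measure E).toSphere
      (volume : Measure E).toSphere := by
  refine ⟨(sphereEquiv A).measurable, ?_⟩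
  ext s hs
  rw [Measure.map_apply (sphereEquiv A).measurable hs, Measure.toSphere_apply' _ hs,
    Measure.toSphere_apply' _ ((sphereEquiv A).measurable hs),
    ← A.measurePreserving.measure_preimage_equiv (f := A.toMeasurableEquiv)
      (Ioo (0 : ℝ) 1 • (Subtype.val '' s))]
  congr 2
  ext x
  simp only [Set.mem_smul, Set.mem_image, Set.mem_preimage]
  constructor
  · rintro ⟨r, hr, _, ⟨ω, hω, rfl⟩, rfl⟩
    exact ⟨r, hr, _, ⟨_, hω, rfl⟩, by simp [sphereEquiv]⟩
  · rintro ⟨r, hr, _, ⟨ω, hω, rfl⟩, h⟩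
    refine ⟨r, hr, _, ⟨(sphereEquiv A).symm ω, by simpa using hω, rfl⟩, ?_⟩
    apply A.injective
    simpa [sphereEquiv] using h

/-- The reflection in the hyperplane orthogonal to `u - v` does it. -/
lemma exists_isometry_map {u v : E} (h : ‖u‖ = ‖v‖) : ∃ A : E ≃ₗᵢ[ℝ] E, A u = v :=
  ⟨_, Submodule.reflection_sub h⟩

lemma exists_isometry_map_inner {u v : E} (h : ‖u‖ = ‖v‖) :
    ∃ A : E ≃ₗᵢ[ℝ] E, ∀ x, inner ℝ u (A x) = inner ℝ v x := by
  obtain ⟨A, hA⟩ := exists_isometry_map h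
  refine ⟨A.symm, fun x => ?_⟩
  rw [← A.inner_map_map, hA, A.apply_symm_apply]

/-- A rotation moves `u` to `v`. This is what makes the spherical averages of the cone indicator and
of the logarithm independent of the direction of `z`. -/
lemma integral_sphere_inner_eq {F : Type*} [NormedAddCommGroup F] [NormedSpace ℝ F] {u v : E}
    (h : ‖u‖ = ‖v‖) (G : ℝ → F) :
    ∫ ω : sphere (0 : E) 1, G (inner ℝ u (ω : E)) ∂(volume : Measure E).toSphere =
      ∫ ω : sphere (0 : E) 1, G (inner ℝ v (ω : E)) ∂(volume : Measure E).toSphere := by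
  obtain ⟨A, hA⟩ := exists_isometry_map_inner h
  rw [← (measurePreserving_sphereEquiv A).integral_comp (sphereEquiv A).measurableEmbedding]
  congr 1 with ω
  exact congrArg G (hA ω)

lemma integrable_sphere_inner_iff {F : Type*} [NormedAddCommGroup F] {u v : E}
    (h : ‖u‖ = ‖v‖) (G : ℝ → F) :
    Integrable (fun ω : sphere (0 : E) 1 => G (inner ℝ u (ω : E))) (volume : Measure E).toSphere ↔
      Integrable (fun ω : sphere (0 : E) 1 => G (inner ℝ v (ω : E)))
        (volume : Measure E).toSphere := by
  obtain ⟨A, hA⟩ := exists_isometry_map_inner h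
  rw [← (measurePreserving_sphereEquiv A).integrable_comp_emb (sphereEquiv A).measurableEmbedding]
  refine iff_of_eq ?_
  congr 1 with ω
  exact congrArg G (hA ω)

lemma lintegral_polar [Nontrivial E] {F : E → ℝ≥0∞} (hF : Measurable F) :
    ∫⁻ w, F w = ∫⁻ ω : sphere (0 : E) 1, (∫⁻ r in Ioi (0 : ℝ),
      ENNReal.ofReal (r ^ (finrank ℝ E - 1)) * F (r • (ω : E))) ∂(volume : Measure E).toSphere := by
  have hg : Measurable fun p : sphere (0 : E) 1 × Ioi (0 : ℝ) => F ((p.2 : ℝ) • (p.1 : E)) := by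
    refine hF.comp (Continuous.measurable ?_)
    fun_prop
  calc ∫⁻ w, F w = ∫⁻ w in ({0}ᶜ : Set E), F w := by rw [restrict_compl_singleton]
    _ = ∫⁻ x : ({(0)}ᶜ : Set E), F x ∂((volume : Measure E).comap (↑)) := by
        rw [lintegral_subtype_comap (measurableSet_singleton _).compl]
    _ = ∫⁻ p, F ((p.2 : ℝ) • (p.1 : E))
          ∂((volume : Measure E).toSphere.prod (.volumeIoiPow (finrank ℝ E - 1))) := by
        rw [← (Measure.measurePreserving_homeomorphUnitSphereProd
          (volume : Measure E)).lintegral_comp_emb (Homeomorph.measurableEmbedding _)]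
        refine lintegral_congr fun x => ?_
        congr 1
        have : (x : E) ≠ 0 := x.2
        simp [smul_smul, mul_inv_cancel₀ (norm_ne_zero_iff.2 this)]
    _ = _ := by
        rw [lintegral_prod _ hg.aemeasurable]
        refine lintegral_congr fun ω => ?_
        have hm : Measurable fun r : ℝ => F (r • (ω : E)) :=
          hF.comp (Continuous.measurable (by fun_prop))
        rw [Measure.volumeIoiPow, lintegral_withDensity_eq_lintegral_mul₀]
        · rw [← lintegral_subtype_comap measurableSet_Ioi]
          rfl
        · exact (measurable_subtype_coe.pow_const _).ennreal_ofReal.aemeasurable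
        · exact (hm.comp measurable_subtype_coe).aemeasurable

lemma lintegral_Ioo_rpow (n : ℕ) :
    ∫⁻ r in Ioo (0 : ℝ) 1, ENNReal.ofReal (r ^ n) = ((n + 1 : ℕ) : ℝ≥0∞)⁻¹ := by
  rw [Measure.restrict_congr_set Ioo_ae_eq_Ioc,
    ← ofReal_integral_eq_lintegral_ofReal (intervalIntegral.intervalIntegrable_pow _).1,
    ← intervalIntegral.integral_of_le zero_le_one]
  · simp [← ENNReal.ofReal_natCast, ENNReal.ofReal_inv_of_pos, Nat.cast_add_one_pos]
    rw [ENNReal.ofReal_add (by positivity) (by positivity)]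
    simp
  · filter_upwards [ae_restrict_mem measurableSet_Ioc] with y hy
    exact pow_nonneg hy.1.le _

/-- In polar coordinates the 0-homogeneous extension of `G` is constant along rays; the dimension
factor undoes `∫₀¹ r^(d-1) dr = 1/d`. -/
lemma lintegral_toSphere [Nontrivial E] {G : E → ℝ≥0∞} (hG : Measurable G) :
    ∫⁻ ω : sphere (0 : E) 1, G ω ∂(volume : Measure E).toSphere =
      finrank ℝ E * ∫⁻ w in ball (0 : E) 1, G (‖w‖⁻¹ • w) := by
  have hm : Measurable fun w : E => G (‖w‖⁻¹ • w) := hG.comp (by fun_prop)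
  have hpos : 0 < finrank ℝ E := finrank_pos
  rw [← lintegral_indicator measurableSet_ball, lintegral_polar (hm.indicator measurableSet_ball),
    ← lintegral_const_mul']
  · refine lintegral_congr fun ω => ?_
    have : ∀ r ∈ Ioi (0 : ℝ), ENNReal.ofReal (r ^ (finrank ℝ E - 1)) *
        (ball (0 : E) 1).indicator (fun w : E => G (‖w‖⁻¹ • w)) (r • (ω : E)) =
        (Ioo (0 : ℝ) 1).indicator
          (fun r => ENNReal.ofReal (r ^ (finrank ℝ E - 1)) * G ω) r := by
      intro r (hr : 0 < r)
      have hn : ‖(ω : E)‖ = 1 := by simp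
      by_cases h1 : r < 1
      · rw [indicator_of_mem, indicator_of_mem]
        · congr 2
          rw [norm_smul, hn, Real.norm_of_nonneg hr.le, smul_smul]
          simp [hr.ne']
        · exact ⟨hr, h1⟩
        · simpa [norm_smul, hn, abs_of_pos hr] using h1
      · rw [indicator_of_notMem, indicator_of_notMem, mul_zero]
        · exact fun h => h1 h.2
        · simpa [norm_smul, hn, abs_of_pos hr] using h1
    rw [setLIntegral_congr_fun measurableSet_Ioi this,
      setLIntegral_indicator measurableSet_Ioo, inter_eq_left.2 Ioo_subset_Ioi_self,
      lintegral_mul_const _ (by fun_prop), lintegral_Ioo_rpow, ← mul_assoc,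
      Nat.sub_add_cancel hpos, ENNReal.mul_inv_cancel (by simpa using hpos.ne') (by simp), one_mul]
  · simp

end SphereMeasure

/-! ### Projection of the upper hemisphere onto the equatorial ball. -/

section Decomposition

variable {H W : Type*} [NormedAddCommGroup H] [InnerProductSpace ℝ H] [FiniteDimensional ℝ H]
  [MeasurableSpace H] [BorelSpace H] [NormedAddCommGroup W] [InnerProductSpace ℝ W]
  [FiniteDimensional ℝ W] [MeasurableSpace W] [BorelSpace W]

lemma measurePreserving_prod (J : WithLp 2 (H × ℝ) ≃ₗᵢ[ℝ] W) :
    MeasurePreserving (fun p : H × ℝ => J (WithLp.toLp 2 p)) volume volume :=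
  J.measurePreserving.comp (WithLp.volume_preserving_toLp H ℝ)

lemma measurableEmbedding_prod (J : WithLp 2 (H × ℝ) ≃ₗᵢ[ℝ] W) :
    MeasurableEmbedding (fun p : H × ℝ => J (WithLp.toLp 2 p)) :=
  J.toMeasurableEquiv.measurableEmbedding.comp
    (MeasurableEquiv.toLp 2 (H × ℝ)).measurableEmbedding

lemma norm_sq_prod (J : WithLp 2 (H × ℝ) ≃ₗᵢ[ℝ] W) (p : H × ℝ) :
    ‖J (WithLp.toLp 2 p)‖ ^ 2 = ‖p.1‖ ^ 2 + p.2 ^ 2 := by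
  rw [J.norm_map, WithLp.prod_norm_sq_eq_of_L2]
  simp

lemma finrank_prod (J : WithLp 2 (H × ℝ) ≃ₗᵢ[ℝ] W) : finrank ℝ W = finrank ℝ H + 1 := by
  rw [← J.toLinearEquiv.finrank_eq, (WithLp.linearEquiv 2 ℝ (H × ℝ)).finrank_eq]
  simp

/-- Substitution `ρ = √(a² + s²)`, for which `dρ = (s / ρ) ds`. -/
lemma lintegral_sqrt_add_sq {a : ℝ} (ha : 0 ≤ a) (k : ℝ → ℝ≥0∞) :
    ∫⁻ s in Ioi (0 : ℝ), ENNReal.ofReal (s / √(a ^ 2 + s ^ 2)) * k √(a ^ 2 + s ^ 2) =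
      ∫⁻ ρ in Ioi a, k ρ := by
  have him : (fun s : ℝ => √(a ^ 2 + s ^ 2)) '' Ioi 0 = Ioi a := by
    ext ρ
    simp only [Set.mem_image, mem_Ioi]
    constructor
    · rintro ⟨s, hs, rfl⟩
      exact Real.lt_sqrt_of_sq_lt (by nlinarith)
    · intro h
      refine ⟨√(ρ ^ 2 - a ^ 2), Real.sqrt_pos.2 (by nlinarith), ?_⟩
      rw [Real.sq_sqrt (by nlinarith), add_sub_cancel, Real.sqrt_sq (ha.trans h.le)]
  rw [← him, lintegral_image_eq_lintegral_abs_deriv_mul measurableSet_Ioi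
    (f' := fun s => s / √(a ^ 2 + s ^ 2))]
  · refine setLIntegral_congr_fun measurableSet_Ioi fun s (hs : 0 < s) => ?_
    rw [abs_of_nonneg (by positivity)]
  · intro s (hs : 0 < s)
    have : HasDerivAt (fun s : ℝ => a ^ 2 + s ^ 2) (2 * s) s := by
      simpa using (hasDerivAt_pow 2 s).const_add (a ^ 2)
    have h2 := this.sqrt (by positivity)
    refine h2.hasDerivWithinAt.congr_deriv ?_
    rw [mul_div_mul_left _ _ two_ne_zero]
  · intro s (hs : 0 < s) t (ht : 0 < t) h
    have := (Real.sqrt_inj (by positivity) (by positivity)).1 h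
    exact (sq_eq_sq₀ hs.le ht.le).1 (by linarith)

lemma lintegral_ball_inv_smul {ρ : ℝ} (hρ : 0 < ρ) {g : H → ℝ≥0∞} (hg : Measurable g) :
    ∫⁻ y in ball (0 : H) ρ, g (ρ⁻¹ • y) =
      ENNReal.ofReal (ρ ^ finrank ℝ H) * ∫⁻ y in ball (0 : H) 1, g y := by
  rw [← lintegral_indicator measurableSet_ball, ← lintegral_indicator measurableSet_ball]
  have h1 : ∀ y : H, (ball (0 : H) ρ).indicator (fun y => g (ρ⁻¹ • y)) y =
      (ball (0 : H) 1).indicator g (ρ⁻¹ • y) := by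
    intro y
    have : y ∈ ball (0 : H) ρ ↔ ρ⁻¹ • y ∈ ball (0 : H) 1 := by
      simp only [mem_ball_zero_iff, norm_smul, norm_inv, Real.norm_of_nonneg hρ.le]
      rw [inv_mul_lt_iff₀ hρ, mul_one]
    by_cases h : y ∈ ball (0 : H) ρ
    · rw [indicator_of_mem h, indicator_of_mem (this.1 h)]
    · rw [indicator_of_notMem h, indicator_of_notMem (fun h' => h (this.2 h'))]
  simp_rw [h1]
  rw [← lintegral_map (hg.indicator measurableSet_ball) (measurable_const_smul ρ⁻¹),
    Measure.map_addHaar_smul _ (inv_ne_zero hρ.ne'), lintegral_smul_measure]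
  congr 2
  rw [inv_pow, inv_inv, abs_of_pos (by positivity)]

/-- Projection of the upper unit hemisphere onto the equatorial unit ball. -/
lemma lintegral_sphere_snd_mul (J : WithLp 2 (H × ℝ) ≃ₗᵢ[ℝ] W) {g : H → ℝ≥0∞}
    (hg : Measurable g) :
    ∫⁻ ω : sphere (0 : W) 1, ENNReal.ofReal (J.symm ω).snd * g (J.symm ω).fst
      ∂(volume : Measure W).toSphere = ∫⁻ y in ball (0 : H) 1, g y := by
  have hdim := finrank_prod J
  have : Nontrivial W := nontrivial_of_finrank_pos (R := ℝ) (by omega)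
  have hfst : Continuous fun w : W => (J.symm w).fst :=
    (WithLp.prod_continuous_ofLp 2 H ℝ).fst.comp J.symm.continuous
  have hsnd : Continuous fun w : W => (J.symm w).snd :=
    (WithLp.prod_continuous_ofLp 2 H ℝ).snd.comp J.symm.continuous
  have hG : Measurable fun w : W => ENNReal.ofReal (J.symm w).snd * g (J.symm w).fst :=
    hsnd.measurable.ennreal_ofReal.mul (hg.comp hfst.measurable)
  rw [lintegral_toSphere (G := fun w : W => ENNReal.ofReal (J.symm w).snd * g (J.symm w).fst) hG,
    ← lintegral_indicator measurableSet_ball,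
    ← (measurePreserving_prod J).lintegral_comp_emb (measurableEmbedding_prod J)]
  -- With `ρ = |w|` the integrand is the weight `s / ρ` times a function of `y` and `ρ` alone, so
  -- the weight is exactly the Jacobian of `s ↦ ρ`.
  set k : H → ℝ → ℝ≥0∞ := fun y ρ => (Iio (1 : ℝ)).indicator (fun ρ => g (ρ⁻¹ • y)) ρ with hk
  have hkm : Measurable fun p : H × ℝ => k p.1 p.2 := by
    have : (fun p : H × ℝ => k p.1 p.2) =
        {p : H × ℝ | p.2 < 1}.indicator (fun p => g (p.2⁻¹ • p.1)) := rfl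
    rw [this]
    exact (hg.comp (by fun_prop)).indicator (measurableSet_lt measurable_snd measurable_const)
  have hpt : ∀ p : H × ℝ, (ball (0 : W) 1).indicator (fun w : W =>
      ENNReal.ofReal (J.symm (‖w‖⁻¹ • w)).snd * g (J.symm (‖w‖⁻¹ • w)).fst)
      (J (WithLp.toLp 2 p)) = (Ioi (0 : ℝ)).indicator (fun s =>
        ENNReal.ofReal (s / √(‖p.1‖ ^ 2 + s ^ 2)) * k p.1 √(‖p.1‖ ^ 2 + s ^ 2)) p.2 := by
    intro p
    have hn : ‖J (WithLp.toLp 2 p)‖ = √(‖p.1‖ ^ 2 + p.2 ^ 2) := by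
      rw [← norm_sq_prod J, Real.sqrt_sq (norm_nonneg _)]
    have hmem : J (WithLp.toLp 2 p) ∈ ball (0 : W) 1 ↔ √(‖p.1‖ ^ 2 + p.2 ^ 2) < 1 := by
      rw [mem_ball_zero_iff, hn]
    have hval : ENNReal.ofReal (J.symm (‖J (WithLp.toLp 2 p)‖⁻¹ • J (WithLp.toLp 2 p))).snd *
        g (J.symm (‖J (WithLp.toLp 2 p)‖⁻¹ • J (WithLp.toLp 2 p))).fst =
        ENNReal.ofReal (p.2 / √(‖p.1‖ ^ 2 + p.2 ^ 2)) *
          g ((√(‖p.1‖ ^ 2 + p.2 ^ 2))⁻¹ • p.1) := by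
      rw [map_smul, J.symm_apply_apply, hn, div_eq_inv_mul]
      rfl
    by_cases h1 : √(‖p.1‖ ^ 2 + p.2 ^ 2) < 1
    · rw [indicator_of_mem (hmem.2 h1), hval]
      by_cases h2 : 0 < p.2
      · rw [indicator_of_mem (mem_Ioi.2 h2)]
        simp only [hk]
        rw [indicator_of_mem (mem_Iio.2 h1)]
      · rw [indicator_of_notMem (by simpa using h2), ENNReal.ofReal_of_nonpos, zero_mul]
        exact div_nonpos_of_nonpos_of_nonneg (not_lt.1 h2) (Real.sqrt_nonneg _)
    · rw [indicator_of_notMem (fun h => h1 (hmem.1 h))]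
      by_cases h2 : 0 < p.2
      · rw [indicator_of_mem (mem_Ioi.2 h2)]
        simp only [hk]
        rw [indicator_of_notMem (by simpa using h1), mul_zero]
      · rw [indicator_of_notMem (by simpa using h2)]
  simp_rw [hpt]
  have hm1 : Measurable fun p : H × ℝ => (Ioi (0 : ℝ)).indicator (fun s =>
        ENNReal.ofReal (s / √(‖p.1‖ ^ 2 + s ^ 2)) * k p.1 √(‖p.1‖ ^ 2 + s ^ 2)) p.2 := by
    have : (fun p : H × ℝ => (Ioi (0 : ℝ)).indicator (fun s =>
        ENNReal.ofReal (s / √(‖p.1‖ ^ 2 + s ^ 2)) * k p.1 √(‖p.1‖ ^ 2 + s ^ 2)) p.2) =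
        {p : H × ℝ | 0 < p.2}.indicator (fun p => ENNReal.ofReal (p.2 / √(‖p.1‖ ^ 2 + p.2 ^ 2)) *
          k p.1 √(‖p.1‖ ^ 2 + p.2 ^ 2)) := rfl
    rw [this]
    refine Measurable.indicator ?_ (measurableSet_lt measurable_const measurable_snd)
    refine Measurable.mul (by fun_prop) ?_
    exact hkm.comp (f := fun p : H × ℝ => (p.1, √(‖p.1‖ ^ 2 + p.2 ^ 2))) (by fun_prop)
  rw [Measure.volume_eq_prod, lintegral_prod _ hm1.aemeasurable]
  simp_rw [lintegral_indicator measurableSet_Ioi, lintegral_sqrt_add_sq (norm_nonneg _)]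
  -- For fixed `ρ` the variable `y` runs over the ball of radius `ρ`, and scaling gives `ρ ^ dim H`.
  -- Its integral over `(0, 1)` is `1 / (dim H + 1)`, cancelling the factor `dim W`.
  have hswap : ∫⁻ y : H, ∫⁻ ρ in Ioi ‖y‖, k y ρ =
      ∫⁻ ρ : ℝ, (Ioo (0 : ℝ) 1).indicator
        (fun ρ => ENNReal.ofReal (ρ ^ finrank ℝ H) * ∫⁻ y in ball (0 : H) 1, g y) ρ := by
    simp_rw [← lintegral_indicator measurableSet_Ioi]
    rw [lintegral_lintegral_swap]
    · refine lintegral_congr fun ρ => ?_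
      have h3 : ∀ y : H, (Ioi ‖y‖).indicator (k y) ρ =
          (Ioo (0 : ℝ) 1).indicator (fun ρ => (ball (0 : H) ρ).indicator
            (fun y => g (ρ⁻¹ • y)) y) ρ := by
        intro y
        by_cases h : ‖y‖ < ρ
        · have h0 : 0 < ρ := (norm_nonneg y).trans_lt h
          rw [indicator_of_mem (mem_Ioi.2 h)]
          by_cases h1 : ρ < 1
          · rw [indicator_of_mem (show ρ ∈ Ioo (0 : ℝ) 1 from ⟨h0, h1⟩),
              indicator_of_mem (by simpa using h)]
            simp only [hk]
            rw [indicator_of_mem (mem_Iio.2 h1)]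
          · rw [indicator_of_notMem (s := Ioo (0 : ℝ) 1) (fun h' => h1 h'.2)]
            simp only [hk]
            rw [indicator_of_notMem (by simpa using h1)]
        · rw [indicator_of_notMem (by simpa using h)]
          by_cases h1 : ρ ∈ Ioo (0 : ℝ) 1
          · rw [indicator_of_mem h1, indicator_of_notMem (by simpa using h)]
          · rw [indicator_of_notMem h1]
      simp_rw [h3]
      by_cases h1 : ρ ∈ Ioo (0 : ℝ) 1
      · simp_rw [indicator_of_mem h1]
        rw [lintegral_indicator measurableSet_ball, lintegral_ball_inv_smul h1.1 hg]
      · simp_rw [indicator_of_notMem h1]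
        simp
    · have : (Function.uncurry fun (y : H) (ρ : ℝ) => (Ioi ‖y‖).indicator (k y) ρ) =
          {p : H × ℝ | ‖p.1‖ < p.2}.indicator (fun p => k p.1 p.2) := rfl
      rw [this]
      exact (hkm.indicator (measurableSet_lt (by fun_prop) (by fun_prop))).aemeasurable
  rw [hswap, lintegral_indicator measurableSet_Ioo, lintegral_mul_const _ (by fun_prop),
    lintegral_Ioo_rpow, ← mul_assoc, hdim, ENNReal.mul_inv_cancel (by simp) (by simp), one_mul]

/-- The equator is null, because the cone over it lies in a hyperplane. -/
lemma toSphere_snd_eq_zero (J : WithLp 2 (H × ℝ) ≃ₗᵢ[ℝ] W) :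
    ∀ᵐ ω : sphere (0 : W) 1 ∂(volume : Measure W).toSphere, (J.symm ω).snd ≠ 0 := by
  have : Nontrivial W := nontrivial_of_finrank_pos (R := ℝ) (by rw [finrank_prod J]; omega)
  have hsnd : Continuous fun w : W => (J.symm w).snd :=
    (WithLp.prod_continuous_ofLp 2 H ℝ).snd.comp J.symm.continuous
  have hset : MeasurableSet {w : W | (J.symm w).snd = 0} :=
    (isClosed_eq hsnd continuous_const).measurableSet
  have h0 : volume {w : W | (J.symm w).snd = 0} = 0 := by
    rw [← (measurePreserving_prod J).measure_preimage hset.nullMeasurableSet]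
    have : (fun p : H × ℝ => J (WithLp.toLp 2 p)) ⁻¹' {w : W | (J.symm w).snd = 0} =
        univ ×ˢ {0} := by
      ext p
      simp
    rw [this, Measure.volume_eq_prod, Measure.prod_prod]
    simp
  have h1 := lintegral_toSphere (E := W)
    (G := {w : W | (J.symm w).snd = 0}.indicator 1) (measurable_one.indicator hset)
  have h2 : ∫⁻ w in ball (0 : W) 1, {w : W | (J.symm w).snd = 0}.indicator 1 (‖w‖⁻¹ • w)
      = (0 : ℝ≥0∞) := by
    refine lintegral_eq_zero_of_ae_eq_zero (ae_restrict_of_ae ?_)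
    have h3 : ∀ᵐ w : W, w ∉ {w : W | (J.symm w).snd = 0} := measure_eq_zero_iff_ae_notMem.1 h0
    filter_upwards [h3] with w hw
    refine indicator_of_notMem (fun h => hw ?_) _
    simp only [mem_ofPred_eq, map_smul, WithLp.smul_snd, smul_eq_mul, mul_eq_zero, inv_eq_zero,
      norm_eq_zero] at h ⊢
    rcases h with h | h
    · simp [h]
    · exact h
  rw [h2, mul_zero] at h1
  have h4 := (lintegral_eq_zero_iff
    ((measurable_one.indicator hset).comp measurable_subtype_coe)).1 h1
  filter_upwards [h4] with ω hω h
  have : ({w : W | (J.symm w).snd = 0}.indicator 1 (ω : W) : ℝ≥0∞) = 1 :=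
    indicator_of_mem (s := {w : W | (J.symm w).snd = 0}) h _
  exact one_ne_zero (this.symm.trans hω)

/-- The lower integral formula says that the measure with density the positive part of the height
pushes forward to Lebesgue measure on the ball. Phrased through measures, the identity holds for
vector values without an integrability hypothesis. -/
lemma setIntegral_sphere_snd_smul {F : Type*} [NormedAddCommGroup F] [NormedSpace ℝ F]
    (J : WithLp 2 (H × ℝ) ≃ₗᵢ[ℝ] W) {h : H → F} (hh : StronglyMeasurable h) :
    ∫ ω : sphere (0 : W) 1 in {ω | 0 ≤ (J.symm (ω : W)).snd},
      (J.symm (ω : W)).snd • h (J.symm (ω : W)).fst ∂(volume : Measure W).toSphere =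
      ∫ y in ball (0 : H) 1, h y := by
  have hfst : Continuous fun ω : sphere (0 : W) 1 => (J.symm (ω : W)).fst :=
    ((WithLp.prod_continuous_ofLp 2 H ℝ).fst.comp J.symm.continuous).comp continuous_subtype_val
  have hsnd : Continuous fun ω : sphere (0 : W) 1 => (J.symm (ω : W)).snd :=
    ((WithLp.prod_continuous_ofLp 2 H ℝ).snd.comp J.symm.continuous).comp continuous_subtype_val
  have hset : MeasurableSet {ω : sphere (0 : W) 1 | 0 ≤ (J.symm (ω : W)).snd} :=
    (isClosed_le continuous_const hsnd).measurableSet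
  set ν := ((volume : Measure W).toSphere.withDensity
    (fun ω => ENNReal.ofReal (J.symm (ω : W)).snd)) with hν
  have hmap : ν.map (fun ω : sphere (0 : W) 1 => (J.symm (ω : W)).fst) =
      volume.restrict (ball (0 : H) 1) := by
    ext S hS
    rw [Measure.map_apply hfst.measurable hS, hν, withDensity_apply _ (hfst.measurable hS),
      ← lintegral_indicator (hfst.measurable hS), ← lintegral_indicator_one hS,
      ← lintegral_sphere_snd_mul J (measurable_one.indicator hS)]
    refine lintegral_congr fun ω => ?_
    by_cases h : (J.symm (ω : W)).fst ∈ S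
    · rw [indicator_of_mem (by exact h), indicator_of_mem h]
      simp
    · rw [indicator_of_notMem (by exact h), indicator_of_notMem h]
      simp
  rw [← hmap, integral_map hfst.measurable.aemeasurable hh.aestronglyMeasurable, hν]
  simp only [ENNReal.ofReal]
  rw [integral_withDensity_eq_integral_smul hsnd.measurable.real_toNNReal,
    ← integral_indicator hset]
  congr 1 with ω
  by_cases h : 0 ≤ (J.symm (ω : W)).snd
  · rw [indicator_of_mem (by exact h), NNReal.smul_def, Real.coe_toNNReal _ h]
  · rw [indicator_of_notMem (by exact h), NNReal.smul_def,
      Real.toNNReal_of_nonpos (not_le.1 h).le]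
    simp

end Decomposition

/-! ### Orthogonal coordinates relative to a unit vector. -/

section HyperplaneDecomposition

variable {E : Type*} [NormedAddCommGroup E] [InnerProductSpace ℝ E] [FiniteDimensional ℝ E]
  [MeasurableSpace E] [BorelSpace E]

/-- The isometry `(y, t) ↦ y + t θ` of `θᗮ × ℝ` onto the whole space, for a unit vector `θ`. -/
def hyperplaneIsometry (θ : E) (hθ : ‖θ‖ = 1) : WithLp 2 ((ℝ ∙ θ)ᗮ × ℝ) ≃ₗᵢ[ℝ] E where
  toFun p := (p.fst : E) + p.snd • θ
  invFun w := WithLp.toLp 2 ((ℝ ∙ θ)ᗮ.orthogonalProjectionOnto w, inner ℝ θ w)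
  map_add' p q := by
    simp only [WithLp.add_fst, WithLp.add_snd, Submodule.coe_add, add_smul]
    abel
  map_smul' c p := by
    simp [smul_smul]
  left_inv p := by
    have h1 : inner ℝ θ (p.fst : E) = 0 :=
      Submodule.mem_orthogonal_singleton_iff_inner_right.1 p.fst.2
    have h3 : (ℝ ∙ θ)ᗮ.orthogonalProjectionOnto θ = 0 :=
      Submodule.orthogonalProjectionOnto_apply_of_mem_orthogonal
        (Submodule.le_orthogonal_orthogonal _ (Submodule.mem_span_singleton_self θ))
    refine WithLp.ofLp_injective 2 (Prod.ext ?_ ?_)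
    · simp [h3]
    · simp [inner_add_right, inner_smul_right, h1, hθ]
  right_inv w := by
    have h := Submodule.starProjection_add_starProjection_orthogonal (K := ℝ ∙ θ) w
    simp only [Submodule.starProjection_apply] at h
    refine Eq.trans (add_comm _ _) ?_
    convert h using 2
    · have := Submodule.starProjection_unit_singleton ℝ hθ w
      rw [Submodule.starProjection_apply] at this
      exact this.symm
    · rfl
  norm_map' p := by
    have h1 : inner ℝ (p.fst : E) (p.snd • θ) = 0 := by
      rw [inner_smul_right, real_inner_comm,
        Submodule.mem_orthogonal_singleton_iff_inner_right.1 p.fst.2, mul_zero]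
    have h2 := norm_add_sq_eq_norm_sq_add_norm_sq_real h1
    have h3 := WithLp.prod_norm_sq_eq_of_L2 p
    rw [norm_smul, hθ, mul_one] at h2
    have h4 : ‖(p.fst : E) + p.snd • θ‖ ^ 2 = ‖p‖ ^ 2 := by
      rw [h3, sq, h2, Submodule.coe_norm]
      ring
    exact (sq_eq_sq₀ (norm_nonneg _) (norm_nonneg _)).1 h4

lemma hyperplaneIsometry_apply (θ : E) (hθ : ‖θ‖ = 1) (y : (ℝ ∙ θ)ᗮ) (t : ℝ) :
    hyperplaneIsometry θ hθ (WithLp.toLp 2 (y, t)) = (y : E) + t • θ := rfl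

lemma finrank_orthogonal_add_one (θ : E) (hθ : ‖θ‖ = 1) :
    finrank ℝ (ℝ ∙ θ)ᗮ + 1 = finrank ℝ E :=
  (finrank_prod (hyperplaneIsometry θ hθ)).symm

lemma norm_sq_smul_add {θ : E} (hθ : ‖θ‖ = 1) (t : ℝ) (y : (ℝ ∙ θ)ᗮ) :
    ‖t • θ + (y : E)‖ ^ 2 = t ^ 2 + ‖y‖ ^ 2 := by
  have h := norm_sq_prod (hyperplaneIsometry θ hθ) (y, t)
  rw [hyperplaneIsometry_apply, add_comm] at h
  rw [h]
  simp only
  ring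

end HyperplaneDecomposition

/-! ### The normalized slice transform is a Radon transform. -/

section Slice

variable {n : ℕ}

local notation "ℰ" => EuclideanSpace ℝ (Fin n)

lemma mkPoint_add (x y : ℰ) (s t : ℝ) : mkPoint x s + mkPoint y t = mkPoint (x + y) (s + t) := by
  ext i
  refine Fin.lastCases ?_ (fun i => ?_) i <;> simp [mkPoint]

lemma smul_mkPoint (c : ℝ) (x : ℰ) (s : ℝ) : c • mkPoint x s = mkPoint (c • x) (c * s) := by
  ext i
  refine Fin.lastCases ?_ (fun i => ?_) i <;> simp [mkPoint]

lemma mkPoint_last (x : ℰ) (s : ℝ) : mkPoint x s (Fin.last n) = s := by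
  simp [mkPoint]

lemma horiz_mkPoint (x : ℰ) (s : ℝ) : horiz (mkPoint x s) = x := by
  ext i
  simp [mkPoint, horiz]

lemma mkPoint_horiz (x : EuclideanSpace ℝ (Fin (n + 1))) : mkPoint (horiz x) (x (Fin.last n)) = x := by
  ext i
  refine Fin.lastCases ?_ (fun i => ?_) i <;> simp [mkPoint, horiz]

lemma norm_sq_mkPoint (x : ℰ) (s : ℝ) : ‖mkPoint x s‖ ^ 2 = ‖x‖ ^ 2 + s ^ 2 := by
  rw [EuclideanSpace.norm_sq_eq, EuclideanSpace.norm_sq_eq, Fin.sum_univ_castSucc]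
  simp [mkPoint]

lemma inner_mkPoint_zero (θ : ℰ) (x : EuclideanSpace ℝ (Fin (n + 1))) :
    inner ℝ (mkPoint θ 0) x = inner ℝ θ (horiz x) := by
  simp [PiLp.inner_apply, Fin.sum_univ_castSucc, mkPoint, horiz]

lemma mem_verticalDirection {θ : ℰ} {x : EuclideanSpace ℝ (Fin (n + 1))} :
    x ∈ verticalDirection θ ↔ horiz x ∈ (ℝ ∙ θ)ᗮ := by
  rw [Submodule.mem_orthogonal_singleton_iff_inner_right,
    Submodule.mem_orthogonal_singleton_iff_inner_right, inner_mkPoint_zero]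

/-- The isometry `(y, s) ↦ (y, s)` of `θᗮ × ℝ` onto the direction of the vertical hyperplanes
orthogonal to `θ`. -/
def verticalIsometry (θ : ℰ) : WithLp 2 ((ℝ ∙ θ)ᗮ × ℝ) ≃ₗᵢ[ℝ] verticalDirection θ where
  toFun p := ⟨mkPoint p.fst p.snd, by
    rw [mem_verticalDirection, horiz_mkPoint]
    exact p.fst.2⟩
  invFun w := WithLp.toLp 2 (⟨horiz (w : EuclideanSpace ℝ (Fin (n + 1))),
    mem_verticalDirection.1 w.2⟩, (w : EuclideanSpace ℝ (Fin (n + 1))) (Fin.last n))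
  map_add' p q := by
    ext1
    simp [mkPoint_add]
  map_smul' c p := by
    ext1
    simp [smul_mkPoint]
  left_inv p := by
    refine WithLp.ofLp_injective 2 (Prod.ext ?_ ?_)
    · simp [horiz_mkPoint]
    · simp [mkPoint_last]
  right_inv w := by
    ext1
    simp [mkPoint_horiz]
  norm_map' p := by
    refine (sq_eq_sq₀ (norm_nonneg _) (norm_nonneg _)).1 ?_
    rw [WithLp.prod_norm_sq_eq_of_L2 p, Submodule.coe_norm]
    change ‖mkPoint (p.fst : ℰ) p.snd‖ ^ 2 = _
    rw [norm_sq_mkPoint]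
    simp

lemma coe_verticalIsometry (θ : ℰ) (y : (ℝ ∙ θ)ᗮ) (s : ℝ) :
    (verticalIsometry θ (WithLp.toLp 2 (y, s)) : EuclideanSpace ℝ (Fin (n + 1))) = mkPoint y s :=
  rfl

variable {𝕜 : Type*} [RCLike 𝕜]

/-- `φ` extended by zero from the unit ball. -/
def zeroExt (φ : ℰ → 𝕜) : ℰ → 𝕜 := (ball (0 : ℰ) 1).indicator φ

/-- The slice is parametrized by `(tθ + r y, r s)` with `(y, s)` on the unit sphere of `θᗮ × ℝ`.
There `f` equals `r s` times the quotient at `tθ + r y`, and the factor `s` is what the hemisphere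
projection absorbs. -/
lemma normalizedSlice_eq_radon {f : EuclideanSpace ℝ (Fin (n + 1)) → 𝕜}
    (hf : StronglyMeasurable (zeroExt (hemisphereQuotient f))) {θ : ℰ} (hθ : ‖θ‖ = 1) {t : ℝ}
    (ht : |t| < 1) :
    normalizedSlice f θ t = ∫ y : (ℝ ∙ θ)ᗮ, zeroExt (hemisphereQuotient f) (t • θ + (y : ℰ)) := by
  set r := √(1 - t ^ 2) with hr
  have ht2 : 0 < 1 - t ^ 2 := by nlinarith [sq_abs t, abs_nonneg t]
  have hr0 : 0 < r := Real.sqrt_pos.2 ht2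
  have hr2 : r ^ 2 = 1 - t ^ 2 := Real.sq_sqrt ht2.le
  set J := verticalIsometry θ
  set φ := zeroExt (hemisphereQuotient f) with hφ
  have hemb : MeasurableEmbedding (fun ω : sphere (0 : verticalDirection θ) 1 =>
      mkPoint (t • θ) 0 + r • ((ω : verticalDirection θ) : EuclideanSpace ℝ (Fin (n + 1)))) := by
    refine (Continuous.isClosedEmbedding (by fun_prop) ?_).measurableEmbedding
    intro ω ω' h
    have h1 := smul_right_injective _ hr0.ne' (add_left_cancel h)
    exact Subtype.ext (Subtype.ext h1)
  have hpt : ∀ ω : sphere (0 : verticalDirection θ) 1,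
      mkPoint (t • θ) 0 + r • ((ω : verticalDirection θ) : EuclideanSpace ℝ (Fin (n + 1))) =
        mkPoint (t • θ + r • ((J.symm ω).fst : ℰ)) (r * (J.symm ω).snd) := by
    intro ω
    have : ((ω : verticalDirection θ) : EuclideanSpace ℝ (Fin (n + 1))) =
        mkPoint ((J.symm ω).fst : ℰ) (J.symm ω).snd := by
      rw [← coe_verticalIsometry]
      exact congrArg Subtype.val (J.apply_symm_apply ω).symm
    rw [this, smul_mkPoint, mkPoint_add, zero_add]
  have hpre : ((fun ω : sphere (0 : verticalDirection θ) 1 =>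
      mkPoint (t • θ) 0 + r • ((ω : verticalDirection θ) : EuclideanSpace ℝ (Fin (n + 1)))) ⁻¹'
        upperHalf n) = {ω : sphere (0 : verticalDirection θ) 1 | 0 ≤ (J.symm (ω : verticalDirection θ)).snd} := by
    ext ω
    rw [mem_preimage, hpt]
    simp only [upperHalf, mem_ofPred_eq, mkPoint_last]
    exact mul_nonneg_iff_of_pos_left hr0
  have hval : ∀ᵐ ω : sphere (0 : verticalDirection θ) 1
      ∂(volume : Measure (verticalDirection θ)).toSphere,
      ω ∈ {ω : sphere (0 : verticalDirection θ) 1 |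
        0 ≤ (J.symm (ω : verticalDirection θ)).snd} →
      f (mkPoint (t • θ) 0 + r • ((ω : verticalDirection θ) :
        EuclideanSpace ℝ (Fin (n + 1)))) =
      (J.symm (ω : verticalDirection θ)).snd •
        (r • φ (t • θ + ((r • (J.symm (ω : verticalDirection θ)).fst : (ℝ ∙ θ)ᗮ) : ℰ))) := by
    -- The equator `s = 0` must be discarded: the right side vanishes there, while `f` is
    -- unconstrained.
    filter_upwards [toSphere_snd_eq_zero J] with ω hω hω0
    have hs : 0 < (J.symm (ω : verticalDirection θ)).snd := lt_of_le_of_ne hω0 (Ne.symm hω)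
    rw [hpt]
    set y := (J.symm (ω : verticalDirection θ)).fst
    set s := (J.symm (ω : verticalDirection θ)).snd
    have hn : ‖y‖ ^ 2 + s ^ 2 = 1 := by
      have h1 := norm_sq_prod J (y, s)
      have h2 : J (WithLp.toLp 2 (y, s)) = ω := J.apply_symm_apply _
      rw [h2] at h1
      have h3 : ‖(ω : verticalDirection θ)‖ = 1 := by simp
      rw [h3] at h1
      simpa using h1.symm
    have hnorm : ‖t • θ + ((r • y : (ℝ ∙ θ)ᗮ) : ℰ)‖ ^ 2 = 1 - (r * s) ^ 2 := by
      rw [norm_sq_smul_add hθ, norm_smul, Real.norm_of_nonneg hr0.le]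
      linear_combination (r ^ 2) * hn + hr2
    have hrs : 0 < r * s := mul_pos hr0 hs
    have hmem : t • θ + ((r • y : (ℝ ∙ θ)ᗮ) : ℰ) ∈ ball (0 : ℰ) 1 := by
      rw [mem_ball_zero_iff, ← sq_lt_one_iff₀ (norm_nonneg _), hnorm]
      nlinarith
    rw [hφ, zeroExt, indicator_of_mem hmem, hemisphereQuotient, hnorm, sub_sub_cancel,
      Real.sqrt_sq hrs.le, smul_smul, smul_smul, mul_comm s r,
      mul_inv_cancel₀ hrs.ne', one_smul]
    rfl
  have hset : MeasurableSet {ω : sphere (0 : verticalDirection θ) 1 |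
      0 ≤ (J.symm (ω : verticalDirection θ)).snd} := by
    rw [← hpre]
    refine hemb.measurable ?_
    exact (isClosed_le continuous_const (by fun_prop)).measurableSet
  have hdim : finrank ℝ (ℝ ∙ θ)ᗮ = n - 1 := by
    have := finrank_orthogonal_add_one θ hθ
    rw [finrank_euclideanSpace_fin] at this
    omega
  have hmeas : StronglyMeasurable fun y : (ℝ ∙ θ)ᗮ => r • φ (t • θ + ((r • y : (ℝ ∙ θ)ᗮ) : ℰ)) := by
    refine StronglyMeasurable.const_smul ?_ r
    exact hf.comp_measurable (by fun_prop)
  -- Since `t² + r² = 1`, the condition `‖y‖ ≥ 1` puts `tθ + r y` outside the open unit ball.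
  have hball : ∫ y : (ℝ ∙ θ)ᗮ in ball 0 1, r • φ (t • θ + ((r • y : (ℝ ∙ θ)ᗮ) : ℰ)) =
      ∫ y : (ℝ ∙ θ)ᗮ, r • φ (t • θ + ((r • y : (ℝ ∙ θ)ᗮ) : ℰ)) := by
    refine setIntegral_eq_integral_of_forall_compl_eq_zero fun y hy => ?_
    rw [hφ, zeroExt, indicator_of_notMem, smul_zero]
    rw [mem_ball_zero_iff, ← sq_lt_one_iff₀ (norm_nonneg _), norm_sq_smul_add hθ, norm_smul,
      Real.norm_of_nonneg hr0.le]
    have : 1 ≤ ‖y‖ := by simpa using hy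
    nlinarith [mul_le_mul_of_nonneg_left this hr0.le, mul_nonneg hr0.le (norm_nonneg y)]
  rw [normalizedSlice, verticalSlice, sliceMeasure, Measure.restrict_smul, integral_smul_measure,
    hemb.setIntegral_map, hpre, setIntegral_congr_ae hset hval,
    setIntegral_sphere_snd_smul J hmeas, hball, integral_smul,
    Measure.integral_comp_smul (volume : Measure (ℝ ∙ θ)ᗮ) (fun y => φ (t • θ + (y : ℰ))), hdim,
    ENNReal.toReal_ofReal (by positivity), abs_of_nonneg (by positivity), smul_smul, smul_smul,
    smul_smul]
  -- In order: the normalization, the surface measure of the slice, the factor `r` in the height `r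
  -- s`, and the dilation of `θᗮ`.
  have : r⁻¹ * r ^ (n - 1) * r * (r ^ (n - 1))⁻¹ = 1 := by field_simp
  rw [this, one_smul]

end Slice

/-! ### Backprojection of the Radon transform, by thin cones. -/

/-- The volume of the unit ball in dimension `d`. -/
def unitBallVolume (d : ℕ) : ℝ := √Real.pi ^ d / Real.Gamma ((d : ℝ) / 2 + 1)

lemma unitBallVolume_pos (d : ℕ) : 0 < unitBallVolume d := by
  have := Real.Gamma_pos_of_pos (show (0 : ℝ) < (d : ℝ) / 2 + 1 by positivity)
  have := Real.pi_pos
  unfold unitBallVolume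
  positivity

section Cone

variable {E : Type*} [NormedAddCommGroup E] [InnerProductSpace ℝ E] [FiniteDimensional ℝ E]
  [MeasurableSpace E] [BorelSpace E] {F : Type*} [NormedAddCommGroup F] [NormedSpace ℝ F] [CompleteSpace F]

lemma volume_real_ball [Nontrivial E] (x : E) {r : ℝ} (hr : 0 < r) :
    (volume : Measure E).real (ball x r) = r ^ finrank ℝ E * unitBallVolume (finrank ℝ E) := by
  have h0 : (volume : Measure E).real (ball 0 1) = unitBallVolume (finrank ℝ E) := by
    rw [Measure.real, InnerProductSpace.volume_ball]
    have := unitBallVolume_pos (finrank ℝ E)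
    unfold unitBallVolume at this ⊢
    simp [ENNReal.toReal_ofReal this.le]
  rw [Measure.real, Measure.addHaar_ball_of_pos _ _ hr, ENNReal.toReal_mul,
    ENNReal.toReal_ofReal (by positivity)]
  congr 1

lemma toSphere_real_univ [Nontrivial E] :
    (volume : Measure E).toSphere.real univ = finrank ℝ E * unitBallVolume (finrank ℝ E) := by
  rw [Measure.toSphere_real_apply_univ, volume_real_ball _ one_pos, one_pow, one_mul]

lemma nontrivial_orthogonal (hE : 2 ≤ finrank ℝ E) {θ : E} (hθ : ‖θ‖ = 1) :
    Nontrivial (ℝ ∙ θ)ᗮ :=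
  nontrivial_of_finrank_pos (R := ℝ) (by
    have := finrank_orthogonal_add_one θ hθ
    omega)

lemma integral_radon_translate {θ : E} (hθ : ‖θ‖ = 1) (ψ : E → F) (x : E) :
    ∫ y : (ℝ ∙ θ)ᗮ, ψ ((inner ℝ x θ : ℝ) • θ + (y : E)) = ∫ y : (ℝ ∙ θ)ᗮ, ψ (x + (y : E)) := by
  have h := (hyperplaneIsometry θ hθ).apply_symm_apply x
  set p := (hyperplaneIsometry θ hθ).symm x
  have h1 : (p.fst : E) + p.snd • θ = x := h
  have h2 : inner ℝ x θ = p.snd := real_inner_comm _ _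
  rw [← integral_add_left_eq_self _ p.fst]
  congr 1 with y
  rw [h2, ← h1]
  congr 1
  simp only [Submodule.coe_add]
  abel

/-- The double cone `{z = y + t θ : |t| < s |y|}` around the hyperplane orthogonal to `θ`. -/
def coneNhd (s : ℝ) (θ : E) : Set E := {z | (inner ℝ z θ : ℝ) ^ 2 * (1 + s ^ 2) < s ^ 2 * ‖z‖ ^ 2}

lemma mem_coneNhd_iff {s : ℝ} (hs : 0 < s) {θ : E} (hθ : ‖θ‖ = 1) (y : (ℝ ∙ θ)ᗮ) (t : ℝ) :
    (y : E) + t • θ ∈ coneNhd s θ ↔ t ∈ Ioo (-(s * ‖y‖)) (s * ‖y‖) := by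
  have h1 : inner ℝ ((y : E) + t • θ) θ = t := by
    have : inner ℝ (y : E) θ = 0 := by
      rw [real_inner_comm]
      exact Submodule.mem_orthogonal_singleton_iff_inner_right.1 y.2
    rw [inner_add_left, this, inner_smul_left, real_inner_self_eq_norm_sq, hθ]
    simp
  have h2 : ‖(y : E) + t • θ‖ ^ 2 = t ^ 2 + ‖y‖ ^ 2 := by
    rw [add_comm, norm_sq_smul_add hθ]
  change (_ : ℝ) < _ ↔ _
  rw [h1, h2, mem_Ioo, ← abs_lt, ← abs_of_nonneg (show 0 ≤ s * ‖y‖ by positivity), ← sq_lt_sq]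
  constructor <;> intro h <;> nlinarith

/-- A bounded function supported in the unit ball and continuous off the unit sphere. -/
structure IsBallDensity (ψ : E → F) : Prop where
  meas : StronglyMeasurable ψ
  bound : ∃ M : ℝ, ∀ z, ‖ψ z‖ ≤ M
  supp : ∀ z, 1 ≤ ‖z‖ → ψ z = 0
  cont : ∀ z, ‖z‖ ≠ 1 → ContinuousAt ψ z

/-- `|z|⁻¹` is integrable over balls in dimension at least two. -/
lemma integrableOn_inv_norm_ball (hE : 2 ≤ finrank ℝ E) (R : ℝ) :
    IntegrableOn (fun z : E => ‖z‖⁻¹) (ball 0 R) := by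
  have : Nontrivial E := nontrivial_of_finrank_pos (R := ℝ) (by omega)
  rw [integrableOn_fun_norm_addHaar volume (f := fun r => r⁻¹)]
  have h1 : IntegrableOn (fun y : ℝ => y ^ (finrank ℝ E - 2)) (Ioo 0 R) :=
    ((continuous_pow _).integrableOn_Icc (a := 0) (b := R)).mono_set Ioo_subset_Icc_self
  refine h1.congr_fun (fun y hy => ?_) measurableSet_Ioo
  have : finrank ℝ E - 1 = finrank ℝ E - 2 + 1 := by omega
  have h0 : y ≠ 0 := hy.1.ne'
  simp only [this, smul_eq_mul, pow_succ]
  field_simp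

variable {ψ : E → F}

lemma IsBallDensity.integrable_inv_norm (hψ : IsBallDensity ψ) (hE : 2 ≤ finrank ℝ E) {x : E}
    (hx : ‖x‖ < 1) : Integrable fun z : E => ‖z‖⁻¹ • ψ (x + z) := by
  obtain ⟨M, hM⟩ := hψ.bound
  have h1 : Integrable ((ball (0 : E) 2).indicator fun z : E => ‖z‖⁻¹ * M) :=
    (integrable_indicator_iff measurableSet_ball).2 ((integrableOn_inv_norm_ball hE 2).mul_const M)
  refine h1.mono' ?_ (Eventually.of_forall fun z => ?_)
  · refine StronglyMeasurable.aestronglyMeasurable ?_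
    exact (measurable_norm.inv.stronglyMeasurable).smul
      (hψ.meas.comp_measurable (measurable_const_add x))
  · by_cases hz : z ∈ ball (0 : E) 2
    · rw [indicator_of_mem hz, norm_smul, norm_inv, norm_norm]
      gcongr
      exact hM _
    · rw [indicator_of_notMem hz, hψ.supp, smul_zero, norm_zero]
      have h2 : 2 ≤ ‖z‖ := by simpa using hz
      have h3 : ‖z‖ ≤ ‖x + z‖ + ‖x‖ := by
        simpa using norm_sub_le (x + z) x
      linarith

lemma measurableSet_coneNhd_prod (s : ℝ) :
    MeasurableSet {p : sphere (0 : E) 1 × E | p.2 ∈ coneNhd s (p.1 : E)} := by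
  have h1 : Continuous fun p : sphere (0 : E) 1 × E =>
    (inner ℝ p.2 (p.1 : E) : ℝ) ^ 2 * (1 + s ^ 2) := by fun_prop
  have h2 : Continuous fun p : sphere (0 : E) 1 × E => s ^ 2 * ‖p.2‖ ^ 2 := by fun_prop
  exact measurableSet_lt h1.measurable h2.measurable

lemma measurableSet_coneNhd (s : ℝ) (θ : E) : MeasurableSet (coneNhd s θ) :=
  measurableSet_lt (by fun_prop) (by fun_prop)

/-- The integral over a thin cone, in coordinates adapted to the cone. -/
lemma setIntegral_coneNhd (hψ : IsBallDensity ψ) (hE : 2 ≤ finrank ℝ E) {x : E} (hx : ‖x‖ < 1)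
    {s : ℝ} (hs : 0 < s) {θ : E} (hθ : ‖θ‖ = 1) :
    ∫ z in coneNhd s θ, ‖z‖⁻¹ • ψ (x + z) =
      s • ∫ y : (ℝ ∙ θ)ᗮ, ∫ τ in (-1 : ℝ)..1,
        (√(1 + (s * τ) ^ 2))⁻¹ • ψ (x + ((y : E) + (s * ‖y‖ * τ) • θ)) := by
  set J := hyperplaneIsometry θ hθ
  have hint := (hψ.integrable_inv_norm hE hx).indicator (measurableSet_coneNhd s θ)
  rw [← integral_indicator (measurableSet_coneNhd s θ),
    ← (measurePreserving_prod J).integral_comp (measurableEmbedding_prod J),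
    Measure.volume_eq_prod, integral_prod, ← integral_smul]
  · have hne : ∀ᵐ y : (ℝ ∙ θ)ᗮ, y ≠ 0 := by
      have := nontrivial_orthogonal hE hθ
      exact Measure.ae_ne volume 0
    refine integral_congr_ae ?_
    filter_upwards [hne] with y hy
    have hy0 : 0 < ‖y‖ := norm_pos_iff.2 hy
    have hsy : 0 < s * ‖y‖ := mul_pos hs hy0
    have h1 : ∀ t : ℝ, (coneNhd s θ).indicator (fun z => ‖z‖⁻¹ • ψ (x + z))
        (J (WithLp.toLp 2 (y, t))) = (Ioo (-(s * ‖y‖)) (s * ‖y‖)).indicator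
          (fun t => (√(t ^ 2 + ‖y‖ ^ 2))⁻¹ • ψ (x + ((y : E) + t • θ))) t := by
      intro t
      rw [hyperplaneIsometry_apply]
      by_cases ht : t ∈ Ioo (-(s * ‖y‖)) (s * ‖y‖)
      · rw [indicator_of_mem ht, indicator_of_mem ((mem_coneNhd_iff hs hθ y t).2 ht),
          ← norm_sq_smul_add hθ, Real.sqrt_sq (norm_nonneg _), add_comm (t • θ)]
      · rw [indicator_of_notMem ht,
          indicator_of_notMem (fun h => ht ((mem_coneNhd_iff hs hθ y t).1 h))]
    simp_rw [h1]
    rw [integral_indicator measurableSet_Ioo, ← integral_Ioc_eq_integral_Ioo,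
      ← intervalIntegral.integral_of_le (by linarith)]
    -- Substituting `t = s ‖y‖ τ` gives the Jacobian `s ‖y‖`; its factor `‖y‖` cancels the one in
    -- `|z| = ‖y‖ √(1 + (sτ)²)`. The weight `|z|⁻¹` was chosen for this cancellation.
    have h2 := intervalIntegral.integral_comp_mul_left (a := -1) (b := 1)
      (fun t => (√(t ^ 2 + ‖y‖ ^ 2))⁻¹ • ψ (x + ((y : E) + t • θ))) hsy.ne'
    rw [mul_neg_one, mul_one] at h2
    rw [eq_inv_smul_iff₀ hsy.ne'] at h2
    rw [← h2, ← intervalIntegral.integral_smul, ← intervalIntegral.integral_smul]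
    refine intervalIntegral.integral_congr fun τ _ => ?_
    simp only [smul_smul]
    congr 1
    have h3 : √((s * ‖y‖ * τ) ^ 2 + ‖y‖ ^ 2) = ‖y‖ * √(1 + (s * τ) ^ 2) := by
      rw [show (s * ‖y‖ * τ) ^ 2 + ‖y‖ ^ 2 = ‖y‖ ^ 2 * (1 + (s * τ) ^ 2) by ring,
        Real.sqrt_mul (by positivity), Real.sqrt_sq hy0.le]
    rw [h3]
    have : 0 < √(1 + (s * τ) ^ 2) := Real.sqrt_pos.2 (by positivity)
    field_simp
  · exact (measurePreserving_prod J).integrable_comp_of_integrable hint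

lemma norm_le_norm_add_smul {θ : E} (hθ : ‖θ‖ = 1) (y : (ℝ ∙ θ)ᗮ) (t : ℝ) :
    ‖y‖ ≤ ‖(y : E) + t • θ‖ := by
  refine (sq_le_sq₀ (norm_nonneg _) (norm_nonneg _)).1 ?_
  rw [add_comm, norm_sq_smul_add hθ]
  nlinarith

lemma IsBallDensity.zero_of_two_le (hψ : IsBallDensity ψ) {x : E} (hx : ‖x‖ < 1) {z : E}
    (hz : 2 ≤ ‖z‖) : ψ (x + z) = 0 := by
  refine hψ.supp _ ?_
  have h3 : ‖z‖ ≤ ‖x + z‖ + ‖x‖ := by simpa using norm_sub_le (x + z) x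
  linarith

lemma norm_inv_sqrt_smul_le {M a : ℝ} {v : F} (hv : ‖v‖ ≤ M) :
    ‖(√(1 + a ^ 2))⁻¹ • v‖ ≤ M := by
  have h1 : 1 ≤ √(1 + a ^ 2) := Real.one_le_sqrt.2 (by nlinarith [sq_nonneg a])
  rw [norm_smul, norm_inv, Real.norm_of_nonneg (by positivity)]
  have := inv_le_one_of_one_le₀ h1
  nlinarith [norm_nonneg v, inv_nonneg.2 (zero_le_one.trans h1)]

/-- Uniform bound for the averages over thin cones. -/
lemma norm_cone_average_le {M : ℝ} (hψ : IsBallDensity ψ) (hE : 2 ≤ finrank ℝ E) (hM : ∀ z, ‖ψ z‖ ≤ M) {x : E}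
    (hx : ‖x‖ < 1) {s : ℝ} {θ : E} (hθ : ‖θ‖ = 1) :
    ‖∫ y : (ℝ ∙ θ)ᗮ, ∫ τ in (-1 : ℝ)..1,
        (√(1 + (s * τ) ^ 2))⁻¹ • ψ (x + ((y : E) + (s * ‖y‖ * τ) • θ))‖ ≤
      2 * M * (2 ^ (finrank ℝ E - 1) * unitBallVolume (finrank ℝ E - 1)) := by
  have hd : finrank ℝ (ℝ ∙ θ)ᗮ = finrank ℝ E - 1 := by
    have := finrank_orthogonal_add_one θ hθ
    omega
  have := nontrivial_orthogonal hE hθ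
  rw [← hd, ← volume_real_ball (0 : (ℝ ∙ θ)ᗮ) two_pos,
    ← setIntegral_eq_integral_of_forall_compl_eq_zero (s := ball 0 2)]
  · refine norm_setIntegral_le_of_norm_le_const measure_ball_lt_top fun y _ => ?_
    refine (intervalIntegral.norm_integral_le_of_norm_le_const (C := M) fun τ _ => ?_).trans ?_
    · exact norm_inv_sqrt_smul_le (hM _)
    · norm_num
      linarith
  · intro y hy
    have hy2 : 2 ≤ ‖y‖ := by simpa using hy
    refine (intervalIntegral.integral_congr fun τ _ => ?_).trans
      intervalIntegral.integral_zero
    rw [hψ.zero_of_two_le hx (hy2.trans (norm_le_norm_add_smul hθ y _)), smul_zero]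

/-- The unit sphere meets the affine hyperplane in at most a lower-dimensional sphere, null in `θᗮ`.
Thus `ψ` is continuous at almost every point of the hyperplane. -/
lemma ae_norm_add_ne_one {θ : E} (hθ : ‖θ‖ = 1) (hE : 2 ≤ finrank ℝ E) (x : E) :
    ∀ᵐ y : (ℝ ∙ θ)ᗮ, ‖x + (y : E)‖ ≠ 1 := by
  have := nontrivial_orthogonal hE hθ
  have h := (hyperplaneIsometry θ hθ).apply_symm_apply x
  set p := (hyperplaneIsometry θ hθ).symm x
  have h1 : (p.fst : E) + p.snd • θ = x := h
  have h2 : ∀ᵐ y : (ℝ ∙ θ)ᗮ, y ∉ sphere (-p.fst) √(1 - p.snd ^ 2) :=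
    measure_eq_zero_iff_ae_notMem.1 (Measure.addHaar_sphere _ _ _)
  filter_upwards [h2] with y hy h3
  apply hy
  have h4 : x + (y : E) = p.snd • θ + ((p.fst + y : (ℝ ∙ θ)ᗮ) : E) := by
    rw [← h1, Submodule.coe_add]
    abel
  have h5 := norm_sq_smul_add hθ p.snd (p.fst + y)
  rw [← h4, h3] at h5
  rw [mem_sphere, dist_eq_norm, sub_neg_eq_add, add_comm,
    show (1 : ℝ) - p.snd ^ 2 = ‖p.fst + y‖ ^ 2 by linarith, Real.sqrt_sq (norm_nonneg _)]

/-- Dominated convergence in `τ` and then in `y`, with majorants from the bound and the support of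
`ψ`; the factor 2 is the length of `[-1, 1]`. -/
lemma tendsto_cone_average (hψ : IsBallDensity ψ) (hE : 2 ≤ finrank ℝ E) {x : E}
    (hx : ‖x‖ < 1) {θ : E} (hθ : ‖θ‖ = 1) {s : ℕ → ℝ} (hs : Tendsto s atTop (𝓝 0)) :
    Tendsto (fun k => ∫ y : (ℝ ∙ θ)ᗮ, ∫ τ in (-1 : ℝ)..1,
        (√(1 + (s k * τ) ^ 2))⁻¹ • ψ (x + ((y : E) + (s k * ‖y‖ * τ) • θ))) atTop
      (𝓝 ((2 : ℝ) • ∫ y : (ℝ ∙ θ)ᗮ, ψ (x + (y : E)))) := by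
  obtain ⟨M, hM⟩ := hψ.bound
  have hM0 : 0 ≤ M := (norm_nonneg _).trans (hM 0)
  have hmeas : ∀ s : ℝ, StronglyMeasurable fun p : (ℝ ∙ θ)ᗮ × ℝ =>
      (√(1 + (s * p.2) ^ 2))⁻¹ • ψ (x + ((p.1 : E) + (s * ‖p.1‖ * p.2) • θ)) := by
    intro s
    refine StronglyMeasurable.smul (Measurable.stronglyMeasurable (by fun_prop)) ?_
    exact hψ.meas.comp_measurable (by fun_prop)
  rw [← integral_smul]
  refine tendsto_integral_of_dominated_convergence ((ball 0 2).indicator fun _ => 2 * M) ?_ ?_ ?_ ?_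
  · intro k
    simp_rw [intervalIntegral.integral_of_le (show (-1 : ℝ) ≤ 1 by norm_num)]
    exact (hmeas (s k)).integral_prod_right.aestronglyMeasurable
  · exact (integrable_indicator_iff measurableSet_ball).2
      (integrableOn_const measure_ball_lt_top.ne)
  · intro k
    refine Eventually.of_forall fun y => ?_
    by_cases hy : y ∈ ball (0 : (ℝ ∙ θ)ᗮ) 2
    · rw [indicator_of_mem hy]
      refine (intervalIntegral.norm_integral_le_of_norm_le_const (C := M) fun τ _ => ?_).trans ?_
      · exact norm_inv_sqrt_smul_le (hM _)
      · norm_num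
        linarith
    · rw [indicator_of_notMem hy]
      have hy2 : 2 ≤ ‖y‖ := by simpa using hy
      refine le_of_eq (norm_eq_zero.2 ?_)
      refine (intervalIntegral.integral_congr fun τ _ => ?_).trans
        intervalIntegral.integral_zero
      rw [hψ.zero_of_two_le hx (hy2.trans (norm_le_norm_add_smul hθ y _)), smul_zero]
  · filter_upwards [ae_norm_add_ne_one hθ hE x] with y hy
    have h2 : (2 : ℝ) • ψ (x + (y : E)) = ∫ _ in (-1 : ℝ)..1, ψ (x + (y : E)) := by
      rw [intervalIntegral.integral_const]
      norm_num
    rw [h2]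
    refine intervalIntegral.tendsto_integral_filter_of_dominated_convergence (fun _ => M)
      ?_ ?_ ?_ ?_
    · refine Eventually.of_forall fun k => ?_
      exact ((hmeas (s k)).comp_measurable (measurable_prodMk_left (x := y))).aestronglyMeasurable
    · exact Eventually.of_forall fun k => Eventually.of_forall fun τ _ =>
        norm_inv_sqrt_smul_le (hM _)
    · exact intervalIntegrable_const
    · refine Eventually.of_forall fun τ _ => ?_
      have h3 : Tendsto (fun k => (√(1 + (s k * τ) ^ 2))⁻¹) atTop (𝓝 1) := by
        have : ContinuousAt (fun u : ℝ => (√(1 + (u * τ) ^ 2))⁻¹) 0 := by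
          refine ContinuousAt.inv₀ (by fun_prop) (by simp)
        have h := this.tendsto.comp hs
        simpa [Function.comp_def] using h
      have h4 : Tendsto (fun k => ψ (x + ((y : E) + (s k * ‖y‖ * τ) • θ))) atTop
          (𝓝 (ψ (x + (y : E)))) := by
        refine (hψ.cont _ hy).tendsto.comp ?_
        have : Continuous (fun u : ℝ => x + ((y : E) + (u * ‖y‖ * τ) • θ)) := by fun_prop
        have h := (this.tendsto 0).comp hs
        simpa [Function.comp_def] using h
      simpa using h3.smul h4

/-- The spherical measure of the directions whose thin cone contains a given unit vector. -/
def coneMeasure (e : E) (s : ℝ) : ℝ :=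
  ∫ θ : sphere (0 : E) 1, {r : ℝ | r ^ 2 * (1 + s ^ 2) < s ^ 2}.indicator (fun _ => (1 : ℝ))
    (inner ℝ e (θ : E)) ∂(volume : Measure E).toSphere

lemma integrable_cone_prod (hψ : IsBallDensity ψ) (hE : 2 ≤ finrank ℝ E) {x : E}
    (hx : ‖x‖ < 1) (s : ℝ) :
    Integrable (fun p : sphere (0 : E) 1 × E =>
      (coneNhd s (p.1 : E)).indicator (fun z => ‖z‖⁻¹ • ψ (x + z)) p.2)
      ((volume : Measure E).toSphere.prod volume) := by
  have h := ((hψ.integrable_inv_norm hE hx).comp_snd (volume : Measure E).toSphere).indicator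
    (measurableSet_coneNhd_prod s)
  exact h

/-- After Fubini, the measure of the directions `θ` whose cone contains `z` does not depend on `z ≠
0`: the cone is invariant under scaling and the measure under rotation. -/
lemma integral_setIntegral_coneNhd (hψ : IsBallDensity ψ) (hE : 2 ≤ finrank ℝ E) {x : E}
    (hx : ‖x‖ < 1) (s : ℝ) {e : E} (he : ‖e‖ = 1) :
    ∫ θ : sphere (0 : E) 1, (∫ z in coneNhd s (θ : E), ‖z‖⁻¹ • ψ (x + z))
      ∂(volume : Measure E).toSphere = coneMeasure e s • ∫ z, ‖z‖⁻¹ • ψ (x + z) := by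
  have : Nontrivial E := nontrivial_of_finrank_pos (R := ℝ) (by omega)
  simp_rw [← integral_indicator (measurableSet_coneNhd s _)]
  rw [integral_integral_swap (integrable_cone_prod hψ hE hx s), ← integral_smul]
  refine integral_congr_ae ?_
  filter_upwards [Measure.ae_ne volume (0 : E)] with z hz
  have hz0 : 0 < ‖z‖ := norm_pos_iff.2 hz
  have h1 : ∀ θ : sphere (0 : E) 1,
      (coneNhd s (θ : E)).indicator (fun z => ‖z‖⁻¹ • ψ (x + z)) z =
      {r : ℝ | r ^ 2 * (1 + s ^ 2) < s ^ 2}.indicator (fun _ => (1 : ℝ))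
        (inner ℝ (‖z‖⁻¹ • z) (θ : E)) • (‖z‖⁻¹ • ψ (x + z)) := by
    intro θ
    have h2 : z ∈ coneNhd s (θ : E) ↔
        inner ℝ (‖z‖⁻¹ • z) (θ : E) ∈ {r : ℝ | r ^ 2 * (1 + s ^ 2) < s ^ 2} := by
      change (_ : ℝ) < _ ↔ (_ : ℝ) < _
      rw [inner_smul_left]
      simp only [conj_trivial]
      rw [mul_pow, inv_pow, mul_assoc, inv_mul_lt_iff₀ (by positivity), mul_comm (s ^ 2)]
    by_cases h : z ∈ coneNhd s (θ : E)
    · rw [indicator_of_mem h, indicator_of_mem (h2.1 h), one_smul]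
    · rw [indicator_of_notMem h, indicator_of_notMem (fun h' => h (h2.2 h')), zero_smul]
  simp_rw [h1]
  rw [integral_smul_const, coneMeasure, integral_sphere_inner_eq (u := ‖z‖⁻¹ • z) (v := e)]
  rw [norm_smul, norm_inv, norm_norm, inv_mul_cancel₀ hz0.ne', he]

lemma tendsto_coneMeasure_smul (hψ : IsBallDensity ψ) (hE : 2 ≤ finrank ℝ E) {x : E}
    (hx : ‖x‖ < 1) {e : E} (he : ‖e‖ = 1) {s : ℕ → ℝ}
    (hs : Tendsto s atTop (𝓝 0)) (hs0 : ∀ k, 0 < s k) :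
    Tendsto (fun k => ((s k)⁻¹ * coneMeasure e (s k)) • ∫ z, ‖z‖⁻¹ • ψ (x + z)) atTop
      (𝓝 (∫ θ : sphere (0 : E) 1, ((2 : ℝ) • ∫ y : (ℝ ∙ (θ : E))ᗮ, ψ (x + (y : E)))
        ∂(volume : Measure E).toSphere)) := by
  obtain ⟨M, hM⟩ := hψ.bound
  have hn : ∀ θ : sphere (0 : E) 1, ‖(θ : E)‖ = 1 := fun θ => by simp
  have h1 : ∀ k, ((s k)⁻¹ * coneMeasure e (s k)) • ∫ z, ‖z‖⁻¹ • ψ (x + z) =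
      ∫ θ : sphere (0 : E) 1, ((s k)⁻¹ • ∫ z in coneNhd (s k) (θ : E), ‖z‖⁻¹ • ψ (x + z))
      ∂(volume : Measure E).toSphere := by
    intro k
    rw [integral_smul, integral_setIntegral_coneNhd hψ hE hx (s k) he, smul_smul]
  simp_rw [h1]
  have h2 : ∀ k, ∀ θ : sphere (0 : E) 1,
      (s k)⁻¹ • ∫ z in coneNhd (s k) (θ : E), ‖z‖⁻¹ • ψ (x + z) =
      ∫ y : (ℝ ∙ (θ : E))ᗮ, ∫ τ in (-1 : ℝ)..1, (√(1 + (s k * τ) ^ 2))⁻¹ •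
        ψ (x + ((y : E) + (s k * ‖y‖ * τ) • (θ : E))) := by
    intro k θ
    rw [setIntegral_coneNhd hψ hE hx (hs0 k) (hn θ), inv_smul_smul₀ (hs0 k).ne']
  refine tendsto_integral_of_dominated_convergence
    (fun _ => 2 * M * (2 ^ (finrank ℝ E - 1) * unitBallVolume (finrank ℝ E - 1))) ?_ ?_ ?_ ?_
  · intro k
    refine AEStronglyMeasurable.const_smul ?_ _
    have := (integrable_cone_prod hψ hE hx (s k)).aestronglyMeasurable.integral_prod_right'
    simp_rw [← integral_indicator (measurableSet_coneNhd (s k) _)]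
    exact this
  · exact integrable_const _
  · intro k
    refine Eventually.of_forall fun θ => ?_
    rw [h2]
    exact norm_cone_average_le hψ hE hM hx (hn θ)
  · refine Eventually.of_forall fun θ => ?_
    simp_rw [h2]
    exact tendsto_cone_average hψ hE hx (hn θ) hs

lemma isBallDensity_indicator_one :
    IsBallDensity ((ball (0 : E) 1).indicator fun _ => (1 : ℝ)) where
  meas := stronglyMeasurable_const.indicator measurableSet_ball
  bound := ⟨1, fun z => by
    by_cases h : z ∈ ball (0 : E) 1
    · rw [indicator_of_mem h, norm_one]
    · rw [indicator_of_notMem h, norm_zero]; exact zero_le_one⟩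
  supp z hz := indicator_of_notMem (by simpa using hz) _
  cont z hz := by
    rcases lt_or_gt_of_ne hz with h | h
    · refine (continuousAt_const (y := (1 : ℝ))).congr ?_
      filter_upwards [isOpen_ball.mem_nhds (show z ∈ ball (0 : E) 1 by simpa using h)] with w hw
      rw [indicator_of_mem hw]
    · refine (continuousAt_const (y := (0 : ℝ))).congr ?_
      have : z ∈ (closedBall (0 : E) 1)ᶜ := by simpa using h
      filter_upwards [isClosed_closedBall.isOpen_compl.mem_nhds this] with w hw
      rw [indicator_of_notMem (fun h' => hw (ball_subset_closedBall h'))]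

lemma integral_inv_norm_ball (hE : 2 ≤ finrank ℝ E) :
    ∫ z in ball (0 : E) 1, ‖z‖⁻¹ =
      finrank ℝ E * unitBallVolume (finrank ℝ E) / (finrank ℝ E - 1) := by
  have : Nontrivial E := nontrivial_of_finrank_pos (R := ℝ) (by omega)
  have h1 : ∀ z : E, (ball (0 : E) 1).indicator (fun z => ‖z‖⁻¹) z =
      (Iio (1 : ℝ)).indicator (fun r => r⁻¹) ‖z‖ := by
    intro z
    simp [indicator]
  rw [← integral_indicator measurableSet_ball]
  simp_rw [h1]
  rw [integral_fun_norm_addHaar volume, volume_real_ball _ one_pos]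
  have h2 : ∫ y in Ioi (0 : ℝ), y ^ (finrank ℝ E - 1) • (Iio (1 : ℝ)).indicator (fun r => r⁻¹) y =
      ∫ y in (0 : ℝ)..1, y ^ (finrank ℝ E - 2) := by
    rw [intervalIntegral.integral_of_le zero_le_one, integral_Ioc_eq_integral_Ioo,
      ← integral_indicator measurableSet_Ioo, ← integral_indicator measurableSet_Ioi]
    congr 1 with y
    by_cases h0 : 0 < y
    · rw [indicator_of_mem (mem_Ioi.2 h0)]
      by_cases h1 : y < 1
      · rw [indicator_of_mem (mem_Iio.2 h1), indicator_of_mem (show y ∈ Ioo (0 : ℝ) 1 from ⟨h0, h1⟩),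
          show finrank ℝ E - 1 = finrank ℝ E - 2 + 1 by omega, smul_eq_mul, pow_succ]
        field_simp
      · rw [indicator_of_notMem (by simpa using h1),
          indicator_of_notMem (fun h : y ∈ Ioo (0 : ℝ) 1 => h1 h.2), smul_zero]
    · rw [indicator_of_notMem (by simpa using h0),
        indicator_of_notMem (fun h : y ∈ Ioo (0 : ℝ) 1 => h0 h.1)]
  rw [h2, integral_pow]
  have h3 : ((finrank ℝ E - 2 : ℕ) : ℝ) + 1 = finrank ℝ E - 1 := by
    rw [Nat.cast_sub hE]
    push_cast
    ring
  rw [h3]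
  simp
  ring

/-- The limit is found without computing the area of a spherical zone: the indicator of the unit
ball at `x = 0` makes both the potential and the hyperplane integrals explicit. -/
lemma tendsto_coneMeasure (hE : 2 ≤ finrank ℝ E) {e : E} (he : ‖e‖ = 1) {s : ℕ → ℝ}
    (hs : Tendsto s atTop (𝓝 0)) (hs0 : ∀ k, 0 < s k) :
    Tendsto (fun k => (s k)⁻¹ * coneMeasure e (s k)) atTop
      (𝓝 (2 * ((finrank ℝ E - 1) * unitBallVolume (finrank ℝ E - 1)))) := by
  have : Nontrivial E := nontrivial_of_finrank_pos (R := ℝ) (by omega)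
  have h := tendsto_coneMeasure_smul (isBallDensity_indicator_one (E := E)) hE
    (x := 0) (by simp) he hs hs0
  have h1 : ∫ z : E, ‖z‖⁻¹ • (ball (0 : E) 1).indicator (fun _ => (1 : ℝ)) (0 + z) =
      finrank ℝ E * unitBallVolume (finrank ℝ E) / (finrank ℝ E - 1) := by
    rw [← integral_inv_norm_ball hE, ← integral_indicator measurableSet_ball]
    congr 1 with z
    rw [zero_add]
    by_cases hz : z ∈ ball (0 : E) 1
    · rw [indicator_of_mem hz, indicator_of_mem hz, smul_eq_mul, mul_one]
    · rw [indicator_of_notMem hz, indicator_of_notMem hz, smul_zero]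
  have h2 : ∀ θ : sphere (0 : E) 1, ∫ y : (ℝ ∙ (θ : E))ᗮ,
      (ball (0 : E) 1).indicator (fun _ => (1 : ℝ)) (0 + (y : E)) =
        unitBallVolume (finrank ℝ E - 1) := by
    intro θ
    have hd := finrank_orthogonal_add_one (θ : E) (by simp)
    have := nontrivial_orthogonal hE (θ := (θ : E)) (by simp)
    have h3 : ∀ y : (ℝ ∙ (θ : E))ᗮ, (ball (0 : E) 1).indicator (fun _ => (1 : ℝ)) (0 + (y : E)) =
        (ball (0 : (ℝ ∙ (θ : E))ᗮ) 1).indicator (fun _ => (1 : ℝ)) y := by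
      intro y
      simp [indicator]
    simp_rw [h3]
    rw [integral_indicator measurableSet_ball, setIntegral_const, volume_real_ball _ one_pos,
      one_pow, one_mul, smul_eq_mul, mul_one, ← hd, Nat.add_sub_cancel]
  simp_rw [h1, h2] at h
  rw [integral_const, toSphere_real_univ] at h
  have hn : (1 : ℝ) < finrank ℝ E := by
    have : (2 : ℝ) ≤ finrank ℝ E := by exact_mod_cast hE
    linarith
  have hV := unitBallVolume_pos (finrank ℝ E)
  set V := unitBallVolume (finrank ℝ E)
  set N : ℝ := (finrank ℝ E : ℝ)
  have h4 := h.mul_const (N * V / (N - 1))⁻¹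
  have hne : N * V / (N - 1) ≠ 0 := by
    have : N - 1 ≠ 0 := by linarith
    have : N ≠ 0 := by linarith
    positivity
  simp only [smul_eq_mul, mul_inv_cancel_right₀ hne] at h4
  convert h4 using 2
  have : N - 1 ≠ 0 := by linarith
  have : N ≠ 0 := by linarith
  field_simp

/-- The backprojection of the Radon transform is convolution with a multiple of `|z|⁻¹`. -/
theorem integral_sphere_radon (hψ : IsBallDensity ψ) (hE : 2 ≤ finrank ℝ E) {x : E}
    (hx : ‖x‖ < 1) :
    ∫ θ : sphere (0 : E) 1, (∫ y : (ℝ ∙ (θ : E))ᗮ, ψ (x + (y : E))) ∂(volume : Measure E).toSphere =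
      ((finrank ℝ E - 1) * unitBallVolume (finrank ℝ E - 1)) • ∫ z, ‖z‖⁻¹ • ψ (x + z) := by
  have : Nontrivial E := nontrivial_of_finrank_pos (R := ℝ) (by omega)
  obtain ⟨e, he⟩ := exists_norm_eq E zero_le_one
  have hs : Tendsto (fun k : ℕ => 1 / ((k : ℝ) + 1)) atTop (𝓝 0) :=
    tendsto_one_div_add_atTop_nhds_zero_nat
  have h1 := tendsto_coneMeasure_smul hψ hE hx he hs fun k => by positivity
  have h2 := (tendsto_coneMeasure hE he hs fun k => by positivity).smul_const
    (∫ z, ‖z‖⁻¹ • ψ (x + z))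
  -- Both limits are of the same sequence; the factor 2 occurs on each side.
  have h3 := tendsto_nhds_unique h1 h2
  rw [integral_smul, mul_smul] at h3
  exact smul_right_injective F (two_ne_zero (α := ℝ)) h3

end Cone

/-! ### Backprojection of the logarithmic transform. -/

section LogTransform

variable {E : Type*} [NormedAddCommGroup E] [InnerProductSpace ℝ E] [FiniteDimensional ℝ E]
  [MeasurableSpace E] [BorelSpace E] {F : Type*} [NormedAddCommGroup F] [NormedSpace ℝ F]
  [CompleteSpace F] {ψ : E → F}

lemma integrableOn_log_Ioo (a b : ℝ) : IntegrableOn Real.log (Ioo a b) :=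
  (intervalIntegral.intervalIntegrable_log' (a := a) (b := b)).1.mono_set Ioo_subset_Ioc_self

lemma inner_hyperplaneIsometry {θ : E} (hθ : ‖θ‖ = 1) (y : (ℝ ∙ θ)ᗮ) (t : ℝ) :
    inner ℝ ((y : E) + t • θ) θ = t := by
  have : inner ℝ (y : E) θ = 0 := by
    rw [real_inner_comm]
    exact Submodule.mem_orthogonal_singleton_iff_inner_right.1 y.2
  rw [inner_add_left, this, inner_smul_left, real_inner_self_eq_norm_sq, hθ]
  simp

/-- In the coordinates `y + tθ` the function is `log t`, dominated by the product of the indicator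
of a ball in `y` with `log` on `(-2, 2)`. -/
lemma integrableOn_log_inner {θ : E} (hθ : ‖θ‖ = 1) :
    IntegrableOn (fun z : E => Real.log (inner ℝ z θ)) (ball 0 2) := by
  rw [← integrable_indicator_iff measurableSet_ball,
    ← (measurePreserving_prod (hyperplaneIsometry θ hθ)).integrable_comp_emb
      (measurableEmbedding_prod _)]
  have h1 : Integrable ((Ioo (-2 : ℝ) 2).indicator Real.log) :=
    (integrable_indicator_iff measurableSet_Ioo).2 (integrableOn_log_Ioo _ _)
  have h2 : Integrable ((ball (0 : (ℝ ∙ θ)ᗮ) 2).indicator fun _ => (1 : ℝ)) :=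
    (integrable_indicator_iff measurableSet_ball).2 (integrableOn_const measure_ball_lt_top.ne)
  refine (h2.mul_prod h1).mono ?_ (Eventually.of_forall fun ⟨y, t⟩ => ?_)
  · refine Measurable.aestronglyMeasurable ?_
    refine Measurable.comp (Measurable.indicator (Real.measurable_log.comp ?_) measurableSet_ball)
      (measurableEmbedding_prod _).measurable
    fun_prop
  · simp only [Function.comp_apply, hyperplaneIsometry_apply]
    by_cases h : (y : E) + t • θ ∈ ball (0 : E) 2
    · have h3 : ‖(y : E) + t • θ‖ < 2 := by simpa using h
      have h4 := norm_sq_smul_add hθ t y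
      rw [add_comm] at h4
      have h5 : ‖y‖ < 2 := (norm_le_norm_add_smul hθ y t).trans_lt h3
      have h6 : |t| < 2 := by
        refine abs_lt_of_sq_lt_sq ?_ zero_le_two
        nlinarith [norm_nonneg ((y : E) + t • θ), sq_nonneg ‖y‖]
      rw [indicator_of_mem h, inner_hyperplaneIsometry hθ,
        indicator_of_mem (show y ∈ ball (0 : (ℝ ∙ θ)ᗮ) 2 by simpa using h5),
        indicator_of_mem (show t ∈ Ioo (-2 : ℝ) 2 from abs_lt.1 h6), one_mul]
    · rw [indicator_of_notMem h, norm_zero]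
      exact norm_nonneg _

lemma integral_norm_log_inner_eq {θ e : E} (h : ‖θ‖ = ‖e‖) :
    ∫ z in ball (0 : E) 2, ‖Real.log (inner ℝ z θ)‖ =
      ∫ z in ball (0 : E) 2, ‖Real.log (inner ℝ z e)‖ := by
  obtain ⟨A, hA⟩ := exists_isometry_map_inner h
  rw [← A.measurePreserving.setIntegral_preimage_emb A.toMeasurableEquiv.measurableEmbedding]
  have : A ⁻¹' ball (0 : E) 2 = ball 0 2 := by
    ext z
    simp
  rw [this]
  congr 1 with z
  rw [real_inner_comm, hA, real_inner_comm]

lemma IsBallDensity.norm_log_smul_le (hψ : IsBallDensity ψ) {M : ℝ} (hM : ∀ z, ‖ψ z‖ ≤ M) {x : E}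
    (hx : ‖x‖ < 1) (θ z : E) : ‖Real.log (inner ℝ z θ) • ψ (x + z)‖ ≤
      (ball (0 : E) 2).indicator (fun z => M * ‖Real.log (inner ℝ z θ)‖) z := by
  by_cases hz : z ∈ ball (0 : E) 2
  · rw [indicator_of_mem hz, norm_smul, mul_comm]
    exact mul_le_mul_of_nonneg_right (hM _) (norm_nonneg _)
  · rw [indicator_of_notMem hz, hψ.zero_of_two_le hx (by simpa using hz), smul_zero, norm_zero]

lemma stronglyMeasurable_log_smul (hψ : IsBallDensity ψ) (x : E) :
    StronglyMeasurable fun p : sphere (0 : E) 1 × E =>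
      Real.log (inner ℝ p.2 (p.1 : E)) • ψ (x + p.2) := by
  have h1 : Continuous fun p : sphere (0 : E) 1 × E => (inner ℝ p.2 (p.1 : E) : ℝ) := by fun_prop
  refine StronglyMeasurable.smul ?_ (hψ.meas.comp_measurable (by fun_prop))
  exact (Real.measurable_log.comp h1.measurable).stronglyMeasurable

lemma integrable_log_smul (hψ : IsBallDensity ψ) {x : E} (hx : ‖x‖ < 1)
    (θ : sphere (0 : E) 1) :
    Integrable fun z : E => Real.log (inner ℝ z (θ : E)) • ψ (x + z) := by
  obtain ⟨M, hM⟩ := hψ.bound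
  have h := integrableOn_log_inner (θ := (θ : E)) (by simp)
  refine Integrable.mono' ((integrable_indicator_iff measurableSet_ball).2 (h.norm.const_mul M)) ?_
    (Eventually.of_forall fun z => hψ.norm_log_smul_le hM hx θ z)
  exact ((stronglyMeasurable_log_smul hψ x).comp_measurable
    (measurable_prodMk_left (x := θ))).aestronglyMeasurable

lemma integrable_log_prod (hψ : IsBallDensity ψ) {x : E} (hx : ‖x‖ < 1) :
    Integrable (fun p : sphere (0 : E) 1 × E =>
      Real.log (inner ℝ p.2 (p.1 : E)) • ψ (x + p.2))
      ((volume : Measure E).toSphere.prod volume) := by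
  obtain ⟨M, hM⟩ := hψ.bound
  have hmeas := stronglyMeasurable_log_smul hψ x
  refine (integrable_prod_iff hmeas.aestronglyMeasurable).2
    ⟨Eventually.of_forall fun θ => integrable_log_smul hψ hx θ, ?_⟩
  -- A reference direction `e` supplies a majorant independent of `θ`; the sphere is empty when `E`
  -- is trivial.
  rcases isEmpty_or_nonempty (sphere (0 : E) 1) with hemp | ⟨⟨e⟩⟩
  · exact Integrable.of_isEmpty
  refine (integrable_const (M * ∫ z in ball (0 : E) 2, ‖Real.log (inner ℝ z (e : E))‖)).mono'
    hmeas.norm.integral_prod_right.aestronglyMeasurable (Eventually.of_forall fun θ => ?_)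
  rw [Real.norm_of_nonneg (integral_nonneg fun _ => norm_nonneg _),
    ← integral_norm_log_inner_eq (θ := (θ : E)) (e := (e : E)) (by simp),
    ← integral_const_mul, ← integral_indicator measurableSet_ball]
  refine integral_mono_of_nonneg (Eventually.of_forall fun _ => norm_nonneg _) ?_
    (Eventually.of_forall fun z => hψ.norm_log_smul_le hM hx θ z)
  exact (integrable_indicator_iff measurableSet_ball).2
    ((integrableOn_log_inner (by simp)).norm.const_mul M)

lemma ae_sphere_inner_ne_zero {e : E} (he : ‖e‖ = 1) :
    ∀ᵐ θ : sphere (0 : E) 1 ∂(volume : Measure E).toSphere, inner ℝ e (θ : E) ≠ 0 :=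
  toSphere_snd_eq_zero (hyperplaneIsometry e he)

/-- Only almost everywhere: where `z ⬝ θ = 0` the convention `Real.log 0 = 0` breaks additivity of
the logarithm. -/
lemma log_inner_ae_eq {z : E} (hz : z ≠ 0) :
    (fun θ : sphere (0 : E) 1 => Real.log (inner ℝ z (θ : E)))
      =ᵐ[(volume : Measure E).toSphere]
      fun θ => Real.log ‖z‖ + Real.log (inner ℝ (‖z‖⁻¹ • z) (θ : E)) := by
  have hz0 : ‖z‖ ≠ 0 := norm_ne_zero_iff.2 hz
  have h1 : ‖‖z‖⁻¹ • z‖ = 1 := by rw [norm_smul, norm_inv, norm_norm, inv_mul_cancel₀ hz0]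
  filter_upwards [ae_sphere_inner_ne_zero h1] with θ hθ
  rw [← Real.log_mul hz0 hθ, inner_smul_left]
  simp [mul_inv_cancel_left₀ hz0]

/-- Integrability on the product gives it on the sphere for almost every `z` in the ball. One
nonzero such `z` suffices: rescaling changes the logarithm by a constant, and rotation reaches `e`.
-/
lemma integrable_sphere_log_inner (hE : 2 ≤ finrank ℝ E) {e : E} (he : ‖e‖ = 1) :
    Integrable (fun θ : sphere (0 : E) 1 => Real.log (inner ℝ e (θ : E)))
      (volume : Measure E).toSphere := by
  have : Nontrivial E := nontrivial_of_finrank_pos (R := ℝ) (by omega)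
  have h1 := (integrable_log_prod (isBallDensity_indicator_one (E := E)) (x := 0)
    (by simp)).swap.prod_right_ae
  have h2 : (volume (ball (0 : E) 1 \ {0})) ≠ 0 := by
    rw [measure_sdiff_null (measure_singleton _)]
    exact (measure_ball_pos volume _ one_pos).ne'
  obtain ⟨z, ⟨hz, hz0⟩, hz1⟩ := Measure.exists_mem_of_measure_ne_zero_of_ae h2 (ae_restrict_of_ae h1)
  have hz0 : z ≠ 0 := hz0
  have hzn : ‖z‖ ≠ 0 := norm_ne_zero_iff.2 hz0
  have h3 : Integrable (fun θ : sphere (0 : E) 1 => Real.log (inner ℝ z (θ : E)))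
      (volume : Measure E).toSphere := by
    simpa [indicator_of_mem hz] using hz1
  have h4 := (h3.congr (log_inner_ae_eq hz0)).sub (integrable_const (Real.log ‖z‖))
  have h5 : ‖‖z‖⁻¹ • z‖ = ‖e‖ := by
    rw [norm_smul, norm_inv, norm_norm, inv_mul_cancel₀ hzn, he]
  rw [← integrable_sphere_inner_iff h5 Real.log]
  simpa [Pi.sub_def] using h4

/-- The integral of the logarithmic kernel over the sphere. -/
def sphereLogIntegral (e : E) : ℝ :=
  ∫ θ : sphere (0 : E) 1, Real.log (inner ℝ e (θ : E)) ∂(volume : Measure E).toSphere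

lemma integral_sphere_log_inner (hE : 2 ≤ finrank ℝ E) {e : E} (he : ‖e‖ = 1) {z : E}
    (hz : z ≠ 0) :
    ∫ θ : sphere (0 : E) 1, Real.log (inner ℝ z (θ : E)) ∂(volume : Measure E).toSphere =
      finrank ℝ E * unitBallVolume (finrank ℝ E) * Real.log ‖z‖ + sphereLogIntegral e := by
  have : Nontrivial E := nontrivial_of_finrank_pos (R := ℝ) (by omega)
  have h1 : ‖‖z‖⁻¹ • z‖ = ‖e‖ := by
    rw [norm_smul, norm_inv, norm_norm, inv_mul_cancel₀ (norm_ne_zero_iff.2 hz), he]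
  rw [integral_congr_ae (log_inner_ae_eq hz), integral_add (integrable_const _)
    (integrable_sphere_log_inner hE (h1.trans he)), integral_const, toSphere_real_univ, smul_eq_mul,
    sphereLogIntegral, integral_sphere_inner_eq h1]

/-- Fubini in the coordinates `y + tθ`, with nothing from `|t| ≥ 1` by the support of `ψ`. The
absolute value disappears because `Real.log` is even. -/
lemma integral_log_radon (hψ : IsBallDensity ψ) {x : E} (hx : ‖x‖ < 1) {θ : E} (hθ : ‖θ‖ = 1) :
    ∫ t in (-1 : ℝ)..1, Real.log |inner ℝ x θ - t| • ∫ y : (ℝ ∙ θ)ᗮ, ψ (t • θ + (y : E)) =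
      ∫ z : E, Real.log (inner ℝ z θ) • ψ (x + z) := by
  have hint := integrable_log_smul hψ hx ⟨θ, by simpa using hθ⟩
  have h1 : ∫ z : E, Real.log (inner ℝ z θ) • ψ (x + z) =
      ∫ z : E, Real.log (inner ℝ (z - x) θ) • ψ z := by
    rw [← integral_add_left_eq_self (fun z => Real.log (inner ℝ (z - x) θ) • ψ z) x]
    simp
  have hint2 : Integrable fun z : E => Real.log (inner ℝ (z - x) θ) • ψ z := by
    simpa using hint.comp_sub_right x
  rw [h1, ← (measurePreserving_prod (hyperplaneIsometry θ hθ)).integral_comp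
    (measurableEmbedding_prod _), Measure.volume_eq_prod, integral_prod_symm]
  · have h2 : ∀ (t : ℝ) (y : (ℝ ∙ θ)ᗮ),
        Real.log (inner ℝ (hyperplaneIsometry θ hθ (WithLp.toLp 2 (y, t)) - x) θ) •
          ψ (hyperplaneIsometry θ hθ (WithLp.toLp 2 (y, t))) =
        Real.log |inner ℝ x θ - t| • ψ (t • θ + (y : E)) := by
      intro t y
      rw [hyperplaneIsometry_apply, inner_sub_left, inner_hyperplaneIsometry hθ, abs_sub_comm,
        Real.log_abs, add_comm]
    simp_rw [h2, integral_smul]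
    rw [intervalIntegral.integral_of_le (by norm_num)]
    refine setIntegral_eq_integral_of_forall_compl_eq_zero fun t ht => ?_
    have ht1 : 1 ≤ |t| := by
      by_contra! h
      exact ht ⟨(abs_lt.1 h).1, (abs_lt.1 h).2.le⟩
    rw [integral_eq_zero_of_ae, smul_zero]
    refine Eventually.of_forall fun y => hψ.supp _ ?_
    refine one_le_sq_iff₀ (norm_nonneg _) |>.1 ?_
    rw [norm_sq_smul_add hθ, ← sq_abs t]
    nlinarith [sq_nonneg ‖y‖]
  · exact (measurePreserving_prod (hyperplaneIsometry θ hθ)).integrable_comp_of_integrable hint2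

/-- The backprojection of the logarithmic transform of the Radon transform is, up to a constant,
a logarithmic potential. -/
theorem integral_sphere_log_radon (hψ : IsBallDensity ψ) (hE : 2 ≤ finrank ℝ E) {x : E}
    (hx : ‖x‖ < 1) {e : E} (he : ‖e‖ = 1) :
    ∫ θ : sphere (0 : E) 1, (∫ t in (-1 : ℝ)..1, Real.log |inner ℝ x (θ : E) - t| •
        ∫ y : (ℝ ∙ (θ : E))ᗮ, ψ (t • (θ : E) + (y : E))) ∂(volume : Measure E).toSphere =
      ∫ z, (finrank ℝ E * unitBallVolume (finrank ℝ E) * Real.log ‖z‖ + sphereLogIntegral e) •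
        ψ (x + z) := by
  have : Nontrivial E := nontrivial_of_finrank_pos (R := ℝ) (by omega)
  have h1 : ∀ θ : sphere (0 : E) 1, ∫ t in (-1 : ℝ)..1, Real.log |inner ℝ x (θ : E) - t| •
        ∫ y : (ℝ ∙ (θ : E))ᗮ, ψ (t • (θ : E) + (y : E)) =
      ∫ z : E, Real.log (inner ℝ z (θ : E)) • ψ (x + z) :=
    fun θ => integral_log_radon hψ hx (by simp)
  simp_rw [h1]
  rw [integral_integral_swap (integrable_log_prod hψ hx)]
  refine integral_congr_ae ?_
  filter_upwards [Measure.ae_ne volume (0 : E)] with z hz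
  rw [integral_smul_const, integral_sphere_log_inner hE he hz]

end LogTransform

/-! ### `C²` regularity from partial derivatives and their uniform limits. -/

section SecondDerivatives

variable {E : Type*} [NormedAddCommGroup E] [InnerProductSpace ℝ E] [FiniteDimensional ℝ E]
  {F : Type*} [NormedAddCommGroup F] [NormedSpace ℝ F] {ι : Type*} [Fintype ι]

/-- The linear map with prescribed values on an orthonormal basis. -/
def ofPartials (b : OrthonormalBasis ι ℝ E) : (ι → F) →L[ℝ] (E →L[ℝ] F) :=
  ∑ i, (ContinuousLinearMap.smulRightL ℝ E F (innerSL ℝ (b i))).comp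
    (ContinuousLinearMap.proj (R := ℝ) (φ := fun _ : ι => F) i)

lemma ofPartials_apply (b : OrthonormalBasis ι ℝ E) (v : ι → F) (w : E) :
    ofPartials b v w = ∑ i, (inner ℝ (b i) w : ℝ) • v i := by
  simp [ofPartials]

lemma ofPartials_apply_basis (b : OrthonormalBasis ι ℝ E) (v : ι → F) (i : ι) :
    ofPartials b v (b i) = v i := by
  classical
  rw [ofPartials_apply, Finset.sum_eq_single i]
  · simp
  · intro j _ hj
    rw [b.orthonormal.2 hj, zero_smul]
  · simp

lemma eq_ofPartials (b : OrthonormalBasis ι ℝ E) (L : E →L[ℝ] F) :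
    L = ofPartials b fun i => L (b i) := by
  ext w
  rw [ofPartials_apply]
  conv_lhs => rw [← b.sum_repr' w]
  simp

/-- Continuous second partial derivatives give a `C²` function, whose Laplacian is the trace. -/
lemma contDiffOn_two_of_partials (b : OrthonormalBasis ι ℝ E) {U : Set E} (hU : IsOpen U)
    {u : E → F} {u₁ : ι → E → F} {u₂ : ι → ι → E → F}
    (h1 : ∀ x ∈ U, HasFDerivAt u (ofPartials b fun i => u₁ i x) x)
    (h2 : ∀ i, ∀ x ∈ U, HasFDerivAt (u₁ i) (ofPartials b fun j => u₂ i j x) x)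
    (h3 : ∀ i j, ContinuousOn (u₂ i j) U) :
    ContDiffOn ℝ 2 u U ∧ ∀ x ∈ U, Laplacian.laplacian u x = ∑ i, u₂ i i x := by
  have hc1 : ∀ i, ContDiffOn ℝ 1 (u₁ i) U := by
    intro i
    rw [show (1 : WithTop ℕ∞) = 0 + 1 by simp, contDiffOn_succ_iff_fderiv_of_isOpen hU]
    refine ⟨fun x hx => (h2 i x hx).differentiableAt.differentiableWithinAt, by simp, ?_⟩
    rw [contDiffOn_zero]
    have : ContinuousOn (fun x => ofPartials b fun j => u₂ i j x) U :=
      (ofPartials b).continuous.comp_continuousOn (continuousOn_pi.2 fun j => h3 i j)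
    exact this.congr fun x hx => (h2 i x hx).fderiv
  refine ⟨?_, fun x hx => ?_⟩
  · rw [show (2 : WithTop ℕ∞) = 1 + 1 by norm_num, contDiffOn_succ_iff_fderiv_of_isOpen hU]
    refine ⟨fun x hx => (h1 x hx).differentiableAt.differentiableWithinAt, by simp, ?_⟩
    have : ContDiffOn ℝ 1 (fun x => ofPartials b fun i => u₁ i x) U :=
      ContDiff.comp_contDiffOn (g := ofPartials (F := F) b)
        (ofPartials (F := F) b).contDiff (contDiffOn_pi.2 hc1)
    exact this.congr fun x hx => (h1 x hx).fderiv
  · rw [InnerProductSpace.laplacian_eq_iteratedFDeriv_orthonormalBasis u b]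
    refine Finset.sum_congr rfl fun i _ => ?_
    rw [iteratedFDeriv_two_apply]
    have h4 : fderiv ℝ u =ᶠ[𝓝 x] fun x => ofPartials b fun i => u₁ i x := by
      filter_upwards [hU.mem_nhds hx] with y hy
      exact (h1 y hy).fderiv
    have h5 : HasFDerivAt (fun x i => u₁ i x)
        (ContinuousLinearMap.pi fun i => ofPartials b fun j => u₂ i j x) x :=
      hasFDerivAt_pi.2 fun i => h2 i x hx
    have h6 := ((ofPartials (F := F) b).hasFDerivAt.comp x h5)
    rw [h4.fderiv_eq]
    change fderiv ℝ (ofPartials b ∘ fun x i => u₁ i x) x _ _ = _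
    rw [h6.fderiv]
    simp [ofPartials_apply_basis]

lemma tendstoUniformlyOn_ofPartials (b : OrthonormalBasis ι ℝ E) {U : Set E}
    {v : ℕ → ι → E → F} {w : ι → E → F}
    (h : ∀ i, TendstoUniformlyOn (fun m => v m i) (w i) atTop U) :
    TendstoUniformlyOn (fun m x => ofPartials b fun i => v m i x)
      (fun x => ofPartials b fun i => w i x) atTop U := by
  refine (ofPartials (F := F) b).uniformContinuous.comp_tendstoUniformlyOn
    (f := fun x i => w i x) (F := fun m x i => v m i x) ?_
  rw [Metric.tendstoUniformlyOn_iff]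
  intro ε hε
  have := fun i => Metric.tendstoUniformlyOn_iff.1 (h i) ε hε
  filter_upwards [eventually_all.2 this] with m hm x hx
  exact (dist_pi_lt_iff hε).2 fun i => hm i x hx

/-- `C²` regularity passes to limits with uniformly convergent first and second partials. -/
lemma contDiffOn_two_of_tendsto (b : OrthonormalBasis ι ℝ E) {U : Set E} (hU : IsOpen U)
    {u : E → F} {u₁ : ι → E → F} {u₂ : ι → ι → E → F}
    {v : ℕ → E → F} {v₁ : ℕ → ι → E → F} {v₂ : ℕ → ι → ι → E → F}
    (h1 : ∀ m x, HasFDerivAt (v m) (ofPartials b fun i => v₁ m i x) x)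
    (h2 : ∀ m i x, HasFDerivAt (v₁ m i) (ofPartials b fun j => v₂ m i j x) x)
    (h3 : ∀ m i j, Continuous (v₂ m i j))
    (t0 : ∀ x ∈ U, Tendsto (fun m => v m x) atTop (𝓝 (u x)))
    (t1 : ∀ i, TendstoUniformlyOn (fun m => v₁ m i) (u₁ i) atTop U)
    (t2 : ∀ i j, TendstoUniformlyOn (fun m => v₂ m i j) (u₂ i j) atTop U) :
    ContDiffOn ℝ 2 u U ∧ ∀ x ∈ U, Laplacian.laplacian u x = ∑ i, u₂ i i x := by
  refine contDiffOn_two_of_partials b hU (u₁ := u₁) (u₂ := u₂) ?_ ?_ ?_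
  · intro x hx
    exact hasFDerivAt_of_tendstoUniformlyOn hU (tendstoUniformlyOn_ofPartials b t1)
      (fun m x _ => h1 m x) t0 hx
  · intro i x hx
    exact hasFDerivAt_of_tendstoUniformlyOn hU (tendstoUniformlyOn_ofPartials b (t2 i))
      (fun m x _ => h2 m i x) (fun y hy => (t1 i).tendsto_at hy) hx
  · intro i j
    exact (t2 i j).continuousOn (Frequently.of_forall fun m => (h3 m i j).continuousOn)

end SecondDerivatives

/-! ### Potentials and uniform convergence of integral operators. -/

section Potential

variable {E : Type*} [NormedAddCommGroup E] [InnerProductSpace ℝ E] [FiniteDimensional ℝ E]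
  [MeasurableSpace E] [BorelSpace E] {F : Type*} [NormedAddCommGroup F] [NormedSpace ℝ F]
  [CompleteSpace F] {ψ : E → F} {ι : Type*} [Fintype ι]

/-- The potential of the density `ψ` with kernel `k`. -/
def potential (k : E → ℝ) (ψ : E → F) (x : E) : F := ∫ y, k (x - y) • ψ y

lemma potential_eq (k : E → ℝ) (ψ : E → F) (x : E) :
    potential k ψ x = ∫ z, k z • ψ (x - z) := by
  rw [potential, ← integral_sub_left_eq_self _ volume x]
  simp

lemma IsBallDensity.integrable (hψ : IsBallDensity ψ) : Integrable ψ := by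
  obtain ⟨M, hM⟩ := hψ.bound
  refine Integrable.mono' ((integrable_indicator_iff measurableSet_ball).2
    (integrableOn_const (measure_ball_lt_top (x := (0 : E)) (r := 1)).ne (C := M)))
    hψ.meas.aestronglyMeasurable (Eventually.of_forall fun z => ?_)
  by_cases h : z ∈ ball (0 : E) 1
  · rw [indicator_of_mem h]
    exact hM z
  · rw [indicator_of_notMem h, hψ.supp z (by simpa using h), norm_zero]

lemma IsBallDensity.integrable_potential (hψ : IsBallDensity ψ) {G : Type*}
    [NormedAddCommGroup G] [NormedSpace ℝ G]
    {k : E → G} (hk : Continuous k) (x : E) :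
    Integrable fun y => ‖k (x - y)‖ * ‖ψ y‖ := by
  obtain ⟨C, hC⟩ := (isCompact_closedBall (0 : E) (‖x‖ + 1)).exists_bound_of_continuousOn
    hk.norm.continuousOn
  refine (hψ.integrable.norm.const_mul C).mono' ?_ (Eventually.of_forall fun y => ?_)
  · exact (hk.comp (continuous_const.sub continuous_id)).norm.aestronglyMeasurable.mul
      hψ.meas.norm.aestronglyMeasurable
  · rw [norm_mul, norm_norm, norm_norm]
    by_cases hy : ‖y‖ < 1
    · have : x - y ∈ closedBall (0 : E) (‖x‖ + 1) := by
        rw [mem_closedBall_zero_iff]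
        exact (norm_sub_le x y).trans (by linarith)
      have h := hC _ this
      rw [norm_norm] at h
      gcongr
    · rw [hψ.supp y (not_lt.1 hy)]
      simp

/-- Potentials with smooth kernels may be differentiated under the integral sign. -/
lemma hasFDerivAt_potential (hψ : IsBallDensity ψ) (b : OrthonormalBasis ι ℝ E) {k : E → ℝ}
    {k' : E → E →L[ℝ] ℝ} (hk : ∀ z, HasFDerivAt k (k' z) z) (hk' : Continuous k') (x : E) :
    HasFDerivAt (potential k ψ) (ofPartials b fun i => potential (fun z => k' z (b i)) ψ x) x := by
  have hkc : Continuous k := continuous_iff_continuousAt.2 fun z => (hk z).continuousAt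
  obtain ⟨C, hC⟩ := (isCompact_closedBall (0 : E) (‖x‖ + 2)).exists_bound_of_continuousOn
    hk'.continuousOn
  have hmeas : ∀ x : E, AEStronglyMeasurable (fun y => k (x - y) • ψ y) volume := fun x =>
    (hkc.comp (continuous_const.sub continuous_id)).aestronglyMeasurable.smul
      hψ.meas.aestronglyMeasurable
  have hmeas' : AEStronglyMeasurable (fun y => (k' (x - y)).smulRight (ψ y)) volume := by
    have h1 : AEStronglyMeasurable (fun y => k' (x - y)) volume :=
      (hk'.comp (continuous_const.sub continuous_id)).aestronglyMeasurable
    have h2 := (ContinuousLinearMap.smulRightL ℝ E F).aestronglyMeasurable_comp₂ h1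
      hψ.meas.aestronglyMeasurable (μ := volume)
    exact h2
  have hint : Integrable (fun y => (k' (x - y)).smulRight (ψ y)) := by
    refine (hψ.integrable_potential hk' x).mono' hmeas' (Eventually.of_forall fun y => ?_)
    rw [ContinuousLinearMap.norm_smulRight_apply]
  have h := hasFDerivAt_integral_of_dominated_of_fderiv_le (μ := (volume : Measure E))
    (F := fun x y => k (x - y) • ψ y) (F' := fun x y => (k' (x - y)).smulRight (ψ y))
    (s := ball x 1) (x₀ := x) (bound := fun y => C * ‖ψ y‖) (ball_mem_nhds x one_pos)
    (Eventually.of_forall hmeas) ?_ hmeas' ?_ (hψ.integrable.norm.const_mul C) ?_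
  · rw [eq_ofPartials b (∫ y, (k' (x - y)).smulRight (ψ y))] at h
    refine h.congr_fderiv (congrArg _ (funext fun i => ?_))
    rw [ContinuousLinearMap.integral_apply hint]
    rfl
  · refine (hψ.integrable_potential hkc x).mono' (hmeas x) (Eventually.of_forall fun y => ?_)
    rw [norm_smul]
  · refine Eventually.of_forall fun y w hw => ?_
    rw [ContinuousLinearMap.norm_smulRight_apply]
    by_cases hy : ‖y‖ < 1
    · have : w - y ∈ closedBall (0 : E) (‖x‖ + 2) := by
        rw [mem_closedBall_zero_iff]
        have h1 : ‖w - x‖ < 1 := by simpa [dist_eq_norm] using hw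
        have h2 : ‖w - y‖ ≤ ‖w - x‖ + ‖x‖ + ‖y‖ := by
          calc ‖w - y‖ = ‖(w - x) + x - y‖ := by congr 1; abel
            _ ≤ ‖(w - x) + x‖ + ‖y‖ := norm_sub_le _ _
            _ ≤ _ := by gcongr; exact norm_add_le _ _
        linarith
      have := hC _ this
      gcongr
    · rw [hψ.supp y (not_lt.1 hy)]
      simp
  · refine Eventually.of_forall fun y w _ => ?_
    have h1 : HasFDerivAt (fun x => k (x - y)) (k' (w - y)) w := by
      have := (hk (w - y)).comp w ((hasFDerivAt_id w).sub_const y)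
      rwa [ContinuousLinearMap.comp_id] at this
    exact h1.smul_const (ψ y)

lemma continuous_potential (hψ : IsBallDensity ψ) {k : E → ℝ} (hk : ContDiff ℝ 1 k) :
    Continuous (potential k ψ) := by
  refine continuous_iff_continuousAt.2 fun x => ?_
  exact (hasFDerivAt_potential hψ (stdOrthonormalBasis ℝ E)
    (fun z => (hk.differentiable one_ne_zero z).hasFDerivAt)
    (hk.continuous_fderiv one_ne_zero) x).continuousAt

/-- Uniform convergence of integral operators under domination. -/
lemma tendstoUniformlyOn_integral_smul {U : Set E} {k : ℕ → E → ℝ} {k₀ K w : E → ℝ}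
    {Θ : E → E → F} (hk : ∀ m, Measurable (k m)) (hk₀ : Measurable k₀)
    (hΘ : ∀ x ∈ U, StronglyMeasurable (Θ x)) (hw : ∀ x ∈ U, ∀ z, ‖Θ x z‖ ≤ w z)
    (hwm : AEStronglyMeasurable w)
    (hK : ∀ m, ∀ᵐ z, |k m z| ≤ K z) (hKw : Integrable fun z => K z * w z)
    (hlim : ∀ᵐ z, Tendsto (fun m => k m z) atTop (𝓝 (k₀ z))) :
    TendstoUniformlyOn (fun m x => ∫ z, k m z • Θ x z) (fun x => ∫ z, k₀ z • Θ x z) atTop U := by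
  rcases U.eq_empty_or_nonempty with rfl | ⟨x₀, hx₀⟩
  · exact tendstoUniformlyOn_empty
  have hw0 : ∀ z, 0 ≤ w z := fun z => (norm_nonneg _).trans (hw x₀ hx₀ z)
  have hK₀ : ∀ᵐ z, |k₀ z| ≤ K z := by
    filter_upwards [ae_all_iff.2 hK, hlim] with z h1 h2
    exact le_of_tendsto h2.abs (Eventually.of_forall h1)
  have hint : ∀ x ∈ U, ∀ k : E → ℝ, Measurable k → (∀ᵐ z, |k z| ≤ K z) →
      Integrable fun z => k z • Θ x z := by
    intro x hx k hk hkK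
    refine hKw.mono' (hk.stronglyMeasurable.smul (hΘ x hx)).aestronglyMeasurable ?_
    filter_upwards [hkK] with z hz
    rw [norm_smul, Real.norm_eq_abs]
    exact mul_le_mul hz (hw x hx z) (norm_nonneg _) ((abs_nonneg _).trans hz)
  have hdiff : ∀ m, ∀ᵐ z, ‖|k m z - k₀ z| * w z‖ ≤ 2 * (K z * w z) := by
    intro m
    filter_upwards [hK m, hK₀] with z h1 h2
    rw [norm_mul, Real.norm_eq_abs, abs_abs, Real.norm_of_nonneg (hw0 z)]
    have : |k m z - k₀ z| ≤ 2 * K z := (abs_sub _ _).trans (by linarith)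
    nlinarith [hw0 z]
  have hdm : ∀ m, AEStronglyMeasurable (fun z => |k m z - k₀ z| * w z) volume := fun m =>
    (((hk m).sub hk₀).abs.aestronglyMeasurable (f := fun z => |k m z - k₀ z|)).mul hwm
  -- This integral bounds the difference of the operators at every point of `U` and is free of `x`,
  -- so its convergence is the uniform convergence.
  have hto : Tendsto (fun m => ∫ z, |k m z - k₀ z| * w z) atTop (𝓝 0) := by
    have := tendsto_integral_of_dominated_convergence (fun z => 2 * (K z * w z))
      (F := fun m z => |k m z - k₀ z| * w z) (f := fun _ => (0 : ℝ)) (μ := volume)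
      hdm (hKw.const_mul 2) hdiff ?_
    · simpa using this
    · filter_upwards [hlim] with z hz
      have h1 : Tendsto (fun m => k m z - k₀ z) atTop (𝓝 0) := by
        simpa using hz.sub_const (k₀ z)
      simpa using h1.abs.mul_const (w z)
  rw [Metric.tendstoUniformlyOn_iff]
  intro ε hε
  filter_upwards [hto.eventually (gt_mem_nhds hε)] with m hm x hx
  refine lt_of_le_of_lt ?_ hm
  rw [dist_comm, dist_eq_norm, ← integral_sub (hint x hx _ (hk m) (hK m)) (hint x hx _ hk₀ hK₀)]
  refine norm_integral_le_of_norm_le ((hKw.const_mul 2).mono' (hdm m) (hdiff m))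
    (Eventually.of_forall fun z => ?_)
  rw [← sub_smul, norm_smul, Real.norm_eq_abs]
  exact mul_le_mul_of_nonneg_left (hw x hx z) (abs_nonneg _)

end Potential

/-! ### Regularized kernels: derivatives, bounds uniform in `ε`, and moments over balls. -/

section Kernels

variable {E : Type*} [NormedAddCommGroup E] [InnerProductSpace ℝ E] [FiniteDimensional ℝ E]
  [MeasurableSpace E] [BorelSpace E] {ι : Type*} [Fintype ι]

/-- The regularized power kernel `(|z|² + ε²)^{-p}`. -/
def powerKernel (p ε : ℝ) (z : E) : ℝ := (‖z‖ ^ 2 + ε ^ 2) ^ (-p)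

/-- First derivative in the direction `v` of a radial kernel with gradient
`c (|z|² + ε²)^{-p-1} z`. -/
def gradKernel (c p ε : ℝ) (v z : E) : ℝ := c * (powerKernel (p + 1) ε z * inner ℝ z v)

/-- Second derivative in the directions `v`, `w` of the same kernel. -/
def hessKernel (c p ε : ℝ) (v w z : E) : ℝ :=
  c * (powerKernel (p + 1) ε z * inner ℝ v w -
    2 * (p + 1) * powerKernel (p + 2) ε z * inner ℝ z v * inner ℝ z w)

/-- Laplacian of the same kernel. -/
def lapKernel (c p ε : ℝ) (z : E) : ℝ :=
  c * (finrank ℝ E * powerKernel (p + 1) ε z - 2 * (p + 1) * ‖z‖ ^ 2 * powerKernel (p + 2) ε z)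

lemma sum_hessKernel (b : OrthonormalBasis ι ℝ E) (c p ε : ℝ) (z : E) :
    ∑ i, hessKernel c p ε (b i) (b i) z = lapKernel c p ε z := by
  have h1 : ∑ i, (inner ℝ z (b i) : ℝ) * inner ℝ z (b i) = ‖z‖ ^ 2 := by
    rw [← b.sum_sq_norm_inner_left z]
    refine Finset.sum_congr rfl fun i _ => ?_
    rw [real_inner_comm, Real.norm_eq_abs, sq_abs, sq]
  have h2 : ∀ i, (inner ℝ (b i) (b i) : ℝ) = 1 := fun i => by
    rw [real_inner_self_eq_norm_sq, b.orthonormal.1 i, one_pow]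
  simp only [hessKernel, lapKernel, h2, ← Finset.mul_sum, Finset.sum_sub_distrib, mul_assoc, h1]
  rw [Finset.sum_const, Finset.card_univ, ← finrank_eq_card_basis b.toBasis]
  simp only [nsmul_eq_mul]
  ring

lemma powerKernel_base_pos {ε : ℝ} (hε : 0 < ε) (z : E) : 0 < ‖z‖ ^ 2 + ε ^ 2 := by positivity

lemma hasFDerivAt_norm_sq_add (ε : ℝ) (z : E) :
    HasFDerivAt (fun z : E => ‖z‖ ^ 2 + ε ^ 2) ((2 : ℝ) • innerSL ℝ z) z := by
  have h := (hasStrictFDerivAt_norm_sq z).hasFDerivAt.add_const (ε ^ 2)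
  exact h.congr_fderiv (by ext; simp [two_mul])

lemma hasFDerivAt_powerKernel (p : ℝ) {ε : ℝ} (hε : 0 < ε) (z : E) :
    HasFDerivAt (powerKernel p ε) ((-2 * p * powerKernel (p + 1) ε z) • innerSL ℝ z) z := by
  have h := (hasFDerivAt_norm_sq_add ε z).rpow_const (p := -p)
    (Or.inl (powerKernel_base_pos hε z).ne')
  refine h.congr_fderiv ?_
  rw [smul_smul, powerKernel, show -(p + 1) = -p - 1 by ring]
  congr 1
  ring

lemma contDiff_powerKernel (p : ℝ) {ε : ℝ} (hε : 0 < ε) :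
    ContDiff ℝ 1 (powerKernel p ε : E → ℝ) := by
  refine ContDiff.rpow_const_of_ne ?_ fun z => (powerKernel_base_pos hε z).ne'
  exact (contDiff_norm_sq ℝ).add contDiff_const

lemma hasFDerivAt_gradKernel (c p : ℝ) {ε : ℝ} (hε : 0 < ε) (v z : E) :
    HasFDerivAt (gradKernel c p ε v)
      (c • (powerKernel (p + 1) ε z • innerSL ℝ v +
        (inner ℝ z v : ℝ) • ((-2 * (p + 1) * powerKernel (p + 2) ε z) • innerSL ℝ z))) z := by
  have h1 : HasFDerivAt (fun z : E => (inner ℝ z v : ℝ)) (innerSL ℝ v) z := by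
    have := (innerSL ℝ v).hasFDerivAt (x := z)
    refine this.congr_of_eventuallyEq (Eventually.of_forall fun w => ?_)
    simp [real_inner_comm]
  have h2 := hasFDerivAt_powerKernel (p + 1) hε z
  rw [show p + 1 + 1 = p + 2 by ring] at h2
  exact (h2.mul h1).const_mul c

lemma contDiff_hessKernel (c p : ℝ) {ε : ℝ} (hε : 0 < ε) (v w : E) :
    ContDiff ℝ 1 (hessKernel c p ε v w) := by
  have h1 := contDiff_powerKernel (E := E) (p + 1) hε
  have h2 := contDiff_powerKernel (E := E) (p + 2) hε
  have h3 : ∀ v : E, ContDiff ℝ 1 fun z : E => (inner ℝ z v : ℝ) := fun v =>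
    contDiff_id.inner ℝ contDiff_const
  exact contDiff_const.mul ((h1.mul contDiff_const).sub
    (((contDiff_const.mul h2).mul (h3 v)).mul (h3 w)))

lemma measurable_powerKernel (p ε : ℝ) : Measurable (powerKernel p ε : E → ℝ) := by
  unfold powerKernel
  fun_prop

lemma measurable_gradKernel (c p ε : ℝ) (v : E) : Measurable (gradKernel c p ε v) := by
  have := measurable_powerKernel (E := E) (p + 1) ε
  unfold gradKernel
  fun_prop

lemma measurable_hessKernel (c p ε : ℝ) (v w : E) : Measurable (hessKernel c p ε v w) := by
  have h1 := measurable_powerKernel (E := E) (p + 1) ε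
  have h2 := measurable_powerKernel (E := E) (p + 2) ε
  unfold hessKernel
  fun_prop

lemma measurable_lapKernel (c p ε : ℝ) : Measurable (lapKernel c p ε : E → ℝ) := by
  have h1 := measurable_powerKernel (E := E) (p + 1) ε
  have h2 := measurable_powerKernel (E := E) (p + 2) ε
  unfold lapKernel
  fun_prop

lemma powerKernel_nonneg (p ε : ℝ) (z : E) : 0 ≤ powerKernel p ε z :=
  Real.rpow_nonneg (by positivity) _

lemma powerKernel_zero (p : ℝ) (z : E) : powerKernel p 0 z = ‖z‖ ^ (-(2 * p)) := by
  rw [powerKernel, zero_pow two_ne_zero, add_zero, ← Real.rpow_natCast, ← Real.rpow_mul (norm_nonneg _)]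
  congr 1
  push_cast
  ring

lemma powerKernel_le {p : ℝ} (hp : 0 ≤ p) (ε : ℝ) {z : E} (hz : z ≠ 0) :
    powerKernel p ε z ≤ ‖z‖ ^ (-(2 * p)) := by
  rw [← powerKernel_zero]
  have : 0 < ‖z‖ := norm_pos_iff.2 hz
  exact Real.rpow_le_rpow_of_nonpos (by positivity) (by nlinarith [sq_nonneg ε]) (by linarith)

lemma tendsto_powerKernel (p : ℝ) {s : ℕ → ℝ} (hs : Tendsto s atTop (𝓝 0)) {z : E} (hz : z ≠ 0) :
    Tendsto (fun m => powerKernel p (s m) z) atTop (𝓝 (powerKernel p 0 z)) := by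
  have h0 : 0 < ‖z‖ := norm_pos_iff.2 hz
  have h : ContinuousAt (fun ε : ℝ => (‖z‖ ^ 2 + ε ^ 2) ^ (-p)) 0 := by
    refine ContinuousAt.rpow_const (by fun_prop) (Or.inl (by positivity))
  exact h.tendsto.comp hs

lemma norm_rpow_split {z : E} (hz : z ≠ 0) (a : ℝ) (k : ℕ) :
    ‖z‖ ^ (-(a + k)) * ‖z‖ ^ k = ‖z‖ ^ (-a) := by
  have h0 : 0 < ‖z‖ := norm_pos_iff.2 hz
  rw [← Real.rpow_natCast ‖z‖ k, ← Real.rpow_add h0]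
  congr 1
  ring

lemma abs_gradKernel_le (c : ℝ) {p : ℝ} (hp : 0 ≤ p) (ε : ℝ) {v z : E} (hv : ‖v‖ = 1)
    (hz : z ≠ 0) : |gradKernel c p ε v z| ≤ |c| * ‖z‖ ^ (-(2 * p + 1)) := by
  rw [gradKernel, abs_mul, abs_mul, abs_of_nonneg (powerKernel_nonneg _ _ _)]
  have h1 := abs_real_inner_le_norm z v
  rw [hv, mul_one] at h1
  have h2 := powerKernel_le (p := p + 1) (by linarith) ε hz
  have h3 := norm_rpow_split hz (2 * p + 1) 1
  rw [show 2 * p + 1 + ((1 : ℕ) : ℝ) = 2 * (p + 1) by push_cast; ring, pow_one] at h3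
  rw [← h3]
  gcongr

/-- The bound has the homogeneity of the unregularized Hessian and is independent of `ε`, so it
serves as a dominating function. -/
lemma abs_hessKernel_le (c : ℝ) {p : ℝ} (hp : 0 ≤ p) (ε : ℝ) {v w z : E} (hv : ‖v‖ = 1)
    (hw : ‖w‖ = 1) (hz : z ≠ 0) :
    |hessKernel c p ε v w z| ≤ |c| * (1 + 2 * (p + 1)) * ‖z‖ ^ (-(2 * p + 2)) := by
  have h1 := abs_real_inner_le_norm z v
  have h1' := abs_real_inner_le_norm z w
  have h1'' := abs_real_inner_le_norm v w
  rw [hv, mul_one] at h1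
  rw [hw, mul_one] at h1'
  rw [hv, hw, mul_one] at h1''
  have h2 := powerKernel_le (p := p + 1) (by linarith) ε hz
  have h2' := powerKernel_le (p := p + 2) (by linarith) ε hz
  have h3 := norm_rpow_split hz (2 * p + 2) 2
  rw [show 2 * p + 2 + ((2 : ℕ) : ℝ) = 2 * (p + 2) by push_cast; ring] at h3
  rw [show 2 * (p + 1) = 2 * p + 2 by ring] at h2
  have h4 : |powerKernel (p + 1) ε z * inner ℝ v w| ≤ ‖z‖ ^ (-(2 * p + 2)) * 1 := by
    rw [abs_mul, abs_of_nonneg (powerKernel_nonneg _ _ _)]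
    gcongr
  have h5 : |2 * (p + 1) * powerKernel (p + 2) ε z * inner ℝ z v * inner ℝ z w| ≤
      2 * (p + 1) * ‖z‖ ^ (-(2 * p + 2)) := by
    rw [abs_mul, abs_mul, abs_mul, abs_of_nonneg (powerKernel_nonneg _ _ _),
      abs_of_nonneg (show 0 ≤ 2 * (p + 1) by linarith), ← h3, sq, ← mul_assoc, ← mul_assoc]
    gcongr
  rw [hessKernel, abs_mul, mul_assoc |c|]
  refine mul_le_mul_of_nonneg_left ((abs_sub _ _).trans ?_) (abs_nonneg _)
  linarith

lemma abs_lapKernel_le (c : ℝ) {p : ℝ} (hp : 0 ≤ p) (ε : ℝ) {z : E} (hz : z ≠ 0) :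
    |lapKernel c p ε z| ≤ finrank ℝ E * (|c| * (1 + 2 * (p + 1)) * ‖z‖ ^ (-(2 * p + 2))) := by
  have b := stdOrthonormalBasis ℝ E
  rw [← sum_hessKernel b]
  refine (Finset.abs_sum_le_sum_abs _ _).trans ((Finset.sum_le_card_nsmul _ _ _ fun i _ =>
    abs_hessKernel_le c hp ε (b.orthonormal.1 i) (b.orthonormal.1 i) hz).trans_eq ?_)
  simp

lemma integrableOn_norm_rpow_ball {a : ℝ} (ha : a < finrank ℝ E) (R : ℝ) [Nontrivial E] :
    IntegrableOn (fun z : E => ‖z‖ ^ (-a)) (ball 0 R) := by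
  rw [integrableOn_fun_norm_addHaar volume (f := fun r => r ^ (-a))]
  have hpos : 1 ≤ finrank ℝ E := finrank_pos
  have h1 : IntegrableOn (fun y : ℝ => y ^ ((finrank ℝ E : ℝ) - 1 - a)) (Ioo 0 R) :=
    (intervalIntegral.intervalIntegrable_rpow' (a := 0) (b := R) (by linarith)).1.mono_set
      Ioo_subset_Ioc_self
  refine h1.congr_fun (fun y hy => ?_) measurableSet_Ioo
  simp only [smul_eq_mul]
  rw [← Real.rpow_natCast, ← Real.rpow_add hy.1, Nat.cast_sub hpos]
  simp [sub_eq_add_neg]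

lemma tendsto_gradKernel (c p : ℝ) {s : ℕ → ℝ} (hs : Tendsto s atTop (𝓝 0)) (v : E) {z : E}
    (hz : z ≠ 0) : Tendsto (fun m => gradKernel c p (s m) v z) atTop (𝓝 (gradKernel c p 0 v z)) :=
  ((tendsto_powerKernel (p + 1) hs hz).mul_const _).const_mul _

lemma tendsto_hessKernel (c p : ℝ) {s : ℕ → ℝ} (hs : Tendsto s atTop (𝓝 0)) (v w : E) {z : E}
    (hz : z ≠ 0) :
    Tendsto (fun m => hessKernel c p (s m) v w z) atTop (𝓝 (hessKernel c p 0 v w z)) := by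
  refine (((tendsto_powerKernel (p + 1) hs hz).mul_const _).sub ?_).const_mul _
  exact (((tendsto_powerKernel (p + 2) hs hz).const_mul _).mul_const _).mul_const _

lemma tendsto_lapKernel (c p : ℝ) {s : ℕ → ℝ} (hs : Tendsto s atTop (𝓝 0)) {z : E}
    (hz : z ≠ 0) :
    Tendsto (fun m => lapKernel c p (s m) z) atTop (𝓝 (lapKernel c p 0 z)) := by
  refine (((tendsto_powerKernel (p + 1) hs hz).const_mul _).sub ?_).const_mul _
  exact (tendsto_powerKernel (p + 2) hs hz).const_mul _

lemma setIntegral_ball_inner_sq_eq {v w : E} (h : ‖v‖ = ‖w‖) (R : ℝ → ℝ) (δ : ℝ) :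
    ∫ z in ball (0 : E) δ, R ‖z‖ * (inner ℝ z v) ^ 2 =
      ∫ z in ball (0 : E) δ, R ‖z‖ * (inner ℝ z w) ^ 2 := by
  obtain ⟨A, hA⟩ := exists_isometry_map_inner h
  rw [← A.measurePreserving.setIntegral_preimage_emb A.toMeasurableEquiv.measurableEmbedding]
  have : A ⁻¹' ball (0 : E) δ = ball 0 δ := by
    ext z
    simp
  rw [this]
  congr 1 with z
  rw [A.norm_map, real_inner_comm, hA, real_inner_comm]

/-- Second moments of a radial weight over a ball. -/
lemma setIntegral_ball_inner_mul_inner [DecidableEq ι] (b : OrthonormalBasis ι ℝ E) {R : ℝ → ℝ}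
    (hR : Continuous R) (δ : ℝ) (i j : ι) :
    ∫ z in ball (0 : E) δ, R ‖z‖ * inner ℝ z (b i) * inner ℝ z (b j) =
      if i = j then (∫ z in ball (0 : E) δ, R ‖z‖ * ‖z‖ ^ 2) / finrank ℝ E else 0 := by
  have hint : ∀ g : E → ℝ, Continuous g → IntegrableOn g (ball (0 : E) δ) := fun g hg =>
    (hg.continuousOn.integrableOn_compact (isCompact_closedBall (0 : E) δ)).mono_set
      ball_subset_closedBall
  split_ifs with hij
  · subst hij
    -- By rotation all diagonal moments agree, and their sum is the moment of `‖z‖²`.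
    have h1 : ∀ k, ∫ z in ball (0 : E) δ, R ‖z‖ * inner ℝ z (b i) * inner ℝ z (b i) =
        ∫ z in ball (0 : E) δ, R ‖z‖ * (inner ℝ z (b k)) ^ 2 := by
      intro k
      rw [← setIntegral_ball_inner_sq_eq (v := b i) (w := b k)
        (by rw [b.orthonormal.1, b.orthonormal.1])]
      congr 1 with z
      ring
    have h2 : ∑ k, ∫ z in ball (0 : E) δ, R ‖z‖ * (inner ℝ z (b k)) ^ 2 =
        ∫ z in ball (0 : E) δ, R ‖z‖ * ‖z‖ ^ 2 := by
      rw [← integral_finsetSum _ fun k _ => hint _ (by fun_prop)]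
      congr 1 with z
      rw [← Finset.mul_sum, ← b.sum_sq_norm_inner_left z]
      congr 1
      refine Finset.sum_congr rfl fun k _ => ?_
      rw [real_inner_comm, Real.norm_eq_abs, sq_abs]
    have h3 := Finset.sum_congr rfl fun k (_ : k ∈ Finset.univ) => h1 k
    rw [h2, Finset.sum_const, Finset.card_univ, ← finrank_eq_card_basis b.toBasis,
      nsmul_eq_mul] at h3
    have hn : (finrank ℝ E : ℝ) ≠ 0 := by
      have : 0 < finrank ℝ E := by
        rw [finrank_eq_card_basis b.toBasis]
        exact Fintype.card_pos_iff.2 ⟨i⟩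
      positivity
    rw [← h3, mul_div_cancel_left₀ _ hn]
  -- Off the diagonal, polarization writes the moment as a difference of square moments in the
  -- directions `b i ± b j`, which have equal length.
  · have hn : ‖b i + b j‖ = ‖b i - b j‖ := by
      have h0 := b.orthonormal.2 hij
      refine (sq_eq_sq₀ (norm_nonneg _) (norm_nonneg _)).1 ?_
      rw [norm_add_sq_real, norm_sub_sq_real, h0]
      ring
    have h1 := setIntegral_ball_inner_sq_eq hn R δ
    have h2 : ∀ z : E, R ‖z‖ * inner ℝ z (b i) * inner ℝ z (b j) =
        (R ‖z‖ * (inner ℝ z (b i + b j)) ^ 2 - R ‖z‖ * (inner ℝ z (b i - b j)) ^ 2) / 4 := by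
      intro z
      rw [inner_add_right, inner_sub_right]
      ring
    simp_rw [h2]
    rw [integral_div, integral_sub (hint _ (by fun_prop)) (hint _ (by fun_prop)), h1, sub_self,
      zero_div]

/-- By symmetry the integrated Hessian is a scalar matrix determined by its trace. Its convergence
as `ε → 0` thus reduces to that of the integrated Laplacian. -/
lemma setIntegral_ball_hessKernel [DecidableEq ι] (b : OrthonormalBasis ι ℝ E) (c p : ℝ) {ε : ℝ}
    (hε : 0 < ε) (δ : ℝ) (i j : ι) :
    ∫ z in ball (0 : E) δ, hessKernel c p ε (b i) (b j) z =
      if i = j then (∫ z in ball (0 : E) δ, lapKernel c p ε z) / finrank ℝ E else 0 := by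
  have hint : ∀ g : E → ℝ, Continuous g → IntegrableOn g (ball (0 : E) δ) := fun g hg =>
    (hg.continuousOn.integrableOn_compact (isCompact_closedBall (0 : E) δ)).mono_set
      ball_subset_closedBall
  have hc : ∀ p : ℝ, Continuous fun r : ℝ => (r ^ 2 + ε ^ 2) ^ (-p) := by
    intro p
    refine Continuous.rpow_const (by fun_prop) fun r => Or.inl ?_
    positivity
  have hq : ∀ p : ℝ, Continuous (powerKernel p ε : E → ℝ) := fun p =>
    (hc p).comp continuous_norm
  have h1 := setIntegral_ball_inner_mul_inner b (hc (p + 2)) δ i j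
  have e1 : ∫ z in ball (0 : E) δ, hessKernel c p ε (b i) (b j) z =
      c * (((∫ z in ball (0 : E) δ, powerKernel (p + 1) ε z) * inner ℝ (b i) (b j)) -
        2 * (p + 1) * ∫ z in ball (0 : E) δ, (‖z‖ ^ 2 + ε ^ 2) ^ (-(p + 2)) *
          inner ℝ z (b i) * inner ℝ z (b j)) := by
    have hq1 := hq (p + 1)
    have hq2 := hq (p + 2)
    rw [← integral_mul_const, ← integral_const_mul, ← integral_sub (hint _ (by fun_prop))
      (hint _ ?_), ← integral_const_mul]
    · congr 1 with z
      rw [hessKernel]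
      unfold powerKernel
      ring
    · have : Continuous fun z : E => 2 * (p + 1) * (powerKernel (p + 2) ε z *
          inner ℝ z (b i) * inner ℝ z (b j)) := by fun_prop
      exact this
  have e2 : ∫ z in ball (0 : E) δ, lapKernel c p ε z =
      c * (finrank ℝ E * (∫ z in ball (0 : E) δ, powerKernel (p + 1) ε z) -
        2 * (p + 1) * ∫ z in ball (0 : E) δ, (‖z‖ ^ 2 + ε ^ 2) ^ (-(p + 2)) * ‖z‖ ^ 2) := by
    have hq1 := hq (p + 1)
    have hq2 := hq (p + 2)
    rw [← integral_const_mul, ← integral_const_mul, ← integral_sub (hint _ (by fun_prop))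
      (hint _ ?_), ← integral_const_mul]
    · congr 1 with z
      rw [lapKernel]
      unfold powerKernel
      ring
    · have : Continuous fun z : E => 2 * (p + 1) * (powerKernel (p + 2) ε z * ‖z‖ ^ 2) := by
        fun_prop
      exact this
  rw [e1, e2, h1]
  split_ifs with hij
  · subst hij
    have hn : (finrank ℝ E : ℝ) ≠ 0 := by
      have : 0 < finrank ℝ E := by
        rw [finrank_eq_card_basis b.toBasis]
        exact Fintype.card_pos_iff.2 ⟨i⟩
      positivity
    rw [real_inner_self_eq_norm_sq, b.orthonormal.1]
    field_simp
  · rw [b.orthonormal.2 hij]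
    ring

end Kernels

/-! ### `C²` regularity of potentials of Hölder densities. -/

section PotentialRegularity

variable {E : Type*} [NormedAddCommGroup E] [InnerProductSpace ℝ E] [FiniteDimensional ℝ E]
  [MeasurableSpace E] [BorelSpace E] {F : Type*} [NormedAddCommGroup F] [NormedSpace ℝ F]
  [CompleteSpace F] {ψ : E → F}

/-- A vanishing sequence of regularization parameters. -/
def regSeq (m : ℕ) : ℝ := 1 / ((m : ℝ) + 1)

lemma regSeq_pos (m : ℕ) : 0 < regSeq m := by unfold regSeq; positivity

lemma regSeq_le_one (m : ℕ) : regSeq m ≤ 1 := by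
  unfold regSeq
  rw [div_le_one (by positivity)]
  linarith [(Nat.cast_nonneg m : (0 : ℝ) ≤ m)]

lemma tendsto_regSeq : Tendsto regSeq atTop (𝓝 0) := tendsto_one_div_add_atTop_nhds_zero_nat

/-- Radial kernels `g 0` approximated by smooth kernels `g ε` with gradient
`c (|z|² + ε²)^{-p-1} z`. -/
structure IsRegularization (g : ℝ → E → ℝ) (c p : ℝ) : Prop where
  deriv : ∀ ε, 0 < ε → ∀ z, HasFDerivAt (g ε) ((c * powerKernel (p + 1) ε z) • innerSL ℝ z) z
  lim : ∀ z, z ≠ 0 → Tendsto (fun m => g (regSeq m) z) atTop (𝓝 (g 0 z))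
  dom : ∃ K : E → ℝ, IntegrableOn K (ball 0 2) ∧
    ∀ m, ∀ z ∈ ball (0 : E) 2, z ≠ 0 → |g (regSeq m) z| ≤ K z

lemma IsBallDensity.norm_sub_le_indicator (hψ : IsBallDensity ψ) {M : ℝ} (hM : ∀ z, ‖ψ z‖ ≤ M)
    {x : E} (hx : ‖x‖ < 1) (z : E) :
    ‖ψ (x - z)‖ ≤ (ball (0 : E) 2).indicator (fun _ => M) z := by
  by_cases hz : z ∈ ball (0 : E) 2
  · rw [indicator_of_mem hz]
    exact hM _
  · rw [indicator_of_notMem hz, sub_eq_add_neg, hψ.zero_of_two_le hx (by simpa using hz), norm_zero]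

/-- The difference `ψ (x - z) - ψ x` near the singularity, and `ψ (x - z)` away from it. -/
def localDifference (ψ : E → F) (δ : ℝ) (x z : E) : F :=
  ψ (x - z) - (ball (0 : E) δ).indicator (fun _ => ψ x) z

lemma stronglyMeasurable_localDifference (hψ : IsBallDensity ψ) (δ : ℝ) (x : E) :
    StronglyMeasurable (localDifference ψ δ x) :=
  (hψ.meas.comp_measurable (by fun_prop)).sub
    (stronglyMeasurable_const.indicator measurableSet_ball)

lemma norm_localDifference_le (hψ : IsBallDensity ψ) {A lam : ℝ} (hlam : 0 < lam) (hA : 0 < A)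
    (hH : ∀ x ∈ ball (0 : E) 1, ∀ y ∈ ball (0 : E) 1, ‖ψ x - ψ y‖ ≤ A * ‖x - y‖ ^ lam)
    {δ : ℝ} (hδ : 0 < δ) (hδ1 : δ ≤ 1) : ∃ C, ∀ x ∈ ball (0 : E) (1 - δ), ∀ z,
      ‖localDifference ψ δ x z‖ ≤ (ball (0 : E) 2).indicator (fun z => C * ‖z‖ ^ lam) z := by
  obtain ⟨M, hM⟩ := hψ.bound
  have hM0 : 0 ≤ M := (norm_nonneg _).trans (hM 0)
  -- The Hölder constant serves for `|z| < δ`; for `|z| ≥ δ` the bound `M` is at most `M / δ ^ lam *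
  -- ‖z‖ ^ lam`.
  refine ⟨A + M / δ ^ lam, fun x hx z => ?_⟩
  have hxn : ‖x‖ < 1 - δ := by simpa using hx
  have hx1 : ‖x‖ < 1 := by linarith
  have hpow : 0 < δ ^ lam := Real.rpow_pos_of_pos hδ _
  have hpz : 0 ≤ ‖z‖ ^ lam := Real.rpow_nonneg (norm_nonneg _) _
  by_cases hz : z ∈ ball (0 : E) δ
  · have hzn : ‖z‖ < δ := by simpa using hz
    rw [localDifference, indicator_of_mem hz,
      indicator_of_mem (show z ∈ ball (0 : E) 2 by simpa using hzn.trans (by linarith))]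
    have h1 : x - z ∈ ball (0 : E) 1 := by
      rw [mem_ball_zero_iff]
      exact (norm_sub_le _ _).trans_lt (by linarith)
    refine (hH _ h1 _ (by simpa using hx1)).trans ?_
    rw [sub_sub_cancel_left, norm_neg]
    gcongr
    exact le_add_of_nonneg_right (by positivity)
  · have hzn : δ ≤ ‖z‖ := by simpa using hz
    rw [localDifference, indicator_of_notMem hz, sub_zero]
    refine (hψ.norm_sub_le_indicator hM hx1 z).trans ?_
    refine indicator_le_indicator ?_
    have h1 : δ ^ lam ≤ ‖z‖ ^ lam := Real.rpow_le_rpow hδ.le hzn hlam.le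
    calc M = M / δ ^ lam * δ ^ lam := by field_simp
      _ ≤ M / δ ^ lam * ‖z‖ ^ lam := by gcongr
      _ ≤ (A + M / δ ^ lam) * ‖z‖ ^ lam := by
        gcongr
        linarith

/-- For regularized kernels this is mere addition and subtraction, but each of the two terms can
converge as `ε → 0` where the naive integrand has no integrable majorant. -/
lemma potential_eq_localDifference (hψ : IsBallDensity ψ) {k : E → ℝ} (hk : Continuous k)
    (δ : ℝ) (x : E) :
    potential k ψ x =
      (∫ z, k z • localDifference ψ δ x z) + (∫ z in ball (0 : E) δ, k z) • ψ x := by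
  have h1 : Integrable fun z => k z • ψ (x - z) := by
    have h := (hψ.integrable_potential hk x).comp_sub_left x
    simp only [sub_sub_cancel] at h
    refine h.mono' ?_ (Eventually.of_forall fun z => by rw [norm_smul])
    exact (hk.stronglyMeasurable.smul
      (hψ.meas.comp_measurable (by fun_prop))).aestronglyMeasurable
  have h2 : IntegrableOn (fun z => k z • ψ x) (ball (0 : E) δ) :=
    ((hk.continuousOn.integrableOn_compact (isCompact_closedBall (0 : E) δ)).mono_set
      ball_subset_closedBall).smul_const _
  have h3 : ∀ z, k z • localDifference ψ δ x z =
      k z • ψ (x - z) - (ball (0 : E) δ).indicator (fun z => k z • ψ x) z := by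
    intro z
    rw [localDifference, smul_sub]
    by_cases hz : z ∈ ball (0 : E) δ
    · rw [indicator_of_mem hz, indicator_of_mem hz]
    · rw [indicator_of_notMem hz, indicator_of_notMem hz, smul_zero]
  simp_rw [h3]
  rw [integral_sub h1 ((integrable_indicator_iff measurableSet_ball).2 h2),
    integral_indicator measurableSet_ball, integral_smul_const, potential_eq, sub_add_cancel]

/-- The weight lowers the singularity by `lam`, so exponent `a` equal to the dimension is admitted
once `lam > 0`. -/
lemma integrable_rpow_mul_weight [Nontrivial E] {a lam : ℝ} (ha : a - lam < finrank ℝ E)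
    (C C' : ℝ) :
    Integrable fun z : E => C * ‖z‖ ^ (-a) *
      (ball (0 : E) 2).indicator (fun z => C' * ‖z‖ ^ lam) z := by
  have h := ((integrableOn_norm_rpow_ball ha 2).const_mul (C * C'))
  refine ((integrable_indicator_iff measurableSet_ball).2 h).congr ?_
  filter_upwards [Measure.ae_ne volume (0 : E)] with z hz
  have hz0 : 0 < ‖z‖ := norm_pos_iff.2 hz
  by_cases h2 : z ∈ ball (0 : E) 2
  · rw [indicator_of_mem h2, indicator_of_mem h2,
      show -(a - lam) = -a + lam by ring, Real.rpow_add hz0]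
    ring
  · rw [indicator_of_notMem h2, indicator_of_notMem h2, mul_zero]

lemma tendstoUniformlyOn_gradPotential (hψ : IsBallDensity ψ) [Nontrivial E] (c : ℝ) {p : ℝ}
    (hp : 0 ≤ p) (hpn : 2 * p + 2 ≤ finrank ℝ E) {v : E} (hv : ‖v‖ = 1) :
    TendstoUniformlyOn (fun m x => potential (gradKernel c p (regSeq m) v) ψ x)
      (fun x => potential (gradKernel c p 0 v) ψ x) atTop (ball 0 1) := by
  obtain ⟨M, hM⟩ := hψ.bound
  simp_rw [potential_eq]
  -- Gradient kernels have exponent `2p + 1`, below the dimension, so boundedness of `ψ` is enough;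
  -- hence the weight exponent 0.
  refine tendstoUniformlyOn_integral_smul (K := fun z => |c| * ‖z‖ ^ (-(2 * p + 1)))
    (w := (ball (0 : E) 2).indicator fun z => M * ‖z‖ ^ (0 : ℝ))
    (fun m => measurable_gradKernel _ _ _ _) (measurable_gradKernel _ _ _ _)
    (fun x _ => hψ.meas.comp_measurable (by fun_prop)) (fun x hx z => ?_) ?_ (fun m => ?_)
    (integrable_rpow_mul_weight (by linarith) _ _) ?_
  · simpa using hψ.norm_sub_le_indicator hM (by simpa using hx) z
  · refine Measurable.aestronglyMeasurable ?_
    exact Measurable.indicator (by fun_prop) measurableSet_ball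
  · filter_upwards [Measure.ae_ne volume (0 : E)] with z hz
    exact abs_gradKernel_le c hp _ hv hz
  · filter_upwards [Measure.ae_ne volume (0 : E)] with z hz
    exact tendsto_gradKernel c p tendsto_regSeq v hz

lemma tendstoUniformlyOn_localDifference (hψ : IsBallDensity ψ) [Nontrivial E] {A lam : ℝ}
    (hlam : 0 < lam) (hA : 0 < A)
    (hH : ∀ x ∈ ball (0 : E) 1, ∀ y ∈ ball (0 : E) 1, ‖ψ x - ψ y‖ ≤ A * ‖x - y‖ ^ lam)
    {p : ℝ} (hpn : 2 * p + 2 ≤ finrank ℝ E) {δ : ℝ} (hδ : 0 < δ) (hδ1 : δ ≤ 1)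
    {k : ℕ → E → ℝ} {k₀ : E → ℝ} (hk : ∀ m, Measurable (k m)) (hk₀ : Measurable k₀) {C : ℝ}
    (hK : ∀ m, ∀ z, z ≠ 0 → |k m z| ≤ C * ‖z‖ ^ (-(2 * p + 2)))
    (hlim : ∀ z, z ≠ 0 → Tendsto (fun m => k m z) atTop (𝓝 (k₀ z))) :
    TendstoUniformlyOn (fun m x => ∫ z, k m z • localDifference ψ δ x z)
      (fun x => ∫ z, k₀ z • localDifference ψ δ x z) atTop (ball 0 (1 - δ)) := by
  obtain ⟨C', hC'⟩ := norm_localDifference_le hψ hlam hA hH hδ hδ1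
  refine tendstoUniformlyOn_integral_smul (K := fun z => C * ‖z‖ ^ (-(2 * p + 2)))
    (w := (ball (0 : E) 2).indicator fun z => C' * ‖z‖ ^ lam) hk hk₀
    (fun x _ => stronglyMeasurable_localDifference hψ δ x) hC' ?_ (fun m => ?_)
    (integrable_rpow_mul_weight (by linarith) _ _) ?_
  · refine Measurable.aestronglyMeasurable ?_
    exact Measurable.indicator (by fun_prop) measurableSet_ball
  · filter_upwards [Measure.ae_ne volume (0 : E)] with z hz
    exact hK m z hz
  · filter_upwards [Measure.ae_ne volume (0 : E)] with z hz
    exact hlim z hz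

/-- Potentials of Hölder densities are of class `C²`, and their Laplacians are limits of the
Laplacians of the regularized potentials. -/
theorem contDiffOn_potential (hψ : IsBallDensity ψ) [Nontrivial E] {A lam : ℝ}
    (hlam : 0 < lam) (hA : 0 < A)
    (hH : ∀ x ∈ ball (0 : E) 1, ∀ y ∈ ball (0 : E) 1, ‖ψ x - ψ y‖ ≤ A * ‖x - y‖ ^ lam)
    {g : ℝ → E → ℝ} {c p : ℝ} (hg : IsRegularization g c p) (hp : 0 ≤ p)
    (hpn : 2 * p + 2 ≤ finrank ℝ E)
    (hκ : ∀ δ : ℝ, 0 < δ → ∃ κ : ℝ,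
      Tendsto (fun m => ∫ z in ball (0 : E) δ, lapKernel c p (regSeq m) z) atTop (𝓝 κ)) :
    ContDiffOn ℝ 2 (potential (g 0) ψ) (ball 0 1) ∧ ∀ x ∈ ball (0 : E) 1,
      Tendsto (fun m => potential (lapKernel c p (regSeq m)) ψ x) atTop
        (𝓝 (Laplacian.laplacian (potential (g 0) ψ) x)) := by
  classical
  set b := stdOrthonormalBasis ℝ E
  obtain ⟨M, hM⟩ := hψ.bound
  have hM0 : 0 ≤ M := (norm_nonneg _).trans (hM 0)
  -- Shrinking to radius `1 - δ` keeps `x - z` in the unit ball for `|z| < δ`, where the Hölder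
  -- estimate is available.
  have key : ∀ δ : ℝ, 0 < δ → δ ≤ 1 →
      ContDiffOn ℝ 2 (potential (g 0) ψ) (ball 0 (1 - δ)) ∧ ∀ x ∈ ball (0 : E) (1 - δ),
      Tendsto (fun m => potential (lapKernel c p (regSeq m)) ψ x) atTop
        (𝓝 (Laplacian.laplacian (potential (g 0) ψ) x)) := by
    intro δ hδ hδ1
    obtain ⟨κ, hκ⟩ := hκ δ hδ
    have hsub : ball (0 : E) (1 - δ) ⊆ ball 0 1 := ball_subset_ball (by linarith)
    -- The limiting second partials: an absolutely convergent singular integral plus a local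
    -- multiple of `ψ x`, present only on the diagonal.
    set u₂ : Fin (finrank ℝ E) → Fin (finrank ℝ E) → E → F := fun i j x =>
      (∫ z, hessKernel c p 0 (b i) (b j) z • localDifference ψ δ x z) +
        (if i = j then κ / finrank ℝ E else 0) • ψ x with hu₂
    have ht2 : ∀ i j, TendstoUniformlyOn
        (fun m x => potential (hessKernel c p (regSeq m) (b i) (b j)) ψ x) (u₂ i j) atTop
        (ball 0 (1 - δ)) := by
      intro i j
      have h1 := tendstoUniformlyOn_localDifference hψ hlam hA hH hpn hδ hδ1
        (fun m => measurable_hessKernel c p (regSeq m) (b i) (b j))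
        (measurable_hessKernel c p 0 (b i) (b j))
        (fun m z hz => abs_hessKernel_le c hp _ (b.orthonormal.1 i) (b.orthonormal.1 j) hz)
        (fun z hz => tendsto_hessKernel c p tendsto_regSeq (b i) (b j) hz)
      have h2 : Tendsto (fun m => ∫ z in ball (0 : E) δ,
          hessKernel c p (regSeq m) (b i) (b j) z) atTop
          (𝓝 (if i = j then κ / finrank ℝ E else 0)) := by
        simp_rw [setIntegral_ball_hessKernel b c p (regSeq_pos _) δ i j]
        split_ifs
        · exact hκ.div_const _
        · exact tendsto_const_nhds
      have h3 : TendstoUniformlyOn (fun m x => (∫ z in ball (0 : E) δ,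
          hessKernel c p (regSeq m) (b i) (b j) z) • ψ x)
          (fun x => (if i = j then κ / finrank ℝ E else 0 : ℝ) • ψ x) atTop (ball 0 (1 - δ)) := by
        rw [Metric.tendstoUniformlyOn_iff]
        intro ε hε
        -- `M + 1` rather than `M`, since the bound `M` may be zero.
        have h4 := Metric.tendsto_nhds.1 h2 (ε / (M + 1)) (by positivity)
        filter_upwards [h4] with m hm x _
        rw [dist_comm, dist_eq_norm, ← sub_smul, norm_smul]
        rw [dist_eq_norm] at hm
        calc _ ≤ ‖(∫ z in ball (0 : E) δ, hessKernel c p (regSeq m) (b i) (b j) z) -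
              (if i = j then κ / finrank ℝ E else 0)‖ * (M + 1) := by
                gcongr
                exact (hM x).trans (by linarith)
          _ < ε / (M + 1) * (M + 1) := by gcongr
          _ = ε := by field_simp
      refine (h1.add h3).congr (Eventually.of_forall fun m x _ => ?_)
      exact (potential_eq_localDifference hψ
        (contDiff_hessKernel c p (regSeq_pos m) (b i) (b j)).continuous δ x).symm
    have ht0 : ∀ x ∈ ball (0 : E) (1 - δ),
        Tendsto (fun m => potential (g (regSeq m)) ψ x) atTop (𝓝 (potential (g 0) ψ x)) := by
      intro x hx
      have hx1 : ‖x‖ < 1 := by simpa using hsub hx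
      obtain ⟨K, hK, hgK⟩ := hg.dom
      simp_rw [potential_eq]
      refine tendsto_integral_of_dominated_convergence
        ((ball (0 : E) 2).indicator fun z => K z * M) (fun m => ?_)
        ((integrable_indicator_iff measurableSet_ball).2 (hK.mul_const M)) (fun m => ?_) ?_
      · have hgc : Continuous (g (regSeq m)) := continuous_iff_continuousAt.2 fun z =>
          (hg.deriv _ (regSeq_pos m) z).continuousAt
        exact (hgc.stronglyMeasurable.smul
          (hψ.meas.comp_measurable (by fun_prop))).aestronglyMeasurable
      · filter_upwards [Measure.ae_ne volume (0 : E)] with z hz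
        by_cases hz2 : z ∈ ball (0 : E) 2
        · rw [indicator_of_mem hz2, norm_smul]
          exact mul_le_mul (hgK m z hz2 hz) (hM _) (norm_nonneg _)
            ((abs_nonneg _).trans (hgK m z hz2 hz))
        · have h1 := hψ.norm_sub_le_indicator hM hx1 z
          rw [indicator_of_notMem hz2] at h1 ⊢
          rw [norm_smul, le_antisymm h1 (norm_nonneg _), mul_zero]
      · filter_upwards [Measure.ae_ne volume (0 : E)] with z hz
        exact (hg.lim z hz).smul_const _
    have hq : ∀ m q, Continuous (powerKernel q (regSeq m) : E → ℝ) := fun m q =>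
      (contDiff_powerKernel q (regSeq_pos m)).continuous
    have main := contDiffOn_two_of_tendsto b isOpen_ball (U := ball (0 : E) (1 - δ))
      (u := potential (g 0) ψ) (u₁ := fun i => potential (gradKernel c p 0 (b i)) ψ) (u₂ := u₂)
      (v := fun m => potential (g (regSeq m)) ψ)
      (v₁ := fun m i => potential (gradKernel c p (regSeq m) (b i)) ψ)
      (v₂ := fun m i j => potential (hessKernel c p (regSeq m) (b i) (b j)) ψ)
      (fun m x => ?_) (fun m i x => ?_) (fun m i j => ?_) ht0 (fun i => ?_) ht2
    · refine ⟨main.1, fun x hx => ?_⟩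
      rw [main.2 x hx]
      have h1 := tendsto_finsetSum Finset.univ fun i _ => (ht2 i i).tendsto_at hx
      refine h1.congr fun m => ?_
      simp_rw [potential_eq]
      rw [← integral_finsetSum]
      · congr 1 with z
        rw [← Finset.sum_smul, sum_hessKernel]
      · intro i _
        have h := (hψ.integrable_potential (contDiff_hessKernel c p (regSeq_pos m) (b i)
          (b i)).continuous x).comp_sub_left x
        simp only [sub_sub_cancel] at h
        refine h.mono' ?_ (Eventually.of_forall fun z => by rw [norm_smul])
        exact ((measurable_hessKernel c p _ _ _).stronglyMeasurable.smul
          (hψ.meas.comp_measurable (by fun_prop))).aestronglyMeasurable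
    · have h := hasFDerivAt_potential hψ b (hg.deriv _ (regSeq_pos m)) (by
        have := hq m (p + 1)
        fun_prop) x
      convert h using 5 with i
      simp [gradKernel, mul_assoc]
    · have h := hasFDerivAt_potential hψ b (hasFDerivAt_gradKernel c p (regSeq_pos m) (b i)) (by
        have := hq m (p + 1)
        have := hq m (p + 2)
        fun_prop) x
      convert h using 5 with j
      simp [hessKernel]
      ring
    · exact continuous_potential hψ (contDiff_hessKernel c p (regSeq_pos m) (b i) (b j))
    · exact (tendstoUniformlyOn_gradPotential hψ c hp hpn (b.orthonormal.1 i)).mono hsub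
  have hδx : ∀ x ∈ ball (0 : E) 1, ∃ δ : ℝ, 0 < δ ∧ δ ≤ 1 ∧ x ∈ ball (0 : E) (1 - δ) := by
    intro x hx
    have hx1 : ‖x‖ < 1 := by simpa using hx
    refine ⟨(1 - ‖x‖) / 2, by linarith, by linarith [norm_nonneg x], ?_⟩
    rw [mem_ball_zero_iff]
    linarith
  constructor
  · intro x hx
    obtain ⟨δ, h0, h1, hxδ⟩ := hδx x hx
    exact ((key δ h0 h1).1.contDiffAt (isOpen_ball.mem_nhds hxδ)).contDiffWithinAt
  · intro x hx
    obtain ⟨δ, h0, h1, hxδ⟩ := hδx x hx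
    exact (key δ h0 h1).2 x hxδ

end PotentialRegularity

/-! ### Laplacians of power and logarithmic potentials; the Poisson equation. -/

section Laplacians

variable {E : Type*} [NormedAddCommGroup E] [InnerProductSpace ℝ E] [FiniteDimensional ℝ E]
  [MeasurableSpace E] [BorelSpace E] {F : Type*} [NormedAddCommGroup F] [NormedSpace ℝ F]
  [CompleteSpace F] {ψ : E → F}

lemma isRegularization_powerKernel [Nontrivial E] {p : ℝ} (hp : 0 ≤ p)
    (hpn : 2 * p + 2 ≤ finrank ℝ E) :
    IsRegularization (powerKernel p : ℝ → E → ℝ) (-2 * p) p where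
  deriv ε hε z := hasFDerivAt_powerKernel p hε z
  lim z hz := tendsto_powerKernel p tendsto_regSeq hz
  dom := by
    refine ⟨fun z => ‖z‖ ^ (-(2 * p)), integrableOn_norm_rpow_ball (by linarith) 2,
      fun m z _ hz => ?_⟩
    rw [abs_of_nonneg (powerKernel_nonneg _ _ _)]
    exact powerKernel_le hp _ hz

/-- The regularized logarithmic kernel `½ log (|z|² + ε²)`. -/
def logKernel (ε : ℝ) (z : E) : ℝ := 1 / 2 * Real.log (‖z‖ ^ 2 + ε ^ 2)

lemma logKernel_zero (z : E) : logKernel 0 z = Real.log ‖z‖ := by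
  rw [logKernel, zero_pow two_ne_zero, add_zero, Real.log_pow]
  push_cast
  ring

lemma integrableOn_log_norm_ball [Nontrivial E] (R : ℝ) :
    IntegrableOn (fun z : E => Real.log ‖z‖) (ball 0 R) := by
  rw [integrableOn_fun_norm_addHaar volume]
  have h1 : IntegrableOn (fun y : ℝ => y ^ (finrank ℝ E - 1)) (Icc 0 R) :=
    (continuous_pow _).integrableOn_Icc
  refine Integrable.bdd_mul (c := |R| ^ (finrank ℝ E - 1)) (integrableOn_log_Ioo 0 R)
    (by fun_prop) ?_
  filter_upwards [ae_restrict_mem measurableSet_Ioo] with y hy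
  have h2 : |y| ≤ |R| := by
    rw [abs_of_pos hy.1]
    exact hy.2.le.trans (le_abs_self R)
  rw [norm_pow, Real.norm_eq_abs]
  exact pow_le_pow_left₀ (abs_nonneg _) h2 _

lemma isRegularization_logKernel [Nontrivial E] :
    IsRegularization (logKernel : ℝ → E → ℝ) 1 0 where
  deriv ε hε z := by
    have h := ((hasFDerivAt_norm_sq_add ε z).log (powerKernel_base_pos hε z).ne').const_mul
      (1 / 2 : ℝ)
    refine h.congr_fderiv ?_
    rw [smul_smul, smul_smul, powerKernel, zero_add, Real.rpow_neg_one]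
    congr 1
    ring
  lim z hz := by
    have h0 : 0 < ‖z‖ := norm_pos_iff.2 hz
    have h : ContinuousAt (fun ε : ℝ => 1 / 2 * Real.log (‖z‖ ^ 2 + ε ^ 2)) 0 := by
      refine ContinuousAt.mul continuousAt_const (ContinuousAt.log (by fun_prop) (by positivity))
    exact h.tendsto.comp tendsto_regSeq
  dom := by
    -- On the ball of radius 2 with `ε ≤ 1`, `|z|² + ε² < 5`.
    refine ⟨fun z => ‖Real.log ‖z‖‖ + Real.log 5, (integrableOn_log_norm_ball 2).norm.add
      (integrableOn_const measure_ball_lt_top.ne), fun m z hz2 hz => ?_⟩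
    have h0 : 0 < ‖z‖ := norm_pos_iff.2 hz
    have h2 : ‖z‖ < 2 := by simpa using hz2
    have h3 := regSeq_pos m
    have h4 := regSeq_le_one m
    have h5 : 0 ≤ Real.log 5 := Real.log_nonneg (by norm_num)
    have hlow : Real.log ‖z‖ ≤ logKernel (regSeq m) z := by
      rw [← logKernel_zero, logKernel, logKernel]
      gcongr
    have hup : logKernel (regSeq m) z ≤ Real.log 5 := by
      have : Real.log (‖z‖ ^ 2 + regSeq m ^ 2) ≤ Real.log 5 :=
        Real.log_le_log (by positivity) (by nlinarith)
      rw [logKernel]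
      linarith
    change |logKernel (regSeq m) z| ≤ |Real.log ‖z‖| + Real.log 5
    rw [abs_le]
    constructor
    · linarith [neg_abs_le (Real.log ‖z‖)]
    · linarith [abs_nonneg (Real.log ‖z‖)]

lemma norm_sq_mul_powerKernel (p : ℝ) (ε : ℝ) {z : E} (hz : z ≠ 0) :
    (‖z‖ ^ 2 + ε ^ 2) * powerKernel (p + 2) ε z = powerKernel (p + 1) ε z := by
  have h0 : 0 < ‖z‖ := norm_pos_iff.2 hz
  have h1 : 0 < ‖z‖ ^ 2 + ε ^ 2 := by positivity
  rw [powerKernel, powerKernel, show -(p + 1) = 1 + -(p + 2) by ring, Real.rpow_add h1,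
    Real.rpow_one]

lemma lapKernel_zero (c p : ℝ) {z : E} (hz : z ≠ 0) :
    lapKernel c p 0 z = c * (finrank ℝ E - 2 * p - 2) * powerKernel (p + 1) 0 z := by
  have h := norm_sq_mul_powerKernel p 0 hz
  rw [zero_pow two_ne_zero, add_zero] at h
  rw [lapKernel, mul_assoc (2 * (p + 1)), h]
  ring

/-- At the Newtonian exponent the `|z|²` terms cancel. What survives is an approximate identity,
vanishing off the origin when `ε = 0`. -/
lemma lapKernel_newton {c p : ℝ} (hpn : 2 * p + 2 = finrank ℝ E) (ε : ℝ) {z : E} (hz : z ≠ 0) :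
    lapKernel c p ε z = c * finrank ℝ E * (ε ^ 2 * powerKernel (p + 2) ε z) := by
  have h := norm_sq_mul_powerKernel p ε hz
  rw [lapKernel, ← h, ← hpn]
  ring

/-- The Laplacian of a potential whose kernel is less singular than the Newtonian one. -/
theorem laplacian_potential_of_lt (hψ : IsBallDensity ψ) [Nontrivial E] {A lam : ℝ}
    (hlam : 0 < lam) (hA : 0 < A)
    (hH : ∀ x ∈ ball (0 : E) 1, ∀ y ∈ ball (0 : E) 1, ‖ψ x - ψ y‖ ≤ A * ‖x - y‖ ^ lam)
    {g : ℝ → E → ℝ} {c p : ℝ} (hg : IsRegularization g c p) (hp : 0 ≤ p)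
    (hpn : 2 * p + 2 < finrank ℝ E) :
    ContDiffOn ℝ 2 (potential (g 0) ψ) (ball 0 1) ∧ ∀ x ∈ ball (0 : E) 1,
      Laplacian.laplacian (potential (g 0) ψ) x =
        (c * (finrank ℝ E - 2 * p - 2)) • potential (powerKernel (p + 1) 0) ψ x := by
  obtain ⟨M, hM⟩ := hψ.bound
  have hκ : ∀ δ : ℝ, 0 < δ → ∃ κ : ℝ,
      Tendsto (fun m => ∫ z in ball (0 : E) δ, lapKernel c p (regSeq m) z) atTop (𝓝 κ) := by
    intro δ _
    refine ⟨_, tendsto_integral_of_dominated_convergence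
      (fun z => finrank ℝ E * (|c| * (1 + 2 * (p + 1)) * ‖z‖ ^ (-(2 * p + 2))))
      (f := lapKernel c p 0)
      (fun m => (measurable_lapKernel c p _).aestronglyMeasurable)
      (((integrableOn_norm_rpow_ball hpn δ).const_mul _).const_mul _) (fun m => ?_) ?_⟩
    · filter_upwards [ae_restrict_of_ae (Measure.ae_ne volume (0 : E))] with z hz
      exact abs_lapKernel_le c hp _ hz
    · filter_upwards [ae_restrict_of_ae (Measure.ae_ne volume (0 : E))] with z hz
      exact tendsto_lapKernel c p tendsto_regSeq hz
  obtain ⟨h1, h2⟩ := contDiffOn_potential hψ hlam hA hH hg hp hpn.le hκ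
  refine ⟨h1, fun x hx => tendsto_nhds_unique (h2 x hx) ?_⟩
  have h3 : TendstoUniformlyOn (fun m x => ∫ z, lapKernel c p (regSeq m) z • ψ (x - z))
      (fun x => ∫ z, lapKernel c p 0 z • ψ (x - z)) atTop (ball 0 1) := by
    refine tendstoUniformlyOn_integral_smul
      (K := fun z => finrank ℝ E * (|c| * (1 + 2 * (p + 1))) * ‖z‖ ^ (-(2 * p + 2)))
      (w := (ball (0 : E) 2).indicator fun z => M * ‖z‖ ^ (0 : ℝ))
      (fun m => measurable_lapKernel _ _ _) (measurable_lapKernel _ _ _)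
      (fun x _ => hψ.meas.comp_measurable (by fun_prop)) (fun x hx z => ?_) ?_ (fun m => ?_)
      (integrable_rpow_mul_weight (by linarith) _ _) ?_
    · simpa using hψ.norm_sub_le_indicator hM (by simpa using hx) z
    · refine Measurable.aestronglyMeasurable ?_
      exact Measurable.indicator (by fun_prop) measurableSet_ball
    · filter_upwards [Measure.ae_ne volume (0 : E)] with z hz
      rw [mul_assoc]
      exact abs_lapKernel_le c hp _ hz
    · filter_upwards [Measure.ae_ne volume (0 : E)] with z hz
      exact tendsto_lapKernel c p tendsto_regSeq hz
  have h4 := h3.tendsto_at hx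
  simp_rw [potential_eq]
  convert h4 using 2
  rw [← integral_smul]
  refine integral_congr_ae ?_
  filter_upwards [Measure.ae_ne volume (0 : E)] with z hz
  rw [lapKernel_zero c p hz, smul_smul]

/-- The integrand has the explicit antiderivative `rⁿ (r² + ε²)^(-n/2) / n`. -/
lemma integral_newton_radial {n : ℕ} (hn : 1 ≤ n) {ε δ : ℝ} (hε : 0 < ε) :
    ∫ r in (0 : ℝ)..δ, r ^ (n - 1) * (ε ^ 2 * (r ^ 2 + ε ^ 2) ^ (-((n : ℝ) / 2 + 1))) =
      δ ^ n * (δ ^ 2 + ε ^ 2) ^ (-((n : ℝ) / 2)) / n := by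
  have hn0 : (n : ℝ) ≠ 0 := by positivity
  have hder : ∀ r : ℝ, HasDerivAt (fun r : ℝ => r ^ n * (r ^ 2 + ε ^ 2) ^ (-((n : ℝ) / 2)) / n)
      (r ^ (n - 1) * (ε ^ 2 * (r ^ 2 + ε ^ 2) ^ (-((n : ℝ) / 2 + 1)))) r := by
    intro r
    have hb : 0 < r ^ 2 + ε ^ 2 := by positivity
    have h1 : HasDerivAt (fun r : ℝ => r ^ 2 + ε ^ 2) (2 * r) r := by
      simpa using (hasDerivAt_pow 2 r).add_const (ε ^ 2)
    have h2 := h1.rpow_const (p := -((n : ℝ) / 2)) (Or.inl hb.ne')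
    have h3 := ((hasDerivAt_pow n r).mul h2).div_const (n : ℝ)
    refine h3.congr_deriv ?_
    have h4 : (r ^ 2 + ε ^ 2) ^ (-((n : ℝ) / 2)) =
        (r ^ 2 + ε ^ 2) * (r ^ 2 + ε ^ 2) ^ (-((n : ℝ) / 2 + 1)) := by
      rw [show -((n : ℝ) / 2) = 1 + -((n : ℝ) / 2 + 1) by ring, Real.rpow_add hb, Real.rpow_one]
    have h5 : r ^ n = r ^ (n - 1) * r := by
      rw [← pow_succ, Nat.sub_add_cancel hn]
    rw [h4, show -((n : ℝ) / 2) - 1 = -((n : ℝ) / 2 + 1) by ring, h5]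
    field_simp
    ring
  rw [intervalIntegral.integral_eq_sub_of_hasDerivAt (fun r _ => hder r)]
  · rw [zero_pow (by omega)]
    ring
  · refine Continuous.intervalIntegrable ?_ _ _
    refine (continuous_pow _).mul (continuous_const.mul ?_)
    exact Continuous.rpow_const (by fun_prop) fun r => Or.inl (by positivity)

/-- The limit does not depend on `δ`: all mass concentrates at the origin. -/
lemma tendsto_setIntegral_newton [Nontrivial E] {p : ℝ} (hpn : 2 * p + 2 = finrank ℝ E) {δ : ℝ}
    (hδ : 0 < δ) :
    Tendsto (fun m => ∫ z in ball (0 : E) δ, regSeq m ^ 2 * powerKernel (p + 2) (regSeq m) z) atTop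
      (𝓝 (unitBallVolume (finrank ℝ E))) := by
  have hn : 1 ≤ finrank ℝ E := finrank_pos
  have hn0 : (finrank ℝ E : ℝ) ≠ 0 := by positivity
  have hp2 : p + 2 = (finrank ℝ E : ℝ) / 2 + 1 := by linarith
  have h1 : ∀ m, ∫ z in ball (0 : E) δ, regSeq m ^ 2 * powerKernel (p + 2) (regSeq m) z =
      unitBallVolume (finrank ℝ E) *
        (δ ^ finrank ℝ E * (δ ^ 2 + regSeq m ^ 2) ^ (-((finrank ℝ E : ℝ) / 2))) := by
    intro m
    set ε := regSeq m
    have hε : 0 < ε := regSeq_pos m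
    have h2 : ∀ z : E, (ball (0 : E) δ).indicator
        (fun z => ε ^ 2 * powerKernel (p + 2) ε z) z =
        (Iio δ).indicator (fun r => ε ^ 2 * (r ^ 2 + ε ^ 2) ^ (-((finrank ℝ E : ℝ) / 2 + 1))) ‖z‖ := by
      intro z
      rw [← hp2]
      simp [indicator, powerKernel]
    rw [← integral_indicator measurableSet_ball]
    simp_rw [h2]
    rw [integral_fun_norm_addHaar volume, volume_real_ball _ one_pos]
    have h3 : ∫ y in Ioi (0 : ℝ), y ^ (finrank ℝ E - 1) •
        (Iio δ).indicator (fun r => ε ^ 2 * (r ^ 2 + ε ^ 2) ^ (-((finrank ℝ E : ℝ) / 2 + 1))) y =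
        ∫ r in (0 : ℝ)..δ, r ^ (finrank ℝ E - 1) *
          (ε ^ 2 * (r ^ 2 + ε ^ 2) ^ (-((finrank ℝ E : ℝ) / 2 + 1))) := by
      rw [intervalIntegral.integral_of_le hδ.le, integral_Ioc_eq_integral_Ioo,
        ← integral_indicator measurableSet_Ioo, ← integral_indicator measurableSet_Ioi]
      congr 1 with y
      by_cases h0 : 0 < y <;> by_cases h1 : y < δ <;> simp [indicator, h0, h1]
    rw [h3, integral_newton_radial hn hε, one_pow, one_mul, nsmul_eq_mul, smul_eq_mul]
    field_simp
  simp_rw [h1]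
  have h4 : ContinuousAt (fun ε : ℝ => unitBallVolume (finrank ℝ E) *
        (δ ^ finrank ℝ E * (δ ^ 2 + ε ^ 2) ^ (-((finrank ℝ E : ℝ) / 2)))) 0 := by
    refine continuousAt_const.mul (continuousAt_const.mul ?_)
    exact ContinuousAt.rpow_const (by fun_prop) (Or.inl (by positivity))
  have h5 := h4.tendsto.comp tendsto_regSeq
  have h6 : δ ^ finrank ℝ E * (δ ^ 2 + 0 ^ 2) ^ (-((finrank ℝ E : ℝ) / 2)) = 1 := by
    rw [zero_pow two_ne_zero, add_zero, ← Real.rpow_natCast δ 2, ← Real.rpow_mul hδ.le,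
      ← Real.rpow_natCast, ← Real.rpow_add hδ]
    rw [show (finrank ℝ E : ℝ) + ((2 : ℕ) : ℝ) * -((finrank ℝ E : ℝ) / 2) = 0 by push_cast; ring,
      Real.rpow_zero]
  rw [h6, mul_one] at h5
  exact h5

/-- The Poisson equation for Newtonian and logarithmic potentials. -/
theorem laplacian_potential_of_eq (hψ : IsBallDensity ψ) [Nontrivial E] {A lam : ℝ}
    (hlam : 0 < lam) (hA : 0 < A)
    (hH : ∀ x ∈ ball (0 : E) 1, ∀ y ∈ ball (0 : E) 1, ‖ψ x - ψ y‖ ≤ A * ‖x - y‖ ^ lam)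
    {g : ℝ → E → ℝ} {c p : ℝ} (hg : IsRegularization g c p) (hp : 0 ≤ p)
    (hpn : 2 * p + 2 = finrank ℝ E) :
    ContDiffOn ℝ 2 (potential (g 0) ψ) (ball 0 1) ∧ ∀ x ∈ ball (0 : E) 1,
      Laplacian.laplacian (potential (g 0) ψ) x =
        (c * (finrank ℝ E * unitBallVolume (finrank ℝ E))) • ψ x := by
  have hκ' : ∀ δ : ℝ, 0 < δ →
      Tendsto (fun m => ∫ z in ball (0 : E) δ, lapKernel c p (regSeq m) z) atTop
        (𝓝 (c * (finrank ℝ E * unitBallVolume (finrank ℝ E)))) := by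
    intro δ hδ
    rw [← mul_assoc]
    refine ((tendsto_setIntegral_newton hpn hδ).const_mul (c * finrank ℝ E)).congr fun m => ?_
    rw [← integral_const_mul]
    refine integral_congr_ae (ae_restrict_of_ae ?_)
    filter_upwards [Measure.ae_ne volume (0 : E)] with z hz
    rw [lapKernel_newton hpn _ hz]
  obtain ⟨h1, h2⟩ := contDiffOn_potential hψ hlam hA hH hg hp hpn.le fun δ hδ => ⟨_, hκ' δ hδ⟩
  refine ⟨h1, fun x hx => tendsto_nhds_unique (h2 x hx) ?_⟩
  have hx1 : ‖x‖ < 1 := by simpa using hx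
  set δ := (1 - ‖x‖) / 2 with hδd
  have hδ : 0 < δ := by linarith
  have hδ1 : δ ≤ 1 := by linarith [norm_nonneg x]
  have hxδ : x ∈ ball (0 : E) (1 - δ) := by
    rw [mem_ball_zero_iff]
    linarith
  have h3 := (tendstoUniformlyOn_localDifference hψ hlam hA hH hpn.le hδ hδ1
    (fun m => measurable_lapKernel c p (regSeq m)) (measurable_lapKernel c p 0)
    (C := finrank ℝ E * (|c| * (1 + 2 * (p + 1))))
    (fun m z hz => by
      rw [mul_assoc]
      exact abs_lapKernel_le c hp _ hz)
    (fun z hz => tendsto_lapKernel c p tendsto_regSeq hz)).tendsto_at hxδ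
  -- The limiting kernel vanishes off the origin, so only the concentrated mass times `ψ x` remains.
  have h4 : ∫ z, lapKernel c p 0 z • localDifference ψ δ x z = 0 := by
    refine integral_eq_zero_of_ae ?_
    filter_upwards [Measure.ae_ne volume (0 : E)] with z hz
    rw [lapKernel_newton hpn 0 hz]
    simp
  rw [h4] at h3
  have h5 := h3.add ((hκ' δ hδ).smul_const (ψ x))
  rw [zero_add] at h5
  refine h5.congr fun m => (potential_eq_localDifference hψ ?_ δ x).symm
  have hq : ∀ q, Continuous (powerKernel q (regSeq m) : E → ℝ) := fun q =>
    (contDiff_powerKernel q (regSeq_pos m)).continuous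
  have := hq (p + 1)
  have := hq (p + 2)
  unfold lapKernel
  fun_prop

end Laplacians

/-! ### Calculus of iterated classical Laplacians on an open set. -/

section IteratedLaplacian

variable {n : ℕ} {𝕜 : Type*} [RCLike 𝕜]

local notation "ℰ" => EuclideanSpace ℝ (Fin n)

/-- `(-Δ)^m u` exists in the classical sense on `U` and equals `w` there. -/
def IsLaplacianPow (m : ℕ) (u : ℰ → 𝕜) (U : Set ℰ) (w : ℰ → 𝕜) : Prop :=
  HasClassicalLaplacianPow m u U ∧ EqOn (negLaplacian^[m] u) w U

variable {U : Set (EuclideanSpace ℝ (Fin n))} {u v w : EuclideanSpace ℝ (Fin n) → 𝕜} {m : ℕ}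

/-- The Laplacian sees only the germ of a function, so identities known just on the ball survive
iteration. -/
lemma negLaplacian_congr (hU : IsOpen U) (h : EqOn u v U) :
    EqOn (negLaplacian u) (negLaplacian v) U := by
  intro x hx
  rw [negLaplacian, negLaplacian, (InnerProductSpace.laplacian_congr_nhds
    (h.eventuallyEq_of_mem (hU.mem_nhds hx))).eq_of_nhds]

lemma iterate_negLaplacian_congr (hU : IsOpen U) (h : EqOn u v U) (k : ℕ) :
    EqOn (negLaplacian^[k] u) (negLaplacian^[k] v) U := by
  induction k with
  | zero => exact h
  | succ k ih =>
    rw [Function.iterate_succ_apply', Function.iterate_succ_apply']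
    exact negLaplacian_congr hU ih

lemma negLaplacian_smul (hU : IsOpen U) (hu : ContDiffOn ℝ 2 u U) (a : ℝ) :
    EqOn (negLaplacian (a • u)) (a • negLaplacian u) U := by
  intro x hx
  rw [Pi.smul_apply, negLaplacian, negLaplacian,
    InnerProductSpace.laplacian_smul a (hu.contDiffAt (hU.mem_nhds hx)), smul_neg]

lemma IsLaplacianPow.zero : IsLaplacianPow 0 u U u :=
  ⟨fun _ hk => absurd hk (Nat.not_lt_zero _), fun _ _ => rfl⟩

lemma IsLaplacianPow.congr (hU : IsOpen U) (h : IsLaplacianPow m v U w) (huv : EqOn u v U) :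
    IsLaplacianPow m u U w :=
  ⟨fun k hk => (h.1 k hk).congr (iterate_negLaplacian_congr hU huv k),
    (iterate_negLaplacian_congr hU huv m).trans h.2⟩

lemma IsLaplacianPow.succ (hu : ContDiffOn ℝ 2 u U) (h : IsLaplacianPow m (negLaplacian u) U w) :
    IsLaplacianPow (m + 1) u U w := by
  refine ⟨fun k hk => ?_, h.2⟩
  cases k with
  | zero => exact hu
  | succ k => exact h.1 k (by omega)

lemma IsLaplacianPow.smul (hU : IsOpen U) (h : IsLaplacianPow m u U w) (a : ℝ) :
    IsLaplacianPow m (a • u) U (a • w) := by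
  induction m generalizing u with
  | zero => exact ⟨fun _ hk => absurd hk (Nat.not_lt_zero _), fun x hx => congrArg (a • ·) (h.2 hx)⟩
  | succ m ih =>
    have hu : ContDiffOn ℝ 2 u U := h.1 0 (Nat.succ_pos m)
    have h' : IsLaplacianPow m (negLaplacian u) U w := ⟨fun k hk => h.1 (k + 1) (by omega), h.2⟩
    exact .succ (hu.const_smul a) ((ih h').congr hU (negLaplacian_smul hU hu a))

/-- At least one Laplacian is needed to remove the constant, hence `m + 1`. -/
lemma IsLaplacianPow.add_const (hU : IsOpen U) (h : IsLaplacianPow (m + 1) u U w) (b : 𝕜) :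
    IsLaplacianPow (m + 1) (fun x => u x + b) U w := by
  have hu : ContDiffOn ℝ 2 u U := h.1 0 (Nat.succ_pos m)
  have h' : IsLaplacianPow m (negLaplacian u) U w := ⟨fun k hk => h.1 (k + 1) (by omega), h.2⟩
  refine .succ (hu.add contDiffOn_const) (h'.congr hU fun x hx => ?_)
  have h2 := (hu.contDiffAt (hU.mem_nhds hx)).laplacian_add
    (contDiffAt_const (c := b) (x := x) (n := 2) (𝕜 := ℝ))
  have h3 : Laplacian.laplacian (fun _ : ℰ => b) x = 0 := by
    rw [InnerProductSpace.laplacian_const]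
    rfl
  rw [h3, add_zero] at h2
  exact congrArg Neg.neg h2

end IteratedLaplacian

/-! ### Iterated Laplacians of Riesz potentials. -/

section Potentials

variable {n : ℕ} {𝕜 : Type*} [RCLike 𝕜]

local notation "ℰ" => EuclideanSpace ℝ (Fin n)

variable {ψ : EuclideanSpace ℝ (Fin n) → 𝕜} {A lam : ℝ}

/-- The iterated Laplacian of a Riesz potential which ends at the Newtonian potential. -/
theorem isLaplacianPow_potential [Nontrivial ℰ] (hψ : IsBallDensity ψ) (hlam : 0 < lam)
    (hA : 0 < A)
    (hH : ∀ x ∈ ball (0 : ℰ) 1, ∀ y ∈ ball (0 : ℰ) 1, ‖ψ x - ψ y‖ ≤ A * ‖x - y‖ ^ lam) (j : ℕ) :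
    ∀ {p : ℝ}, 0 < p → 2 * p + 2 * j + 2 = n →
      IsLaplacianPow (j + 1) (potential (powerKernel p 0) ψ) (ball 0 1)
        ((n * unitBallVolume n * (2 ^ (2 * j + 1) * j.factorial * Real.Gamma (p + j + 1) /
          Real.Gamma p)) • ψ) := by
  have hfin : finrank ℝ ℰ = n := by simp
  induction j with
  | zero =>
    intro p hp hpn
    have hpn' : 2 * p + 2 = finrank ℝ ℰ := by rw [hfin, ← hpn]; simp
    obtain ⟨h1, h2⟩ := laplacian_potential_of_eq hψ hlam hA hH
      (isRegularization_powerKernel hp.le hpn'.le) hp.le hpn'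
    refine .succ h1 (IsLaplacianPow.zero.congr isOpen_ball fun x hx => ?_)
    have hg : Real.Gamma p ≠ 0 := (Real.Gamma_pos_of_pos hp).ne'
    rw [negLaplacian, h2 x hx, hfin, ← neg_smul, Pi.smul_apply]
    congr 1
    simp only [Nat.cast_zero, add_zero, mul_zero, zero_add, pow_one, Nat.factorial_zero,
      Nat.cast_one, mul_one]
    rw [Real.Gamma_add_one hp.ne']
    field_simp
  | succ j ih =>
    intro p hp hpn
    push_cast at hpn
    have hpn' : 2 * p + 2 < finrank ℝ ℰ := by
      rw [hfin, ← hpn]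
      linarith [(Nat.cast_nonneg j : (0 : ℝ) ≤ j)]
    obtain ⟨h1, h2⟩ := laplacian_potential_of_lt hψ hlam hA hH
      (isRegularization_powerKernel hp.le hpn'.le) hp.le hpn'
    -- `-Δ` multiplies the kernel with exponent `2p` by `2p (n - 2p - 2)` and raises `p` by one;
    -- here `n - 2p - 2 = 2(j + 1)`.
    have h3 := (ih (p := p + 1) (by linarith) (by linarith)).smul isOpen_ball
      (2 * p * (2 * (j + 1)))
    have hg : Real.Gamma p ≠ 0 := (Real.Gamma_pos_of_pos hp).ne'
    refine .succ h1 ?_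
    convert h3.congr isOpen_ball (u := negLaplacian (potential (powerKernel p 0) ψ))
      (fun x hx => ?_) using 1
    · rw [smul_smul]
      congr 1
      rw [Real.Gamma_add_one hp.ne', Nat.factorial_succ, Nat.cast_succ,
        show p + (j + 1 : ℝ) + 1 = p + 1 + j + 1 by ring]
      push_cast
      field_simp
      ring
    · rw [negLaplacian, h2 x hx, hfin, ← neg_smul, Pi.smul_apply]
      congr 1
      rw [← hpn]
      ring

end Potentials

/-! ### Evaluation of the constants. -/

section Constants

/-- Matches the area `σ_{d-1}` used in the dual Radon transform. -/
lemma mul_unitBallVolume {d : ℕ} (hd : 0 < d) :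
    d * unitBallVolume d = 2 * Real.pi ^ ((d : ℝ) / 2) / Real.Gamma ((d : ℝ) / 2) := by
  have h0 : (0 : ℝ) < d := by exact_mod_cast hd
  have h1 : Real.Gamma ((d : ℝ) / 2) ≠ 0 := (Real.Gamma_pos_of_pos (by positivity)).ne'
  have h2 : √Real.pi ^ d = Real.pi ^ ((d : ℝ) / 2) := by
    rw [Real.sqrt_eq_rpow, ← Real.rpow_natCast, ← Real.rpow_mul Real.pi_pos.le]
    congr 1
    ring
  rw [unitBallVolume, h2, Real.Gamma_add_one (by positivity)]
  field_simp

lemma unitBallVolume_even (j : ℕ) : unitBallVolume (2 * j) = Real.pi ^ j / j.factorial := by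
  rw [unitBallVolume, pow_mul, Real.sq_sqrt Real.pi_pos.le]
  push_cast
  rw [mul_div_cancel_left₀ _ two_ne_zero, Real.Gamma_nat_eq_factorial]

/-- The first bracket is the backprojection constant, the second that of `j + 1` Laplacians from `p
= 1/2`. Both `n * unitBallVolume n` and `Γ(n/2)` cancel, and the volume in the even dimension `n -
1` is elementary. -/
lemma oddConst_mul {j n : ℕ} (hn : n = 2 * j + 3) :
    oddConst n * (((n * unitBallVolume n)⁻¹ * ((n - 1) * unitBallVolume (n - 1))) *
      (n * unitBallVolume n * (2 ^ (2 * j + 1) * j.factorial * Real.Gamma (1 / 2 + j + 1) /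
        Real.Gamma (1 / 2)))) = 1 := by
  have h0 : (n : ℝ) * unitBallVolume n ≠ 0 := by
    have := unitBallVolume_pos n
    have : (0 : ℝ) < n := by rw [hn]; positivity
    positivity
  have h1 : (1 / 2 + j + 1 : ℝ) = n / 2 := by
    rw [hn]
    push_cast
    ring
  have h2 : Real.Gamma ((n : ℝ) / 2) ≠ 0 :=
    (Real.Gamma_pos_of_pos (by rw [← h1]; positivity)).ne'
  have h3 : Real.pi ^ (1 - (n : ℝ) / 2) = (Real.pi ^ j * √Real.pi)⁻¹ := by
    rw [Real.sqrt_eq_rpow, ← Real.rpow_natCast, ← Real.rpow_add Real.pi_pos,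
      ← Real.rpow_neg Real.pi_pos.le, ← h1]
    congr 1
    ring
  have h4 : √Real.pi ^ 2 = Real.pi := Real.sq_sqrt Real.pi_pos.le
  have h5 : √Real.pi ≠ 0 := (Real.sqrt_pos.2 Real.pi_pos).ne'
  have h6 : (j.factorial : ℝ) ≠ 0 := by exact_mod_cast j.factorial_ne_zero
  have h7 := Real.pi_pos.ne'
  have h8 : (n : ℝ) - 1 = 2 * (j + 1) := by
    rw [hn]
    push_cast
    ring
  have h9 : (j + 1 : ℝ) ≠ 0 := by positivity
  rw [h1, Real.Gamma_one_half_eq, h8, show n - 1 = 2 * (j + 1) by omega, unitBallVolume_even,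
    oddConst, h3, show n - 1 = 2 * j + 2 by omega, Nat.factorial_succ]
  push_cast
  generalize (n : ℝ) * unitBallVolume n = c at *
  generalize Real.Gamma ((n : ℝ) / 2) = d at *
  field_simp
  rw [h4]
  ring

lemma evenConst_eq {j n : ℕ} (hn : n = 2 * j + 2) :
    evenConst n = -(Real.pi ^ (j + 1) * 2 ^ (2 * j + 1) * j.factorial)⁻¹ := by
  have h1 : Real.pi ^ (-(n : ℝ) / 2) = (Real.pi ^ (j + 1))⁻¹ := by
    rw [← Real.rpow_natCast, ← Real.rpow_neg Real.pi_pos.le, hn]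
    congr 1
    push_cast
    ring
  have h2 : (n : ℝ) / 2 = j + 1 := by
    rw [hn]
    push_cast
    ring
  rw [evenConst, h1, h2, Real.Gamma_nat_eq_factorial, show n - 1 = 2 * j + 1 by omega, mul_assoc,
    mul_inv (Real.pi ^ (j + 1)), div_eq_mul_inv]

lemma evenConst_two_mul : evenConst 2 * -(2 * unitBallVolume 2) = 1 := by
  have h := unitBallVolume_even 1
  have h2 := Real.pi_pos.ne'
  rw [mul_one] at h
  rw [evenConst_eq (j := 0) rfl, h]
  simp
  field_simp

/-- The factor `-(n - 2)` comes from the first `-Δ`, applied to the logarithm; the rest is the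
constant of `j + 1` Laplacians from `p = 1`. -/
lemma evenConst_mul {j n : ℕ} (hn : n = 2 * j + 4) :
    evenConst n * (-(n - 2) * (n * unitBallVolume n * (2 ^ (2 * j + 1) * j.factorial *
      Real.Gamma (1 + j + 1) / Real.Gamma 1))) = 1 := by
  have h1 : (n : ℝ) = 2 * (j + 2) := by
    rw [hn]
    push_cast
    ring
  have h2 : (1 + j + 1 : ℝ) = (j + 1 : ℕ) + 1 := by
    push_cast
    ring
  have h3 := Real.pi_pos.ne'
  have h6 : (j.factorial : ℝ) ≠ 0 := by exact_mod_cast j.factorial_ne_zero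
  have h9 : (j + 1 : ℝ) ≠ 0 := by positivity
  have h10 : (j + 2 : ℝ) ≠ 0 := by positivity
  rw [evenConst_eq (j := j + 1) (by omega), h2, Real.Gamma_nat_eq_factorial, Real.Gamma_one, h1,
    show n = 2 * (j + 2) by omega, unitBallVolume_even, Nat.factorial_succ (j + 1),
    Nat.factorial_succ j]
  push_cast
  have h11 : (j + 1 + 1 : ℝ) ≠ 0 := by positivity
  field_simp
  ring

end Constants

/-! ### Assembly: the backprojections as potentials, and their inversion. -/

section Inversion

variable {n : ℕ} {𝕜 : Type*} [RCLike 𝕜]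

local notation "ℰ" => EuclideanSpace ℝ (Fin n)

lemma zeroExt_of_mem {φ : EuclideanSpace ℝ (Fin n) → 𝕜} {x : EuclideanSpace ℝ (Fin n)}
    (hx : x ∈ ball 0 1) : zeroExt φ x = φ x := indicator_of_mem hx _

/-- The extension by zero of a Hölder continuous function on the unit ball. -/
lemma isBallDensity_zeroExt {φ : ℰ → 𝕜} {A lam : ℝ} (hlam : 0 < lam) (hA : 0 < A)
    (hH : ∀ x ∈ ball (0 : ℰ) 1, ∀ y ∈ ball (0 : ℰ) 1, ‖φ x - φ y‖ ≤ A * ‖x - y‖ ^ lam) :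
    IsBallDensity (zeroExt φ) := by
  have hcont : ContinuousOn φ (ball 0 1) := by
    intro x hx
    rw [ContinuousWithinAt, tendsto_iff_norm_sub_tendsto_zero]
    have h1 : Tendsto (fun y : ℰ => A * ‖y - x‖ ^ lam) (𝓝[ball 0 1] x) (𝓝 0) := by
      have h2 : ContinuousAt (fun y : ℰ => A * ‖y - x‖ ^ lam) x :=
        continuousAt_const.mul (ContinuousAt.rpow_const (by fun_prop) (Or.inr hlam.le))
      have h3 := h2.tendsto.mono_left (nhdsWithin_le_nhds (s := ball 0 1))
      simpa [Real.zero_rpow hlam.ne'] using h3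
    refine squeeze_zero' (Eventually.of_forall fun _ => norm_nonneg _) ?_ h1
    filter_upwards [self_mem_nhdsWithin] with y hy
    exact hH y hy x hx
  refine ⟨?_, ⟨‖φ 0‖ + A, fun z => ?_⟩, fun z hz => ?_, fun z hz => ?_⟩
  · classical
    borelize 𝕜
    rw [zeroExt, ← piecewise_eq_indicator]
    exact (hcont.measurable_piecewise continuousOn_const measurableSet_ball).stronglyMeasurable
  · by_cases hz : z ∈ ball (0 : ℰ) 1
    · have h1 := hH z hz 0 (mem_ball_self one_pos)
      rw [sub_zero] at h1
      have h2 : ‖z‖ ^ lam ≤ 1 :=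
        Real.rpow_le_one (norm_nonneg _) (mem_ball_zero_iff.1 hz).le hlam.le
      have h3 := norm_le_norm_add_norm_sub' (φ z) (φ 0)
      rw [zeroExt_of_mem hz]
      nlinarith
    · rw [zeroExt, indicator_of_notMem hz, norm_zero]
      positivity
  · exact indicator_of_notMem (by simpa using hz) _
  · rcases lt_or_gt_of_ne hz with h | h
    · have hz' : z ∈ ball (0 : ℰ) 1 := by simpa using h
      exact (hcont.continuousAt (isOpen_ball.mem_nhds hz')).congr
        (eventuallyEq_of_mem (isOpen_ball.mem_nhds hz') fun y hy => (zeroExt_of_mem hy).symm)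
    · refine (continuousAt_const (y := (0 : 𝕜))).congr ?_
      have h1 : {y : ℰ | 1 < ‖y‖} ∈ 𝓝 z := (isOpen_lt continuous_const continuous_norm).mem_nhds h
      filter_upwards [h1] with y hy
      exact (indicator_of_notMem (by simpa using le_of_lt hy) _).symm

lemma inner_sphere_mem_Ioo {x : ℰ} (hx : ‖x‖ < 1) (θ : sphere (0 : ℰ) 1) :
    |inner ℝ x (θ : ℰ)| < 1 := by
  have h1 : ‖(θ : ℰ)‖ = 1 := by simp
  have h2 := abs_real_inner_le_norm x (θ : ℰ)
  rw [h1, mul_one] at h2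
  exact h2.trans_lt hx

variable {f : EuclideanSpace ℝ (Fin (n + 1)) → 𝕜}

/-- Backprojection of the normalized slice transform is a Riesz potential of order `n - 1`. -/
theorem dualRadon_normalizedSlice (hn : 2 ≤ n)
    (hψ : IsBallDensity (zeroExt (hemisphereQuotient f))) :
    EqOn (dualRadon (normalizedSlice f))
      (((n * unitBallVolume n)⁻¹ * ((n - 1) * unitBallVolume (n - 1))) •
        potential (powerKernel (1 / 2) 0) (zeroExt (hemisphereQuotient f))) (ball 0 1) := by
  intro x hx
  have hx1 : ‖x‖ < 1 := by simpa using hx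
  have hfin : finrank ℝ ℰ = n := by simp
  have h1 := integral_sphere_radon hψ (hfin.symm ▸ hn) hx1
  rw [hfin] at h1
  rw [dualRadon, ← mul_unitBallVolume (by omega), Pi.smul_apply, mul_smul]
  congr 1
  have h2 : ∀ θ : sphere (0 : ℰ) 1, normalizedSlice f (θ : ℰ) (inner ℝ x (θ : ℰ)) =
      ∫ y : (ℝ ∙ (θ : ℰ))ᗮ, zeroExt (hemisphereQuotient f) (x + (y : ℰ)) := by
    intro θ
    have hθ : ‖(θ : ℰ)‖ = 1 := by simp
    rw [normalizedSlice_eq_radon hψ.meas hθ (inner_sphere_mem_Ioo hx1 θ),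
      integral_radon_translate hθ]
  simp_rw [h2]
  -- The reflection `z ↦ -z` turns `ψ (x + z)` into the convolution form; `p = 1/2` is the kernel
  -- `|z|⁻¹`.
  rw [h1, potential_eq, ← integral_neg_eq_self]
  congr 2
  ext z
  rw [norm_neg, ← sub_eq_add_neg, powerKernel_zero, show -(2 * (1 / 2) : ℝ) = -1 by norm_num,
    Real.rpow_neg_one]

lemma IsBallDensity.integrable_log_smul [Nontrivial ℰ] {ψ : ℰ → 𝕜} (hψ : IsBallDensity ψ) {x : ℰ}
    (hx : ‖x‖ < 1) : Integrable fun z : ℰ => Real.log ‖z‖ • ψ (x - z) := by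
  obtain ⟨M, hM⟩ := hψ.bound
  have h1 : IntegrableOn (fun z : ℰ => Real.log ‖z‖ • ψ (x - z)) (ball 0 2) :=
    (integrableOn_log_norm_ball 2).smul_bdd M
      (hψ.meas.comp_measurable (by fun_prop)).aestronglyMeasurable
      (Eventually.of_forall fun z => hM _)
  refine h1.integrable_of_forall_notMem_eq_zero fun z hz => ?_
  rw [sub_eq_add_neg, hψ.zero_of_two_le hx (by simpa using hz), smul_zero]

/-- Backprojection of the logarithmic transform of the normalized slice transform is a
logarithmic potential, up to a constant. -/
theorem dualRadon_logTransform_normalizedSlice [Nontrivial ℰ] (hn : 2 ≤ n)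
    (hψ : IsBallDensity (zeroExt (hemisphereQuotient f))) :
    ∃ b : 𝕜, EqOn (dualRadon (logTransform (normalizedSlice f)))
      (fun x => potential (logKernel 0) (zeroExt (hemisphereQuotient f)) x + b) (ball 0 1) := by
  have hfin : finrank ℝ ℰ = n := by simp
  set ψ := zeroExt (hemisphereQuotient f) with hψdef
  obtain ⟨e, he⟩ := exists_norm_eq ℰ zero_le_one
  have h0 : (n : ℝ) * unitBallVolume n ≠ 0 := by
    have := unitBallVolume_pos n
    have : (0 : ℝ) < n := by exact_mod_cast (by omega : 0 < n)
    positivity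
  -- The constant part of the spherical logarithmic average, integrated against `ψ`, no longer
  -- depends on `x`.
  refine ⟨(n * unitBallVolume n)⁻¹ • sphereLogIntegral e • ∫ z, ψ z, fun x hx => ?_⟩
  have hx1 : ‖x‖ < 1 := by simpa using hx
  have h1 := integral_sphere_log_radon hψ (hfin.symm ▸ hn) hx1 he
  rw [hfin] at h1
  have h2 : ∀ θ : sphere (0 : ℰ) 1,
      logTransform (normalizedSlice f) (θ : ℰ) (inner ℝ x (θ : ℰ)) =
        ∫ t in (-1 : ℝ)..1, Real.log |inner ℝ x (θ : ℰ) - t| •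
          ∫ y : (ℝ ∙ (θ : ℰ))ᗮ, ψ (t • (θ : ℰ) + (y : ℰ)) := by
    intro θ
    refine intervalIntegral.integral_congr_ae ?_
    -- The interval is half-open at 1, whereas the Radon identity needs `|t| < 1`.
    filter_upwards [Measure.ae_ne volume (1 : ℝ)] with t ht ht'
    rw [uIoc_of_le (by norm_num)] at ht'
    rw [normalizedSlice_eq_radon hψ.meas (by simp) (abs_lt.2 ⟨ht'.1, lt_of_le_of_ne ht'.2 ht⟩)]
  rw [dualRadon, ← mul_unitBallVolume (by omega)]
  simp_rw [h2]
  have h3 : ∫ z, (n * unitBallVolume n * Real.log ‖z‖ + sphereLogIntegral e) • ψ (x + z) =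
      ((n : ℝ) * unitBallVolume n) • potential (logKernel 0) ψ x +
        sphereLogIntegral e • ∫ z, ψ z := by
    rw [potential_eq, ← integral_sub_left_eq_self ψ volume x, ← integral_smul, ← integral_smul,
      ← integral_neg_eq_self, ← integral_add]
    · refine integral_congr_ae (Eventually.of_forall fun z => ?_)
      simp only [norm_neg, logKernel_zero, ← sub_eq_add_neg]
      rw [add_smul, mul_smul]
    · simp_rw [logKernel_zero]
      exact (hψ.integrable_log_smul hx1).smul _
    · exact (hψ.integrable.comp_sub_left x).smul _
  rw [h1, h3, smul_add, inv_smul_smul₀ h0]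

theorem isLaplacianPow_dualRadon [Nontrivial ℰ] {j : ℕ} (hn : n = 2 * j + 3) {A lam : ℝ}
    (hlam : 0 < lam) (hA : 0 < A)
    (hH : ∀ x ∈ ball (0 : ℰ) 1, ∀ y ∈ ball (0 : ℰ) 1,
      ‖hemisphereQuotient f x - hemisphereQuotient f y‖ ≤ A * ‖x - y‖ ^ lam) :
    ∃ a : ℝ, oddConst n * a = 1 ∧ IsLaplacianPow (j + 1) (dualRadon (normalizedSlice f)) (ball 0 1)
      (a • zeroExt (hemisphereQuotient f)) := by
  have hψ := isBallDensity_zeroExt hlam hA hH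
  refine ⟨_, oddConst_mul hn, ?_⟩
  rw [mul_smul]
  refine ((isLaplacianPow_potential hψ hlam hA ?_ j one_half_pos ?_).smul isOpen_ball _).congr
    isOpen_ball (dualRadon_normalizedSlice (by omega) hψ)
  · intro x hx y hy
    rw [zeroExt_of_mem hx, zeroExt_of_mem hy]
    exact hH x hx y hy
  · rw [hn]
    push_cast
    ring

theorem isLaplacianPow_dualRadon_logTransform [Nontrivial ℰ] {j : ℕ} (hn : n = 2 * j + 2)
    {A lam : ℝ} (hlam : 0 < lam) (hA : 0 < A)
    (hH : ∀ x ∈ ball (0 : ℰ) 1, ∀ y ∈ ball (0 : ℰ) 1,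
      ‖hemisphereQuotient f x - hemisphereQuotient f y‖ ≤ A * ‖x - y‖ ^ lam) :
    ∃ a : ℝ, evenConst n * a = 1 ∧
      IsLaplacianPow (j + 1) (dualRadon (logTransform (normalizedSlice f))) (ball 0 1)
        (a • zeroExt (hemisphereQuotient f)) := by
  have hψ := isBallDensity_zeroExt hlam hA hH
  have hfin : finrank ℝ ℰ = n := by simp
  have hH' : ∀ x ∈ ball (0 : ℰ) 1, ∀ y ∈ ball (0 : ℰ) 1,
      ‖zeroExt (hemisphereQuotient f) x - zeroExt (hemisphereQuotient f) y‖ ≤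
        A * ‖x - y‖ ^ lam := by
    intro x hx y hy
    rw [zeroExt_of_mem hx, zeroExt_of_mem hy]
    exact hH x hx y hy
  obtain ⟨b, hb⟩ := dualRadon_logTransform_normalizedSlice (by omega) hψ
  suffices h : ∃ a : ℝ, evenConst n * a = 1 ∧ IsLaplacianPow (j + 1)
      (potential (logKernel 0) (zeroExt (hemisphereQuotient f))) (ball 0 1)
        (a • zeroExt (hemisphereQuotient f)) by
    obtain ⟨a, ha, h⟩ := h
    exact ⟨a, ha, (h.add_const isOpen_ball b).congr isOpen_ball hb⟩
  -- For `n = 2` the logarithm is already the Newtonian kernel. For `n ≥ 4` the first Laplacian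
  -- yields a multiple of `|z|⁻²`, the power kernel with `p = 1`.
  cases j with
  | zero =>
    have hn2 : n = 2 := by omega
    have hpn : 2 * (0 : ℝ) + 2 = finrank ℝ ℰ := by rw [hfin, hn2]; norm_num
    obtain ⟨h1, h2⟩ := laplacian_potential_of_eq hψ hlam hA hH' isRegularization_logKernel le_rfl
      hpn
    refine ⟨-(n * unitBallVolume n), ?_, .succ h1 (IsLaplacianPow.zero.congr isOpen_ball
      fun x hx => ?_)⟩
    · rw [hn2]
      exact_mod_cast evenConst_two_mul
    · rw [negLaplacian, h2 x hx, hfin, one_mul, Pi.smul_apply, neg_smul]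
  | succ j =>
    have hn4 : n = 2 * j + 4 := by omega
    have hpn : 2 * (0 : ℝ) + 2 < finrank ℝ ℰ := by
      rw [hfin, hn4]
      push_cast
      linarith [(Nat.cast_nonneg j : (0 : ℝ) ≤ j)]
    obtain ⟨h1, h2⟩ := laplacian_potential_of_lt hψ hlam hA hH' isRegularization_logKernel le_rfl
      hpn
    refine ⟨_, evenConst_mul hn4, .succ h1 ?_⟩
    rw [mul_smul]
    refine ((isLaplacianPow_potential hψ hlam hA hH' j one_pos ?_).smul isOpen_ball _).congr
      isOpen_ball fun x hx => ?_
    · rw [hn4]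
      push_cast
      ring
    · rw [negLaplacian, h2 x hx, hfin, ← neg_smul, Pi.smul_apply, zero_add]
      congr 1
      ring

/-- Recovery of an even function on the sphere from its hemisphere quotient. -/
lemma eq_abs_smul_zeroExt
    (hf : ∀ x ∈ sphere (0 : EuclideanSpace ℝ (Fin (n + 1))) 1,
      f (mkPoint (horiz x) (-x (Fin.last n))) = f x)
    {x : EuclideanSpace ℝ (Fin (n + 1))} (hx : x ∈ sphere 0 1) (hx0 : x (Fin.last n) ≠ 0) :
    horiz x ∈ ball (0 : ℰ) 1 ∧
      f x = |x (Fin.last n)| • zeroExt (hemisphereQuotient f) (horiz x) := by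
  have h1 : ‖horiz x‖ ^ 2 + x (Fin.last n) ^ 2 = 1 := by
    rw [← norm_sq_mkPoint, mkPoint_horiz, mem_sphere_zero_iff_norm.1 hx, one_pow]
  have h2 : √(1 - ‖horiz x‖ ^ 2) = |x (Fin.last n)| := by
    rw [← h1, add_sub_cancel_left, Real.sqrt_sq_eq_abs]
  have h3 : horiz x ∈ ball (0 : ℰ) 1 := by
    have h4 : 0 < x (Fin.last n) ^ 2 := by positivity
    rw [mem_ball_zero_iff]
    nlinarith [norm_nonneg (horiz x)]
  refine ⟨h3, ?_⟩
  rw [zeroExt_of_mem h3, hemisphereQuotient, h2, smul_inv_smul₀ (abs_ne_zero.2 hx0)]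
  -- Evenness is needed only here, to pass from the lower hemisphere to the upper.
  rcases abs_choice (x (Fin.last n)) with h | h
  · rw [h, mkPoint_horiz]
  · rw [h, hf x hx]

end Inversion

end VerticalSlice

end

theorem theorem2p6 {𝕜 : Type*} [RCLike 𝕜] (n : ℕ) (hn : 2 ≤ n)
    (f : EuclideanSpace ℝ (Fin (n + 1)) → 𝕜)
    (hf_even : ∀ x ∈ Metric.sphere (0 : EuclideanSpace ℝ (Fin (n + 1))) 1,
      f (VerticalSlice.mkPoint (VerticalSlice.horiz x) (-x (Fin.last n))) = f x)
    (lam : ℝ) (hlam_pos : 0 < lam) (hlam_le : lam ≤ 1)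
    (hLip : VerticalSlice.IsLip lam (VerticalSlice.hemisphereQuotient f)
      (Metric.ball (0 : EuclideanSpace ℝ (Fin n)) 1)) :
    (Odd n →
      VerticalSlice.HasClassicalLaplacianPow ((n - 1) / 2)
        (VerticalSlice.dualRadon (VerticalSlice.normalizedSlice f))
        (Metric.ball (0 : EuclideanSpace ℝ (Fin n)) 1) ∧
      ∀ x ∈ Metric.sphere (0 : EuclideanSpace ℝ (Fin (n + 1))) 1, x (Fin.last n) ≠ 0 →
        f x = |x (Fin.last n)| • (VerticalSlice.oddConst n •
          (VerticalSlice.negLaplacian^[(n - 1) / 2]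
            (VerticalSlice.dualRadon (VerticalSlice.normalizedSlice f)))
              (VerticalSlice.horiz x))) ∧
    (Even n →
      VerticalSlice.HasClassicalLaplacianPow (n / 2)
        (VerticalSlice.dualRadon
          (VerticalSlice.logTransform (VerticalSlice.normalizedSlice f)))
        (Metric.ball (0 : EuclideanSpace ℝ (Fin n)) 1) ∧
      ∀ x ∈ Metric.sphere (0 : EuclideanSpace ℝ (Fin (n + 1))) 1, x (Fin.last n) ≠ 0 →
        f x = |x (Fin.last n)| • (VerticalSlice.evenConst n •
          (VerticalSlice.negLaplacian^[n / 2]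
            (VerticalSlice.dualRadon
              (VerticalSlice.logTransform (VerticalSlice.normalizedSlice f))))
                (VerticalSlice.horiz x))) := by

  obtain ⟨A, hA, hH⟩ := hLip
  have : Nontrivial (EuclideanSpace ℝ (Fin n)) :=
    Module.nontrivial_of_finrank_pos (R := ℝ) (by simp; omega)
  have key : ∀ (a c : ℝ) (m : ℕ) (u : EuclideanSpace ℝ (Fin n) → 𝕜), c * a = 1 →
      VerticalSlice.IsLaplacianPow m u (ball 0 1)
        (a • VerticalSlice.zeroExt (VerticalSlice.hemisphereQuotient f)) →
      ∀ x ∈ sphere (0 : EuclideanSpace ℝ (Fin (n + 1))) 1, x (Fin.last n) ≠ 0 →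
        f x = |x (Fin.last n)| •
          (c • (VerticalSlice.negLaplacian^[m] u) (VerticalSlice.horiz x)) := by
    intro a c m u hca hu x hx hx0
    obtain ⟨h1, h2⟩ := VerticalSlice.eq_abs_smul_zeroExt hf_even hx hx0
    rw [hu.2 h1, Pi.smul_apply, smul_smul c a, hca, one_smul, ← h2]
  constructor
  · rintro ⟨k, hk⟩
    -- As `n ≥ 2`, an odd `n` is at least 3, so at least one Laplacian is applied.
    obtain ⟨j, rfl⟩ : ∃ j, k = j + 1 := ⟨k - 1, by omega⟩
    obtain ⟨a, ha, h⟩ := VerticalSlice.isLaplacianPow_dualRadon (by omega : n = 2 * j + 3)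
      hlam_pos hA hH
    rw [show (n - 1) / 2 = j + 1 by omega]
    exact ⟨h.1, key _ _ _ _ ha h⟩
  · rintro ⟨k, hk⟩
    obtain ⟨j, rfl⟩ : ∃ j, k = j + 1 := ⟨k - 1, by omega⟩
    obtain ⟨a, ha, h⟩ := VerticalSlice.isLaplacianPow_dualRadon_logTransform
      (by omega : n = 2 * j + 2) hlam_pos hA hH
    rw [show n / 2 = j + 1 by omega]
    exact ⟨h.1, key _ _ _ _ ha h⟩
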